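/- Let $k,n$ be integers with $1\le k$ and $k+1<n$, let $V=\mathbb{C}^n$, let $G(k,V)$ and $G(k+1,V)$ be the Grassmannians of linear subspaces of $V$ of dimension $k$ and $k+1$, and let $F=F(k,k+1,V)$ be the variety of flags $W\subset W'\subset V$ with $\dim W=k$, $\dim W'=k+1$, with projections $h_1:F\to G(k,V)$ and $h_2:F\to G(k+1,V)$. Let $\mathcal{O}(1,1)=h_1^*\mathcal{O}(1)\otimes h_2^*\mathcal{O}(1)$, where $\mathcal{O}(1)$ is the Plücker line bundle, and let $S\in H^0(F,\mathcal{O}(1,1))$ be any section, that is, the restriction to $F$ of a bilinear form on $\bigwedge^kV\times\bigwedge^{k+1}V$. Let $Y_1\subset G(k,V)$ and $Y_2\subset G(k+1,V)$ be the zero loci of the pushforwards $h_{1*}S$ and $h_{2*}S$; in other words, $Y_1$ is the set of those $W\in G(k,V)$ such that $S$ vanishes at every flag $W\subset W'$, and $Y_2$ is the set of those $W'\in G(k+1,V)$ such that $S$ vanishes at every flag $W\subset W'$. Then, in the Grothendieck ring $K_0(\mathrm{Var}/\mathbb{C})$ of varieties over $\mathbb{C}$, with $\mathbb{L}=[\mathbb{A}^1]$,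 $$\mathbb{L}^k[Y_2]-\mathbb{L}^{n-k-1}[Y_1]+[G(k+1,V)][\mathbb{P}^{k-1}]-[G(k,V)][\mathbb{P}^{n-k-2}]=0 .$$ -/

import Mathlib

open AlgebraicGeometry CategoryTheory CategoryTheory.Limits

noncomputable section

/-! ### Varieties over `ℂ` and their Grothendieck ring -/

/-- The base scheme `Spec ℂ`. -/
abbrev SpecC : Scheme.{0} := Spec (CommRingCat.of ℂ)

/-- A variety over `ℂ`: a separated scheme of finite type over `Spec ℂ`
(not necessarily reduced, irreducible or non-empty). -/
structure CVariety where
  /-- the underlying scheme over `Spec ℂ` -/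
  toOver : Over SpecC
  separated : IsSeparated toOver.hom
  locallyOfFiniteType : LocallyOfFiniteType toOver.hom
  quasiCompact : QuasiCompact toOver.hom

namespace CVariety

/-- The variety given by a separated morphism of finite type `X ⟶ Spec ℂ`. -/
def ofHom {X : Scheme.{0}} (f : X ⟶ SpecC) [hs : IsSeparated f] [hf : LocallyOfFiniteType f]
    [hq : QuasiCompact f] : CVariety :=
  ⟨Over.mk f, hs, hf, hq⟩

instance (X : CVariety) : IsSeparated X.toOver.hom := X.separated

instance (X : CVariety) : LocallyOfFiniteType X.toOver.hom := X.locallyOfFiniteType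

instance (X : CVariety) : QuasiCompact X.toOver.hom := X.quasiCompact

/-- The product `X ×_ℂ Y`. -/
def prod (X Y : CVariety) : CVariety :=
  ofHom (pullback.fst X.toOver.hom Y.toOver.hom ≫ X.toOver.hom)

theorem locallyOfFiniteType_spec (R : Type) [CommRing R] [Algebra ℂ R] [Algebra.FiniteType ℂ R] :
    LocallyOfFiniteType (Spec.map (CommRingCat.ofHom (algebraMap ℂ R))) := by
  rw [HasRingHomProperty.Spec_iff (P := @LocallyOfFiniteType), CommRingCat.hom_ofHom,
    RingHom.finiteType_algebraMap]
  infer_instance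

/-- The affine variety `Spec R` of a finitely generated `ℂ`-algebra `R`. -/
def spec (R : Type) [CommRing R] [Algebra ℂ R] [Algebra.FiniteType ℂ R] : CVariety :=
  have := locallyOfFiniteType_spec R
  ofHom (Spec.map (CommRingCat.ofHom (algebraMap ℂ R)))

/-- The point `Spec ℂ`. -/
def point : CVariety := spec ℂ

/-- The affine line `𝔸¹ = Spec ℂ[T]`. -/
def affineLine : CVariety := spec (Polynomial ℂ)

/-- The relations that define the Grothendieck ring as a quotient of the polynomial ring
with one variable for each variety. -/
inductive GrothendieckRel : MvPolynomial CVariety ℤ → Prop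
  /-- `[X] = [Y]` if `X` and `Y` are isomorphic over `ℂ` -/
  | iso (X Y : CVariety) (e : X.toOver ≅ Y.toOver) :
      GrothendieckRel (MvPolynomial.X X - MvPolynomial.X Y)
  /-- `[X] = [Z] + [U]` if `Z` is a closed subvariety of `X` with open complement `U` -/
  | scissor (X Z U : CVariety) (i : Z.toOver ⟶ X.toOver) (j : U.toOver ⟶ X.toOver)
      (hi : IsClosedImmersion i.left) (hj : IsOpenImmersion j.left)
      (hij : Set.range j.left = (Set.range i.left)ᶜ) :
      GrothendieckRel (MvPolynomial.X X - (MvPolynomial.X Z + MvPolynomial.X U))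
  /-- `[X × Y] = [X] [Y]` -/
  | prod (X Y : CVariety) :
      GrothendieckRel (MvPolynomial.X (X.prod Y) - MvPolynomial.X X * MvPolynomial.X Y)
  /-- `[Spec ℂ] = 1` -/
  | point : GrothendieckRel (MvPolynomial.X point - 1)

/-- The Grothendieck ring `K₀(Var/ℂ)` of varieties over `ℂ`: the commutative ring generated by
symbols `[X]`, with `[X] = [Y]` for isomorphic varieties, `[X] = [Z] + [X ∖ Z]` for
closed subvarieties, `[X × Y] = [X] [Y]` and `[Spec ℂ] = 1`. -/
abbrev K0 : Type 1 :=
  MvPolynomial CVariety ℤ ⧸ Ideal.span {p : MvPolynomial CVariety ℤ | GrothendieckRel p}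

/-- The class `[X]` of a variety in the Grothendieck ring. -/
def cls (X : CVariety) : K0 := Ideal.Quotient.mk _ (MvPolynomial.X X)

end CVariety

/-- The Lefschetz class `𝕃 = [𝔸¹]`. -/
def lefschetz : CVariety.K0 := CVariety.affineLine.cls

/-! ### Projective varieties -/

attribute [local instance] MvPolynomial.gradedAlgebra

/-- The projective space with homogeneous coordinates indexed by `σ`, as the scheme
`Proj ℂ[x_i : i ∈ σ]`. -/
abbrev ProjC (σ : Type) : Scheme.{0} := Proj (MvPolynomial.homogeneousSubmodule σ ℂ)

/-- The structure morphism of `ProjC σ` to `Spec ℂ`. -/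
def ProjC.toSpecC (σ : Type) : ProjC σ ⟶ SpecC :=
  Proj.toSpecZero (MvPolynomial.homogeneousSubmodule σ ℂ) ≫
    Spec.map (CommRingCat.ofHom (algebraMap ℂ (MvPolynomial.homogeneousSubmodule σ ℂ 0)))

theorem ProjC.algebraMap_zero_surjective (σ : Type) : Function.Surjective
    (algebraMap ℂ (MvPolynomial.homogeneousSubmodule σ ℂ 0)) := by
  rintro ⟨p, hp⟩
  rw [MvPolynomial.mem_homogeneousSubmodule] at hp
  have h := (MvPolynomial.totalDegree_eq_zero_iff_eq_C (p := p)).1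
    (Nat.le_zero.1 hp.totalDegree_le)
  exact ⟨_, Subtype.ext h.symm⟩

instance ProjC.finiteType_zero (σ : Type) [Finite σ] : Algebra.FiniteType
    (MvPolynomial.homogeneousSubmodule σ ℂ 0) (MvPolynomial σ ℂ) :=
  have : IsScalarTower ℂ (MvPolynomial.homogeneousSubmodule σ ℂ 0) (MvPolynomial σ ℂ) :=
    ⟨fun a b c => smul_mul_assoc a (b : MvPolynomial σ ℂ) c⟩
  Algebra.FiniteType.of_restrictScalars_finiteType ℂ _ _

instance ProjC.locallyOfFiniteType_map (σ : Type) : LocallyOfFiniteType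
    (Spec.map (CommRingCat.ofHom (algebraMap ℂ (MvPolynomial.homogeneousSubmodule σ ℂ 0)))) := by
  rw [HasRingHomProperty.Spec_iff (P := @LocallyOfFiniteType), CommRingCat.hom_ofHom]
  exact RingHom.FiniteType.of_surjective _ (ProjC.algebraMap_zero_surjective σ)

instance ProjC.isSeparated_toSpecC (σ : Type) : IsSeparated (ProjC.toSpecC σ) := by
  unfold ProjC.toSpecC
  infer_instance

instance ProjC.locallyOfFiniteType_toSpecC (σ : Type) [Finite σ] :
    LocallyOfFiniteType (ProjC.toSpecC σ) := by
  unfold ProjC.toSpecC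
  infer_instance

instance ProjC.quasiCompact_toSpecC (σ : Type) [Finite σ] :
    QuasiCompact (ProjC.toSpecC σ) := by
  unfold ProjC.toSpecC
  infer_instance

/-- The projective space `ℙ^m` over `ℂ`. -/
def projectiveSpace (m : ℕ) : CVariety :=
  CVariety.ofHom (ProjC.toSpecC (Fin (m + 1)))

/-- The Zariski closed subset of projective space defined by all homogeneous polynomials that
vanish at each vector of homogeneous coordinates in `A`. -/
def projZeroLocus {σ : Type} (A : Set (σ → ℂ)) : TopologicalSpace.Closeds (ProjC σ) where
  carrier := ProjectiveSpectrum.zeroLocus (MvPolynomial.homogeneousSubmodule σ ℂ)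
    {f | (∃ d, f.IsHomogeneous d) ∧ ∀ a ∈ A, MvPolynomial.eval a f = 0}
  isClosed' := ProjectiveSpectrum.isClosed_zeroLocus _ _

/-- The projective variety with the set of homogeneous coordinate vectors `A`: the closed
subset `projZeroLocus A` with its reduced scheme structure. (If the points with coordinates in `A`
form a Zariski closed subset of projective space, they are the closed points of this variety.) -/
def projVariety {σ : Type} [Finite σ] (A : Set (σ → ℂ)) : CVariety :=
  CVariety.ofHom
    ((Scheme.IdealSheafData.vanishingIdeal (projZeroLocus A)).subschemeι ≫ ProjC.toSpecC σ)

/-! ### Grassmannians and zero loci -/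

/-- The Plücker coordinates of `k` vectors in `ℂⁿ`: the maximal minors of the `k × n` matrix
with rows `w`. -/
def plucker {n k : ℕ} (w : Fin k → Fin n → ℂ) : (Fin k ↪o Fin n) → ℂ :=
  fun I => (Matrix.of fun a b => w a (I b)).det

instance finite_plucker_index (n k : ℕ) : Finite (Fin k ↪o Fin n) :=
  Finite.of_injective (fun I : Fin k ↪o Fin n => (I : Fin k → Fin n)) DFunLike.coe_injective

/-- The subvariety of the Grassmannian `G(k, ℂⁿ)`, in its Plücker embedding, given by a (Zariski
closed) set `𝒲` of `k`-dimensional linear subspaces of `ℂⁿ`. -/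
def grassSubvariety (n k : ℕ) (𝒲 : Set (Submodule ℂ (Fin n → ℂ))) : CVariety :=
  projVariety {p : (Fin k ↪o Fin n) → ℂ | ∃ w : Fin k → Fin n → ℂ,
    LinearIndependent ℂ w ∧ Submodule.span ℂ (Set.range w) ∈ 𝒲 ∧ p = plucker w}

/-- The Grassmannian `G(k, V)` of `k`-dimensional linear subspaces of `V = ℂⁿ`. -/
def grassmannian (n k : ℕ) : CVariety :=
  grassSubvariety n k {W | Module.finrank ℂ W = k}

/-- Bilinear forms on `⋀ᵏV × ⋀ᵏ⁺¹V`, for `V = ℂⁿ`. Such a form is a form of bidegree `(1, 1)` in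
the Plücker coordinates of `G(k, V)` and `G(k+1, V)`; restricted to the flag variety
`F = F(k, k+1, V)` it is a global section of the line bundle `𝒪(1, 1)`, and each global section
of `𝒪(1, 1)` on `F` arises in this way. -/
abbrev FlagSection (n k : ℕ) : Type :=
  ⋀[ℂ]^k (Fin n → ℂ) →ₗ[ℂ] ⋀[ℂ]^(k + 1) (Fin n → ℂ) →ₗ[ℂ] ℂ

namespace FlagSection

variable {n k : ℕ}

/-- The section `S` is zero at the flag `W ⊂ W'`, that is, the flag is a point of the hypersurface
`M = Z(S) ⊂ F(k, k+1, V)`: the form is zero on `⋀ᵏW × ⋀ᵏ⁺¹W'`. -/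
def VanishesAt (S : FlagSection n k) (W W' : Submodule ℂ (Fin n → ℂ)) : Prop :=
  ∀ (w : Fin k → Fin n → ℂ) (w' : Fin (k + 1) → Fin n → ℂ),
    (∀ i, w i ∈ W) → (∀ i, w' i ∈ W') →
      S (exteriorPower.ιMulti ℂ k w) (exteriorPower.ιMulti ℂ (k + 1) w') = 0

/-- `Y₁ ⊂ G(k, V)`, the zero locus of the pushforward of `S` along
`h₁ : F(k, k+1, V) → G(k, V)`: the value of the pushforward at `W` is the restriction of `S` to the
fibre of `h₁` over `W`, which consists of the flags `W ⊂ W'`. -/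
def Y₁ (S : FlagSection n k) : CVariety :=
  grassSubvariety n k {W | Module.finrank ℂ W = k ∧
    ∀ W' : Submodule ℂ (Fin n → ℂ), Module.finrank ℂ W' = k + 1 → W ≤ W' → S.VanishesAt W W'}

/-- `Y₂ ⊂ G(k+1, V)`, the zero locus of the pushforward of `S` along
`h₂ : F(k, k+1, V) → G(k+1, V)`: the value of the pushforward at `W'` is the restriction of `S` to
the fibre of `h₂` over `W'`, which consists of the flags `W ⊂ W'`. -/
def Y₂ (S : FlagSection n k) : CVariety :=
  grassSubvariety n (k + 1) {W' | Module.finrank ℂ W' = k + 1 ∧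
    ∀ W : Submodule ℂ (Fin n → ℂ), Module.finrank ℂ W = k → W ≤ W' → S.VanishesAt W W'}

end FlagSection

end

open AlgebraicGeometry CategoryTheory CategoryTheory.Limits
noncomputable section
attribute [local instance] MvPolynomial.gradedAlgebra

namespace CVariety

/-! ### Basic relations in the Grothendieck ring -/

/-! Let M ⊂ F be the zero set of S. The fibre of F over W ∈ G(k,V) is P(V/W) = P^{n-k-1}, and S
restricts to a linear form on it. So the fibre of M is a hyperplane, unless W ∈ Y₁, when it is the
whole space. As [P^m] = [P^{m-1}] + L^m, this gives [M] = [G(k,V)][P^{n-k-2}] + L^{n-k-1}[Y₁]. The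
fibre of F over W' is the dual projective space of hyperplanes in W', a P^k, and S is again linear
on it. Hence [M] = [G(k+1,V)][P^{k-1}] + L^k[Y₂]. The theorem is the equality of the two
expressions, `FlagSection.relation`.

M is never built as a scheme. Its pieces, and those of the Grassmannians, are plain sets with an
algebra of complex functions, affine in the sense of `Subalgebra.IsAff`: finitely generated, with
every character a point. Such a set has a class `setCls`. The Nullstellensatz transfers three rules
from schemes to these classes: cutting along a function (`Subalgebra.IsAff.cls_eq_add`, iterated in
`Subalgebra.IsAff.cls_eq_sum_stratum`), products (`Subalgebra.IsAff.cls_prod`), and invariance under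
maps that pull functions back to functions (`cls_eq_of_equiv`). Reducedness of the rings never has
to be checked, because nilpotents do not change a class.

The actual schemes enter through `cls_projVariety`, which writes the class of a projective variety
as a sum over its pieces in the standard charts; `grassSubvariety_cls` rewrites this for
subvarieties of Grassmannians. The fibrewise count is `sum_cls_hyperPiece`, a hyperplane with
varying coefficients in a trivial projective bundle. The pieces of M over a chart of either
Grassmannian are identified with such hyperplanes in `isAff_and_cls_flagPieceFst` and
`isAff_and_cls_flagPieceSnd`. This stratifies M in two ways, and `sum_cls_biStratum` shows by a
common refinement that the two sums agree; it takes the place of the class of M. -/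

theorem mk_eq_zero {p : MvPolynomial CVariety ℤ} (h : GrothendieckRel p) :
    Ideal.Quotient.mk (Ideal.span {p : MvPolynomial CVariety ℤ | GrothendieckRel p}) p = 0 :=
  Ideal.Quotient.eq_zero_iff_mem.2 (Ideal.subset_span h)

theorem cls_congr {X Y : CVariety} (e : X.toOver ≅ Y.toOver) : X.cls = Y.cls := by
  have h := mk_eq_zero (.iso X Y e)
  rwa [map_sub, sub_eq_zero] at h

theorem cls_prod (X Y : CVariety) : (X.prod Y).cls = X.cls * Y.cls := by
  have h := mk_eq_zero (.prod X Y)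
  rwa [map_sub, sub_eq_zero, map_mul] at h

theorem cls_point : point.cls = 1 := by
  have h := mk_eq_zero .point
  rwa [map_sub, sub_eq_zero, map_one] at h

theorem cls_scissor {X Z U : CVariety} (i : Z.toOver ⟶ X.toOver) (j : U.toOver ⟶ X.toOver)
    (hi : IsClosedImmersion i.left) (hj : IsOpenImmersion j.left)
    (hij : Set.range j.left = (Set.range i.left)ᶜ) : X.cls = Z.cls + U.cls := by
  have h := mk_eq_zero (.scissor X Z U i j hi hj hij)
  rwa [map_sub, sub_eq_zero, map_add] at h

/-- The class of a separated scheme of finite type over `ℂ`. -/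
abbrev clsOf {X : Scheme.{0}} (f : X ⟶ SpecC) [IsSeparated f] [LocallyOfFiniteType f]
    [QuasiCompact f] : K0 := (ofHom f).cls

theorem isLocallyNoetherian_of_specC {X : Scheme.{0}} (f : X ⟶ SpecC) [LocallyOfFiniteType f] :
    IsLocallyNoetherian X :=
  LocallyOfFiniteType.isLocallyNoetherian f

theorem quasiCompact_opens {X : Scheme.{0}} (f : X ⟶ SpecC) [LocallyOfFiniteType f]
    (V : X.Opens) : QuasiCompact V.ι :=
  have := isLocallyNoetherian_of_specC f
  inferInstance

section
variable {X Y Z U : Scheme.{0}} (f : X ⟶ SpecC) [IsSeparated f] [LocallyOfFiniteType f]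
  [QuasiCompact f] (g : Y ⟶ SpecC) [IsSeparated g] [LocallyOfFiniteType g] [QuasiCompact g]

theorem clsOf_congr (e : X ≅ Y) (h : e.hom ≫ g = f) : clsOf f = clsOf g :=
  cls_congr (Over.isoMk e h)

theorem clsOf_scissor (z : Z ⟶ SpecC) [IsSeparated z] [LocallyOfFiniteType z] [QuasiCompact z]
    (u : U ⟶ SpecC) [IsSeparated u] [LocallyOfFiniteType u] [QuasiCompact u]
    (i : Z ⟶ X) (j : U ⟶ X) [hi : IsClosedImmersion i] [hj : IsOpenImmersion j]
    (hz : i ≫ f = z) (hu : j ≫ f = u) (h : Set.range j = (Set.range i)ᶜ) :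
    clsOf f = clsOf z + clsOf u :=
  cls_scissor (X := ofHom f) (Z := ofHom z) (U := ofHom u)
    (Over.homMk i hz) (Over.homMk j hu) hi hj h

/-- The class of an open subscheme. -/
def clsOpen (V : X.Opens) : K0 :=
  have := quasiCompact_opens f V
  clsOf (V.ι ≫ f)

theorem clsOpen_top : clsOpen f ⊤ = clsOf f :=
  have := quasiCompact_opens f ⊤
  clsOf_congr _ _ X.topIso (by simp)

/-- Removing a closed subscheme. -/
theorem clsOf_eq_add_clsOpen (z : Z ⟶ SpecC) [IsSeparated z] [LocallyOfFiniteType z]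
    [QuasiCompact z] (i : Z ⟶ X) [IsClosedImmersion i] (hz : i ≫ f = z) (V : X.Opens)
    (h : (V : Set X) = (Set.range i)ᶜ) : clsOf f = clsOf z + clsOpen f V := by
  have := quasiCompact_opens f V
  exact clsOf_scissor f z (V.ι ≫ f) i V.ι hz rfl (by simpa using h)

/-- Closed subschemes with the same points have the same class. -/
theorem clsOf_eq_of_range_eq {Z' : Scheme.{0}}
    (z : Z ⟶ SpecC) [IsSeparated z] [LocallyOfFiniteType z] [QuasiCompact z]
    (z' : Z' ⟶ SpecC) [IsSeparated z'] [LocallyOfFiniteType z'] [QuasiCompact z']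
    (i : Z ⟶ X) [IsClosedImmersion i] (hz : i ≫ f = z)
    (i' : Z' ⟶ X) [IsClosedImmersion i'] (hz' : i' ≫ f = z') (h : Set.range i = Set.range i') :
    clsOf z = clsOf z' := by
  -- Both subschemes have the same open complement, so the two scissor relations share a summand
  -- that cancels. Hence only the points of a closed subscheme matter for its class.
  have hc : IsClosed (Set.range i) := i.isClosedEmbedding.isClosed_range
  have h1 := clsOf_eq_add_clsOpen f z i hz ⟨_, hc.isOpen_compl⟩ rfl
  have h2 := clsOf_eq_add_clsOpen f z' i' hz' ⟨_, hc.isOpen_compl⟩ (by simp [h])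
  rw [h1] at h2
  exact add_right_cancel h2

theorem clsOpen_clsOpen (V : X.Opens) [QuasiCompact (V.ι ≫ f)] (W : X.Opens) (h : W ≤ V) :
    clsOpen (V.ι ≫ f) (V.ι ⁻¹ᵁ W) = clsOpen f W := by
  have := quasiCompact_opens f W
  have := quasiCompact_opens (V.ι ≫ f) (V.ι ⁻¹ᵁ W)
  refine clsOf_congr _ _ (IsOpenImmersion.isoOfRangeEq ((V.ι ⁻¹ᵁ W).ι ≫ V.ι) W.ι ?_) ?_
  · rw [Scheme.Hom.comp_base, TopCat.coe_comp, Set.range_comp]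
    have hV : Set.range V.ι = V := V.range_ι
    rw [Scheme.Opens.range_ι, Scheme.Opens.range_ι]
    change V.ι '' (V.ι ⁻¹' (W : Set X)) = W
    rw [Set.image_preimage_eq_inter_range, hV, Set.inter_eq_left]
    exact h
  · rw [← Category.assoc, IsOpenImmersion.isoOfRangeEq_hom_fac, Category.assoc]

/-- The decomposition of X into Z and D is intersected with V; the closed immersion restricts to a
closed immersion over V. -/
theorem clsOpen_add_preimage (z : Z ⟶ SpecC) [IsSeparated z] [LocallyOfFiniteType z]
    [QuasiCompact z] (i : Z ⟶ X) [IsClosedImmersion i] (hz : i ≫ f = z) (D V : X.Opens)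
    (h : (D : Set X) = (Set.range i)ᶜ) :
    clsOpen f V = clsOpen z (i ⁻¹ᵁ V) + clsOpen f (D ⊓ V) := by
  have := quasiCompact_opens f V
  have := quasiCompact_opens z (i ⁻¹ᵁ V)
  rw [← clsOpen_clsOpen f V (D ⊓ V) inf_le_right]
  refine clsOf_eq_add_clsOpen (V.ι ≫ f) ((i ⁻¹ᵁ V).ι ≫ z) (i ∣_ V) ?_ _ ?_
  · rw [← hz, morphismRestrict_ι_assoc]
  · have h' : ∀ x, x ∈ D ↔ x ∉ Set.range i := fun x => by rw [← SetLike.mem_coe, h]; rfl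
    ext x
    simp only [Set.mem_compl_iff, Set.mem_range, SetLike.mem_coe]
    have : x ∈ V.ι ⁻¹ᵁ (D ⊓ V) ↔ x.1 ∈ D :=
      and_iff_left x.2
    rw [this, h', not_iff_not]
    constructor
    · rintro ⟨y, hy⟩
      refine ⟨⟨y, show i y ∈ V from hy ▸ x.2⟩, Subtype.ext ?_⟩
      exact (morphismRestrict_base_coe i V _).trans hy
    · rintro ⟨y, hy⟩
      refine ⟨y.1, ?_⟩
      rw [← morphismRestrict_base_coe, hy]

/-- If an open set `D` is added to an open set `A`, then the class increases by the class
of any closed subscheme of `D` with the points of `D \ A`. -/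
theorem clsOpen_sup (A D : X.Opens) (z : Z ⟶ SpecC) [IsSeparated z] [LocallyOfFiniteType z]
    [QuasiCompact z] (d : Y ⟶ X) [IsOpenImmersion d] (hd : d.opensRange = D) (hg : d ≫ f = g)
    (i : Z ⟶ Y) [IsClosedImmersion i] (hz : i ≫ g = z)
    (h : Set.range i = d ⁻¹' (A : Set X)ᶜ) :
    clsOpen f (A ⊔ D) = clsOpen f A + clsOf z := by
  have hDc : IsClosed (D : Set X)ᶜ := D.2.isClosed_compl
  -- On the reduced complement T of D the open sets `A` and `A ⊔ D` have the same trace. Their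
  -- classes therefore differ as those of `D` and `D ⊓ A` do, and that difference is the class of Z.
  let T := Scheme.IdealSheafData.vanishingIdeal (X := X) ⟨_, hDc⟩
  have hT : (D : Set X) = (Set.range T.subschemeι)ᶜ := by
    rw [T.range_subschemeι, Scheme.IdealSheafData.coe_support_vanishingIdeal]
    simp
  have h1 := clsOpen_add_preimage f (T.subschemeι ≫ f) T.subschemeι rfl D (A ⊔ D) hT
  have h2 := clsOpen_add_preimage f (T.subschemeι ≫ f) T.subschemeι rfl D A hT
  have h3 : T.subschemeι ⁻¹ᵁ (A ⊔ D) = T.subschemeι ⁻¹ᵁ A := by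
    ext x
    have hx : T.subschemeι x ∉ D := by
      rw [← SetLike.mem_coe, hT]
      exact fun h => h ⟨x, rfl⟩
    have e1 : x ∈ T.subschemeι ⁻¹ᵁ (A ⊔ D) ↔ T.subschemeι x ∈ A ∨ T.subschemeι x ∈ D := Iff.rfl
    have e2 : x ∈ T.subschemeι ⁻¹ᵁ A ↔ T.subschemeι x ∈ A := Iff.rfl
    simp only [SetLike.mem_coe]
    rw [e1, e2]; tauto
  rw [h3, inf_eq_left.2 (le_sup_right : D ≤ A ⊔ D)] at h1
  have := quasiCompact_opens f D
  have h4 : clsOpen f D = clsOf g :=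
    clsOf_congr _ _ (IsOpenImmersion.isoOfRangeEq D.ι d (by simp [← hd])) (by
      rw [← hg, IsOpenImmersion.isoOfRangeEq_hom_fac_assoc])
  have h5 : clsOf g = clsOf z + clsOpen g (d ⁻¹ᵁ A) :=
    clsOf_eq_add_clsOpen g z i hz _ (by rw [h]; simp)
  have h6 : clsOpen g (d ⁻¹ᵁ A) = clsOpen f (D ⊓ A) := by
    have := quasiCompact_opens f (D ⊓ A)
    have := quasiCompact_opens g (d ⁻¹ᵁ A)
    refine clsOf_congr _ _ (IsOpenImmersion.isoOfRangeEq ((d ⁻¹ᵁ A).ι ≫ d) (D ⊓ A).ι ?_) ?_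
    · rw [Scheme.Hom.comp_base, TopCat.coe_comp, Set.range_comp]
      simp [← hd, Set.image_preimage_eq_inter_range, Set.inter_comm]
    · rw [← hg, ← Category.assoc, IsOpenImmersion.isoOfRangeEq_hom_fac, Category.assoc]
  rw [h1, h2, h4, h5, h6]
  ring

end

end CVariety

/-- The Nullstellensatz over `ℂ`. -/
theorem mem_radical_of_forall_algHom {R : Type*} [CommRing R] [Algebra ℂ R] [Algebra.FiniteType ℂ R]
    (J : Ideal R) (g : R) (h : ∀ φ : R →ₐ[ℂ] ℂ, (∀ x ∈ J, φ x = 0) → φ g = 0) :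
    g ∈ J.radical := by
  have : IsJacobsonRing R := isJacobsonRing_of_finiteType (A := ℂ)
  rw [Ideal.radical_eq_jacobson, Ideal.jacobson, Ideal.mem_sInf]
  rintro m ⟨hJm, hm⟩
  -- By Zariski's lemma the residue field of `m` is finite over ℂ, hence equal to ℂ. So the quotient
  -- by `m` is a character with kernel `m`, and the hypothesis applies to it.
  let := Ideal.Quotient.field m
  have := finite_of_finite_type_of_isJacobsonRing ℂ (R ⧸ m)
  have hb : Function.Bijective (algebraMap ℂ (R ⧸ m)) :=
    IsAlgClosed.algebraMap_bijective_of_isIntegral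
  let e := AlgEquiv.ofBijective (Algebra.ofId ℂ (R ⧸ m)) hb
  have key : ∀ x, (e.symm.toAlgHom.comp (Ideal.Quotient.mkₐ ℂ m)) x = 0 ↔ x ∈ m := fun x => by
    simp [Ideal.Quotient.eq_zero_iff_mem]
  exact (key g).1 (h _ fun x hx => (key x).2 (hJm hx))

namespace CVariety

/-! ### Classes of affine varieties -/

/-- The structure morphism of `Spec R`. -/
abbrev specHom (R : Type) [CommRing R] [Algebra ℂ R] : Spec (CommRingCat.of R) ⟶ SpecC :=
  Spec.map (CommRingCat.ofHom (algebraMap ℂ R))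

/-- The morphism of schemes given by a homomorphism of `ℂ`-algebras. -/
abbrev specMap {R S : Type} [CommRing R] [CommRing S] [Algebra ℂ R] [Algebra ℂ S]
    (φ : R →ₐ[ℂ] S) : Spec (CommRingCat.of S) ⟶ Spec (CommRingCat.of R) :=
  Spec.map (CommRingCat.ofHom φ.toRingHom)

theorem specMap_specHom {R S : Type} [CommRing R] [CommRing S] [Algebra ℂ R] [Algebra ℂ S]
    (φ : R →ₐ[ℂ] S) : specMap φ ≫ specHom R = specHom S := by
  rw [← Spec.map_comp, ← CommRingCat.ofHom_comp]
  congr 2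
  exact φ.comp_algebraMap

variable {R S T : Type} [CommRing R] [CommRing S] [CommRing T] [Algebra ℂ R] [Algebra ℂ S]
  [Algebra ℂ T] [Algebra.FiniteType ℂ R] [Algebra.FiniteType ℂ S] [Algebra.FiniteType ℂ T]

instance : LocallyOfFiniteType (specHom R) := locallyOfFiniteType_spec R

variable (R) in
/-- The class of `Spec R`. -/
def specCls : K0 := (spec R).cls

theorem specCls_congr (e : R ≃ₐ[ℂ] S) : specCls R = specCls S :=
  clsOf_congr _ _ (Scheme.Spec.mapIso e.toRingEquiv.toCommRingCatIso.op).symm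
    (specMap_specHom e.symm.toAlgHom)

section
variable {R S : Type} [CommRing R] [CommRing S] [Algebra ℂ R] [Algebra ℂ S]

theorem isClosedImmersion_specMap (φ : R →ₐ[ℂ] S) (h : Function.Surjective φ) :
    IsClosedImmersion (specMap φ) :=
  IsClosedImmersion.spec_of_surjective _ h

theorem range_specMap (φ : R →ₐ[ℂ] S) (h : Function.Surjective φ) :
    Set.range (specMap φ) = PrimeSpectrum.zeroLocus (RingHom.ker φ.toRingHom : Set R) :=
  range_comap_of_surjective _ φ.toRingHom h

end

/-- A closed immersion with nilpotent kernel hits every point, so it can be compared with the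
identity. This allows a ring to be replaced by its image in an algebra of functions. -/
theorem specCls_eq_of_surjective (φ : R →ₐ[ℂ] S) (h : Function.Surjective φ)
    (hn : ∀ r, φ r = 0 → IsNilpotent r) : specCls R = specCls S := by
  have := isClosedImmersion_specMap φ h
  refine clsOf_eq_of_range_eq (specHom R) (specHom R) (specHom S) (𝟙 _) (Category.id_comp _)
    (specMap φ) (specMap_specHom φ) ?_
  rw [range_specMap φ h]
  symm
  have : PrimeSpectrum.zeroLocus (RingHom.ker φ.toRingHom : Set R) = Set.univ := by
    rw [PrimeSpectrum.zeroLocus_eq_univ_iff]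
    intro r hr
    exact mem_nilradical.2 (hn r hr)
  rw [this]
  simp
  rfl

/-- The empty scheme is both a closed subscheme of itself and the open complement, so its class is
twice itself. -/
theorem specCls_of_subsingleton [Subsingleton R] : specCls R = 0 := by
  have h := clsOf_scissor (specHom R) (specHom R) (specHom R) (𝟙 _) (𝟙 _)
    (Category.id_comp _) (Category.id_comp _) (by
      have : IsEmpty (Spec (CommRingCat.of R)) :=
        inferInstanceAs (IsEmpty (PrimeSpectrum R))
      exact Subsingleton.elim _ _)
  exact left_eq_add.1 h

theorem specCls_complex : specCls ℂ = 1 := cls_point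

theorem specCls_polynomial : specCls (Polynomial ℂ) = lefschetz := rfl

instance finiteType_tensorProduct : Algebra.FiniteType ℂ (TensorProduct ℂ R S) :=
  .trans (S := R) ‹_› inferInstance

theorem specCls_tensor :
    specCls (TensorProduct ℂ R S) = specCls R * specCls S := by
  rw [specCls, specCls, specCls, ← cls_prod]
  have h : (pullbackSpecIso ℂ R S).inv ≫ pullback.fst (specHom R) (specHom S) ≫ specHom R =
      specHom (TensorProduct ℂ R S) := by
    rw [pullbackSpecIso_inv_fst_assoc]
    exact specMap_specHom (Algebra.TensorProduct.includeLeft : R →ₐ[ℂ] TensorProduct ℂ R S)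
  exact cls_congr (X := spec (TensorProduct ℂ R S)) (Y := (spec R).prod (spec S))
    (Over.isoMk (pullbackSpecIso ℂ R S).symm h)

/-- The kernel of `φ` and the ideal of `f` have the same radical, so Spec S has the points of V(f),
although S need not be R/(f). Spec T is the complement D(f). -/
theorem specCls_scissor (f : R) (φ : R →ₐ[ℂ] S) (hφ : Function.Surjective φ)
    (hf : φ f = 0) (hr : ∀ g, φ g = 0 → g ∈ (Ideal.span {f}).radical)
    (ψ : R →ₐ[ℂ] T) (hψ : @IsLocalization.Away R _ f T _ ψ.toRingHom.toAlgebra) :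
    specCls R = specCls S + specCls T := by
  have := isClosedImmersion_specMap φ hφ
  let := ψ.toRingHom.toAlgebra
  have : IsOpenImmersion (specMap ψ) := IsOpenImmersion.of_isLocalization (S := T) f
  refine clsOf_scissor _ _ _ (specMap φ) (specMap ψ) (specMap_specHom φ) (specMap_specHom ψ) ?_
  rw [range_specMap φ hφ]
  refine (PrimeSpectrum.localization_away_comap_range T f).trans ?_
  have : PrimeSpectrum.zeroLocus (RingHom.ker φ.toRingHom : Set R) =
      PrimeSpectrum.zeroLocus {f} := by
    apply le_antisymm
    · exact PrimeSpectrum.zeroLocus_anti_mono (by simpa using hf)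
    · rw [← PrimeSpectrum.zeroLocus_span {f}, ← PrimeSpectrum.zeroLocus_radical]
      exact PrimeSpectrum.zeroLocus_anti_mono hr
  rw [this]
  exact PrimeSpectrum.basicOpen_eq_zeroLocus_compl f

end CVariety

/-! ### Sets with an algebra of functions -/

open CVariety

/-- The class in the Grothendieck ring of a finitely generated algebra of functions. -/
def Subalgebra.cls {X : Type} (A : Subalgebra ℂ (X → ℂ)) : K0 :=
  open Classical in
  if h : A.FG then @specCls A _ _ ((Subalgebra.fg_iff_finiteType A).1 h) else 0

/-- An algebra of functions on `X` is affine if it is finitely generated and each of its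
characters is the evaluation at a point of `X`. -/
structure Subalgebra.IsAff {X : Type} (A : Subalgebra ℂ (X → ℂ)) : Prop where
  fg : A.FG
  exists_eval : ∀ φ : A →ₐ[ℂ] ℂ, ∃ x, ∀ a : A, φ a = a.1 x

theorem Subalgebra.cls_eq {X : Type} (A : Subalgebra ℂ (X → ℂ)) [h : Algebra.FiniteType ℂ A] :
    A.cls = specCls A := by
  rw [Subalgebra.cls, dif_pos ((Subalgebra.fg_iff_finiteType A).2 h)]

theorem Subalgebra.IsAff.finiteType {X : Type} {A : Subalgebra ℂ (X → ℂ)} (h : A.IsAff) :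
    Algebra.FiniteType ℂ A := (Subalgebra.fg_iff_finiteType A).1 h.fg

/-- The pullback of functions. -/
def funComp {X Y : Type} (e : X → Y) : (Y → ℂ) →ₐ[ℂ] (X → ℂ) where
  toFun f := f ∘ e
  map_one' := rfl
  map_mul' _ _ := rfl
  map_zero' := rfl
  map_add' _ _ := rfl
  commutes' _ := rfl

/-- The algebra of functions on `U` generated by the restrictions of the functions in `G`. -/
def coordRing {X : Type} (U : Set X) (G : Set (X → ℂ)) : Subalgebra ℂ (U → ℂ) :=
  Algebra.adjoin ℂ ((fun g (u : U) => g u) '' G)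

/-- The class of the set `U` with the functions generated by `G`. -/
def setCls {X : Type} (U : Set X) (G : Set (X → ℂ)) : K0 := (coordRing U G).cls

theorem setCls_eq {X : Type} (U : Set X) (G : Set (X → ℂ))
    [h : Algebra.FiniteType ℂ (coordRing U G)] : setCls U G = specCls (coordRing U G) :=
  Subalgebra.cls_eq _

theorem setCls_congr {X : Type} {U : Set X} {G G' : Set (X → ℂ)}
    (h : coordRing U G = coordRing U G') : setCls U G = setCls U G' := by
  rw [setCls, setCls, h]

section
variable {X Y : Type} {U U' : Set X} {G G' : Set (X → ℂ)} {V : Set Y} {H : Set (Y → ℂ)}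

theorem coordRing_fg (hG : G.Finite) : (coordRing U G).FG :=
  Subalgebra.fg_def.2 ⟨_, hG.image _, rfl⟩

theorem gen_mem_coordRing {g : X → ℂ} (hg : g ∈ G) : (fun u : U => g u) ∈ coordRing U G :=
  Algebra.subset_adjoin ⟨g, hg, rfl⟩

theorem const_mem_coordRing (c : ℂ) : (fun _ : U => c) ∈ coordRing U G :=
  (coordRing U G).algebraMap_mem c

theorem comp_mem_coordRing {e : U → V} (he : ∀ h ∈ H, (fun u => h (e u)) ∈ coordRing U G)
    {f : V → ℂ} (hf : f ∈ coordRing V H) : f ∘ e ∈ coordRing U G := by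
  have : coordRing V H ≤ (coordRing U G).comap (funComp e) := by
    refine Algebra.adjoin_le ?_
    rintro _ ⟨h, hh, rfl⟩
    exact he h hh
  exact this hf

theorem coordRing_le (h : ∀ g ∈ G, (fun u : U => g u) ∈ coordRing U G') :
    coordRing U G ≤ coordRing U G' := fun _ hf =>
  comp_mem_coordRing (e := id) (U := U) h hf

theorem coordRing_congr (h : ∀ g ∈ G, (fun u : U => g u) ∈ coordRing U G')
    (h' : ∀ g ∈ G', (fun u : U => g u) ∈ coordRing U G) : coordRing U G = coordRing U G' :=
  le_antisymm (coordRing_le h) (coordRing_le h')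

theorem mem_coordRing_of_subset (hU : U' ⊆ U) (hG : G ⊆ G') {f : X → ℂ}
    (hf : (fun u : U => f u) ∈ coordRing U G) : (fun u : U' => f u) ∈ coordRing U' G' :=
  comp_mem_coordRing (e := Set.inclusion hU) (f := fun u => f u)
    (fun _ h => gen_mem_coordRing (hG h)) hf

/-- The homomorphism of algebras of functions given by a map. -/
def coordMap (e : U → V) (he : ∀ h ∈ H, (fun u => h (e u)) ∈ coordRing U G) :
    coordRing V H →ₐ[ℂ] coordRing U G :=
  ((funComp e).comp (coordRing V H).val).codRestrict _ fun f => comp_mem_coordRing he f.2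

theorem coordMap_apply (e : U → V) (he : ∀ h ∈ H, (fun u => h (e u)) ∈ coordRing U G)
    (f : coordRing V H) (u : U) : (coordMap e he f).1 u = f.1 (e u) := rfl

/-- Functions need not separate points: coordinate vectors that differ by a scalar have the same
ratios. The equivalences below therefore use maps that are inverse only as far as the generators can
tell. -/
theorem comp_eq_of_gen {e : U → U} (he : ∀ g ∈ G, ∀ u, g (e u) = g u) {f : U → ℂ}
    (hf : f ∈ coordRing U G) : f ∘ e = f := by
  have : coordRing U G ≤ AlgHom.equalizer (funComp e) (AlgHom.id ℂ _) := by
    refine Algebra.adjoin_le ?_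
    rintro _ ⟨h, hh, rfl⟩
    exact funext fun u => he h hh u
  exact this hf

/-- Mutually inverse maps (up to functions) that pull back functions to functions. -/
def coordEquiv (e : U → V) (e' : V → U) (he : ∀ h ∈ H, (fun u => h (e u)) ∈ coordRing U G)
    (he' : ∀ g ∈ G, (fun v => g (e' v)) ∈ coordRing V H)
    (hl : ∀ g ∈ G, ∀ u, g (e' (e u)) = g u) (hr : ∀ h ∈ H, ∀ v, h (e (e' v)) = h v) :
    coordRing U G ≃ₐ[ℂ] coordRing V H :=
  AlgEquiv.ofAlgHom (coordMap e' he') (coordMap e he)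
    (AlgHom.ext fun f => Subtype.ext (comp_eq_of_gen (e := e ∘ e') hr f.2))
    (AlgHom.ext fun f => Subtype.ext (comp_eq_of_gen (e := e' ∘ e) hl f.2))

theorem isAff_of_equiv (hV : (coordRing V H).IsAff) (e : U → V) (e' : V → U)
    (he : ∀ h ∈ H, (fun u => h (e u)) ∈ coordRing U G)
    (he' : ∀ g ∈ G, (fun v => g (e' v)) ∈ coordRing V H)
    (hl : ∀ g ∈ G, ∀ u, g (e' (e u)) = g u) (hr : ∀ h ∈ H, ∀ v, h (e (e' v)) = h v) :
    (coordRing U G).IsAff := by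
  have := hV.finiteType
  refine ⟨(Subalgebra.fg_iff_finiteType _).2 (Algebra.FiniteType.equiv this
    (coordEquiv e e' he he' hl hr).symm), fun φ => ?_⟩
  obtain ⟨y, hy⟩ := hV.exists_eval (φ.comp (coordMap e he))
  refine ⟨e' y, fun f => ?_⟩
  have h1 := hy (coordMap e' he' f)
  rw [coordMap_apply] at h1
  rw [← h1, AlgHom.comp_apply]
  congr 1
  exact Subtype.ext (comp_eq_of_gen (e := e' ∘ e) hl f.2).symm

theorem cls_eq_of_equiv (hV : (coordRing V H).IsAff) (e : U → V) (e' : V → U)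
    (he : ∀ h ∈ H, (fun u => h (e u)) ∈ coordRing U G)
    (he' : ∀ g ∈ G, (fun v => g (e' v)) ∈ coordRing V H)
    (hl : ∀ g ∈ G, ∀ u, g (e' (e u)) = g u) (hr : ∀ h ∈ H, ∀ v, h (e (e' v)) = h v) :
    setCls U G = setCls V H := by
  have := hV.finiteType
  have := (isAff_of_equiv hV e e' he he' hl hr).finiteType
  rw [setCls_eq, setCls_eq]
  exact specCls_congr (coordEquiv e e' he he' hl hr)

/-- The restriction of functions to a subset. -/
def coordRestrict (hU : U' ⊆ U) (hG : G ⊆ G') : coordRing U G →ₐ[ℂ] coordRing U' G' :=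
  coordMap (Set.inclusion hU) fun _ h => gen_mem_coordRing (hG h)

theorem coordRestrict_surjective (hU : U' ⊆ U) :
    Function.Surjective (coordRestrict (G := G) hU subset_rfl) := by
  rintro ⟨f, hf⟩
  have : coordRing U' G ≤ (coordRing U G).map (funComp (Set.inclusion hU)) := by
    refine Algebra.adjoin_le ?_
    rintro _ ⟨h, hh, rfl⟩
    exact ⟨_, gen_mem_coordRing hh, rfl⟩
  obtain ⟨g, hg, rfl⟩ := this hf
  exact ⟨⟨g, hg⟩, rfl⟩

theorem fg_of_subset (hU : U' ⊆ U) (h : (coordRing U G).FG) : (coordRing U' G).FG := by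
  have := (Subalgebra.fg_iff_finiteType _).1 h
  exact (Subalgebra.fg_iff_finiteType _).2
    (Algebra.FiniteType.of_surjective _ (coordRestrict_surjective hU))

/-- A closed subset of an affine set is affine. -/
theorem Subalgebra.IsAff.of_closed (h : (coordRing U G).IsAff) (hU : U' ⊆ U)
    (hc : ∀ x ∈ U, x ∉ U' → ∃ f : X → ℂ, (fun u : U => f u) ∈ coordRing U G ∧
      (∀ y ∈ U', f y = 0) ∧ f x ≠ 0) : (coordRing U' G).IsAff := by
  refine ⟨fg_of_subset hU h.fg, fun φ => ?_⟩
  obtain ⟨⟨x, hx⟩, hφ⟩ := h.exists_eval (φ.comp (coordRestrict hU subset_rfl))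
  -- Otherwise the separating function restricts to zero on `U'`, so the character kills it; but the
  -- character is evaluation at `x`, where it is not zero.
  have hx' : x ∈ U' := by
    by_contra hx'
    obtain ⟨f, hf, hf0, hfx⟩ := hc x hx hx'
    have h1 := hφ ⟨_, hf⟩
    have h2 : coordRestrict (G := G) hU subset_rfl ⟨_, hf⟩ = 0 :=
      Subtype.ext (funext fun y => hf0 _ y.2)
    rw [AlgHom.comp_apply, h2, map_zero] at h1
    exact hfx h1.symm
  refine ⟨⟨x, hx'⟩, fun a => ?_⟩
  obtain ⟨b, rfl⟩ := coordRestrict_surjective hU a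
  exact hφ b

/-- The subset of an affine set where a function is zero. -/
theorem Subalgebra.IsAff.zeroSet (h : (coordRing U G).IsAff) {f : X → ℂ}
    (hf : (fun u : U => f u) ∈ coordRing U G) : (coordRing (U ∩ {x | f x = 0}) G).IsAff :=
  h.of_closed Set.inter_subset_left fun _ hx hx' =>
    ⟨f, hf, fun _ hy => hy.2, fun h0 => hx' ⟨hx, h0⟩⟩

/-- The subset of an affine set where a function is not zero. -/
theorem Subalgebra.IsAff.basicOpen (h : (coordRing U G).IsAff) {f : X → ℂ}
    (hf : (fun u : U => f u) ∈ coordRing U G) :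
    (coordRing (U ∩ {x | f x ≠ 0}) (insert f⁻¹ G)).IsAff := by
  have hV : U ∩ {x | f x ≠ 0} ⊆ U := Set.inter_subset_left
  have hG : G ⊆ insert f⁻¹ G := Set.subset_insert _ _
  constructor
  · have h1 : coordRing (U ∩ {x | f x ≠ 0}) (insert f⁻¹ G) =
        coordRing (U ∩ {x | f x ≠ 0}) {f⁻¹} ⊔ coordRing (U ∩ {x | f x ≠ 0}) G := by
      rw [coordRing, coordRing, coordRing, ← Algebra.adjoin_union, ← Set.image_union,
        Set.singleton_union]
    rw [h1]
    exact (coordRing_fg (Set.finite_singleton _)).sup (fg_of_subset hV h.fg)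
  · intro φ
    obtain ⟨⟨x, hx⟩, hφ⟩ := h.exists_eval (φ.comp (coordRestrict hV hG))
    have hi : (fun u : ↥(U ∩ {x | f x ≠ 0}) => f⁻¹ u) ∈
        coordRing (U ∩ {x | f x ≠ 0}) (insert f⁻¹ G) := gen_mem_coordRing (Set.mem_insert _ _)
    -- A character sends `f` to an invertible number, which forces the point found in `U` to lie
    -- where `f` is not zero.
    have h1 : φ (coordRestrict hV hG ⟨_, hf⟩) * φ ⟨_, hi⟩ = 1 := by
      rw [← map_mul, ← map_one φ]
      congr 1
      exact Subtype.ext (funext fun u => mul_inv_cancel₀ u.2.2)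
    have h2 : f x * φ ⟨_, hi⟩ = 1 := by
      rw [← h1]; congr 1; exact (hφ ⟨_, hf⟩).symm
    have hx0 : f x ≠ 0 := left_ne_zero_of_mul_eq_one h2
    refine ⟨⟨x, hx, hx0⟩, ?_⟩
    rintro ⟨a, ha⟩
    induction ha using Algebra.adjoin_induction with
    | mem a ha =>
      obtain ⟨g, hg | hg, rfl⟩ := ha
      · subst hg
        exact eq_inv_of_mul_eq_one_right h2
      · exact hφ ⟨_, gen_mem_coordRing hg⟩
    | algebraMap r => exact φ.commutes r
    | add a b ha hb h1 h2 => exact (φ.map_add ⟨a, ha⟩ ⟨b, hb⟩).trans (congrArg₂ _ h1 h2)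
    | mul a b ha hb h1 h2 => exact (φ.map_mul ⟨a, ha⟩ ⟨b, hb⟩).trans (congrArg₂ _ h1 h2)

/-- Induction on generators shows that each function on the open set times a power of `f` extends to
`U`. Two functions on `U` that agree where `f` is not zero agree after multiplication by `f`, so no
higher power is needed. -/
theorem isLocalization_coordRestrict {f : X → ℂ}
    (hf : (fun u : U => f u) ∈ coordRing U G) :
    @IsLocalization.Away _ _ (⟨_, hf⟩ : coordRing U G)
      (coordRing (U ∩ {x | f x ≠ 0}) (insert f⁻¹ G)) _
      (coordRestrict Set.inter_subset_left (Set.subset_insert _ _)).toRingHom.toAlgebra := by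
  have hV : U ∩ {x | f x ≠ 0} ⊆ U := Set.inter_subset_left
  have hG : G ⊆ insert f⁻¹ G := Set.subset_insert _ _
  let F : coordRing U G := ⟨_, hf⟩
  let ρ := coordRestrict (U := U) (G := G) hV hG
  have hi : (fun u : ↥(U ∩ {x | f x ≠ 0}) => f⁻¹ u) ∈
      coordRing (U ∩ {x | f x ≠ 0}) (insert f⁻¹ G) := gen_mem_coordRing (Set.mem_insert _ _)
  have hinv : ρ F * ⟨_, hi⟩ = 1 := Subtype.ext (funext fun u => mul_inv_cancel₀ u.2.2)
  let := ρ.toRingHom.toAlgebra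
  refine (isLocalization_iff _ _).2 ⟨?_, ?_, fun {a b} hab => ?_⟩
  · rintro ⟨_, n, rfl⟩
    change IsUnit (ρ (F ^ n))
    rw [map_pow]
    exact (IsUnit.of_mul_eq_one _ hinv).pow n
  · suffices h : ∀ z, ∃ (n : ℕ) (r : coordRing U G), z * ρ F ^ n = ρ r by
      intro z
      obtain ⟨n, r, hr⟩ := h z
      refine ⟨(r, ⟨F ^ n, n, rfl⟩), ?_⟩
      change z * ρ (F ^ n) = ρ r
      rw [map_pow, hr]
    rintro ⟨a, ha⟩
    induction ha using Algebra.adjoin_induction with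
    | mem a ha =>
      obtain ⟨g, hg | hg, rfl⟩ := ha
      · subst hg
        refine ⟨1, 1, ?_⟩
        rw [pow_one, map_one, mul_comm]
        exact hinv
      · exact ⟨0, ⟨_, gen_mem_coordRing hg⟩, by rw [pow_zero, mul_one]; rfl⟩
    | algebraMap r => exact ⟨0, algebraMap ℂ _ r, by rw [pow_zero, mul_one]; rfl⟩
    | add a b ha hb h1 h2 =>
      obtain ⟨n, r, hr⟩ := h1
      obtain ⟨m, s, hs⟩ := h2
      refine ⟨n + m, r * F ^ m + s * F ^ n, ?_⟩
      rw [map_add, map_mul, map_mul, ← hr, ← hs, map_pow, map_pow]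
      have : (⟨a + b, add_mem ha hb⟩ : coordRing (U ∩ {x | f x ≠ 0}) (insert f⁻¹ G)) =
        ⟨a, ha⟩ + ⟨b, hb⟩ := rfl
      rw [this]; ring
    | mul a b ha hb h1 h2 =>
      obtain ⟨n, r, hr⟩ := h1
      obtain ⟨m, s, hs⟩ := h2
      refine ⟨n + m, r * s, ?_⟩
      rw [map_mul, ← hr, ← hs]
      have : (⟨a * b, mul_mem ha hb⟩ : coordRing (U ∩ {x | f x ≠ 0}) (insert f⁻¹ G)) =
        ⟨a, ha⟩ * ⟨b, hb⟩ := rfl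
      rw [this]; ring
  · refine ⟨⟨F, 1, pow_one _⟩, Subtype.ext (funext fun u => ?_)⟩
    change f u * a.1 u = f u * b.1 u
    by_cases hu : f u = 0
    · rw [hu, zero_mul, zero_mul]
    · exact congrArg (f u * ·) (congrFun (congrArg Subtype.val hab) ⟨u, u.2, hu⟩)

/-- The scissor relation for affine sets. -/
theorem Subalgebra.IsAff.cls_eq_add (h : (coordRing U G).IsAff) {f : X → ℂ}
    (hf : (fun u : U => f u) ∈ coordRing U G) :
    setCls U G = setCls (U ∩ {x | f x = 0}) G +
      setCls (U ∩ {x | f x ≠ 0}) (insert f⁻¹ G) := by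
  have := h.finiteType
  have := (h.zeroSet hf).finiteType
  have := (h.basicOpen hf).finiteType
  rw [setCls_eq, setCls_eq, setCls_eq]
  refine specCls_scissor ⟨_, hf⟩ (coordRestrict Set.inter_subset_left subset_rfl)
    (coordRestrict_surjective _) (Subtype.ext (funext fun y => y.2.2)) ?_
    (coordRestrict Set.inter_subset_left (Set.subset_insert _ _)) ?_
  · intro g hg
    -- The characters of an affine set are its points, so a function that vanishes on the zeros of
    -- `f` lies in the radical of `(f)`.
    refine mem_radical_of_forall_algHom _ _ fun φ hφ => ?_
    obtain ⟨x, hx⟩ := h.exists_eval φ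
    have h1 := hφ _ (Ideal.mem_span_singleton_self _)
    rw [hx] at h1
    rw [hx]
    exact congrFun (congrArg Subtype.val hg) ⟨x.1, x.2, h1⟩
  · exact isLocalization_coordRestrict hf

end

/-! ### Stratifications, products and affine spaces -/

/-- An element killed by all characters is nilpotent by the Nullstellensatz, and nilpotents do not
affect the class. So the tensor product need not be shown to be reduced. -/
theorem specCls_eq_mul_of_surjective {R S T : Type} [CommRing R] [CommRing S] [CommRing T]
    [Algebra ℂ R] [Algebra ℂ S] [Algebra ℂ T] [Algebra.FiniteType ℂ R] [Algebra.FiniteType ℂ S]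
    [Algebra.FiniteType ℂ T] (φ : TensorProduct ℂ R S →ₐ[ℂ] T) (h : Function.Surjective φ)
    (hn : ∀ t, φ t = 0 → ∀ χ : TensorProduct ℂ R S →ₐ[ℂ] ℂ, χ t = 0) :
    specCls T = specCls R * specCls S := by
  rw [← specCls_tensor]
  refine (specCls_eq_of_surjective φ h fun t ht => ?_).symm
  rw [← mem_nilradical]
  exact mem_radical_of_forall_algHom ⊥ t fun χ _ => hn t ht χ

section
variable {X Y : Type} {U U' : Set X} {G G' : Set (X → ℂ)} {V : Set Y} {H : Set (Y → ℂ)}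

theorem Subalgebra.IsAff.zeroSets (h : (coordRing U G).IsAff) {ι : Type} (s : Set ι)
    {f : ι → X → ℂ} (hf : ∀ i, (fun u : U => f i u) ∈ coordRing U G) :
    (coordRing (U ∩ {x | ∀ i ∈ s, f i x = 0}) G).IsAff :=
  h.of_closed Set.inter_subset_left fun x hx hx' => by
    obtain ⟨i, hi, hi'⟩ : ∃ i ∈ s, f i x ≠ 0 := by
      by_contra! hc
      exact hx' ⟨hx, hc⟩
    exact ⟨f i, hf i, fun _ hy => hy.2 i hi, hi'⟩

/-- The subset of `U` where `f i` is the first of the functions `f` that is not zero. -/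
def stratum {ι : Type} (r : ι → ℕ) (f : ι → X → ℂ) (U : Set X) (i : ι) : Set X :=
  U ∩ {x | f i x ≠ 0 ∧ ∀ j, r j < r i → f j x = 0}

theorem stratum_eq {ι : Type} (r : ι → ℕ) (f : ι → X → ℂ) (U : Set X) (i : ι) :
    stratum r f U i = (U ∩ {x | ∀ j ∈ {j | r j < r i}, f j x = 0}) ∩ {x | f i x ≠ 0} := by
  ext x
  simp only [stratum, Set.mem_inter_iff, Set.mem_ofPred_eq]
  tauto

theorem Subalgebra.IsAff.isAff_stratum (h : (coordRing U G).IsAff) {ι : Type} (r : ι → ℕ)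
    {f : ι → X → ℂ} (hf : ∀ i, (fun u : U => f i u) ∈ coordRing U G) (i : ι) :
    (coordRing (stratum r f U i) (insert (f i)⁻¹ G)).IsAff := by
  rw [stratum_eq]
  exact (h.zeroSets _ hf).basicOpen
    (mem_coordRing_of_subset Set.inter_subset_left subset_rfl (hf i))

/-- The class of an affine set is the sum of the classes of the strata. -/
theorem Subalgebra.IsAff.cls_eq_sum_stratum (h : (coordRing U G).IsAff) {ι : Type} [Fintype ι]
    (r : ι → ℕ) (hr : Function.Injective r) {f : ι → X → ℂ}
    (hf : ∀ i, (fun u : U => f i u) ∈ coordRing U G) :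
    setCls U G = ∑ i, setCls (stratum r f U i) (insert (f i)⁻¹ G) +
      setCls (U ∩ {x | ∀ i, f i x = 0}) G := by
  classical
  -- Functions are added in order of increasing `r`. A new one comes after all earlier ones, so it
  -- leaves their strata unchanged and cuts only the remaining common zero set.
  suffices H : ∀ s : Finset ι, setCls U G =
      ∑ i ∈ s, setCls (U ∩ {x | f i x ≠ 0 ∧ ∀ j ∈ s, r j < r i → f j x = 0})
        (insert (f i)⁻¹ G) +
      setCls (U ∩ {x | ∀ i ∈ (s : Set ι), f i x = 0}) G by
    simpa only [stratum, Finset.mem_univ, Finset.coe_univ, Set.mem_univ, true_imp_iff] using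
      H Finset.univ
  intro s
  induction s using Finset.induction_on_max_value r with
  | empty => simp
  | insert a s ha hmax ih =>
    rw [ih, Finset.sum_insert ha,
      (h.zeroSets (s : Set ι) hf).cls_eq_add (f := f a)
        (mem_coordRing_of_subset Set.inter_subset_left subset_rfl (hf a))]
    have h1 : (U ∩ {x | ∀ i ∈ (s : Set ι), f i x = 0}) ∩ {x | f a x = 0} =
        U ∩ {x | ∀ i ∈ ((insert a s : Finset ι) : Set ι), f i x = 0} := by
      ext x
      simp only [Set.mem_inter_iff, Set.mem_ofPred_eq, Finset.coe_insert, Set.forall_mem_insert]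
      tauto
    have h2 : (U ∩ {x | ∀ i ∈ (s : Set ι), f i x = 0}) ∩ {x | f a x ≠ 0} =
        U ∩ {x | f a x ≠ 0 ∧ ∀ j ∈ insert a s, r j < r a → f j x = 0} := by
      ext x
      simp only [Set.mem_inter_iff, Set.mem_ofPred_eq, Finset.forall_mem_insert, lt_irrefl,
        false_imp_iff, true_and, and_assoc]
      refine and_congr_right fun _ => ?_
      rw [and_comm]
      refine and_congr_right fun _ => forall₂_congr fun j hj => ?_
      have : r j < r a := lt_of_le_of_ne (hmax j hj) fun e => ha (hr e ▸ hj)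
      simp [this]
    have h3 : ∀ i ∈ s, U ∩ {x | f i x ≠ 0 ∧ ∀ j ∈ s, r j < r i → f j x = 0} =
        U ∩ {x | f i x ≠ 0 ∧ ∀ j ∈ insert a s, r j < r i → f j x = 0} := by
      intro i hi
      ext x
      simp [not_lt.2 (hmax i hi)]
    rw [h1, h2, Finset.sum_congr rfl fun i hi => by rw [h3 i hi]]
    ring

theorem cls_coordRing_of_isEmpty [IsEmpty U] : setCls U G = 0 := by
  have : Subsingleton (coordRing U G) := ⟨fun a b => Subtype.ext (funext fun u => isEmptyElim u)⟩
  have hfg : (coordRing U G).FG := ⟨∅, by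
    ext f
    have : f = 0 := funext fun u => isEmptyElim u
    simp [this]⟩
  have := (Subalgebra.fg_iff_finiteType _).1 hfg
  rw [setCls_eq, specCls_of_subsingleton]

theorem cls_coordRing_of_eq_empty (h : U = ∅) : setCls U G = 0 := by
  subst h
  exact cls_coordRing_of_isEmpty

/-- Functions on a product. -/
def prodGen (G : Set (X → ℂ)) (H : Set (Y → ℂ)) : Set (X × Y → ℂ) :=
  (fun g p => g p.1) '' G ∪ (fun h p => h p.2) '' H

theorem fst_mem_prod {f : U → ℂ} (hf : f ∈ coordRing U G) :
    (fun p : U ×ˢ V => f ⟨p.1.1, p.2.1⟩) ∈ coordRing (U ×ˢ V) (prodGen G H) :=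
  comp_mem_coordRing (e := fun p : U ×ˢ V => (⟨p.1.1, p.2.1⟩ : U))
    (fun h hh => gen_mem_coordRing (g := fun p : X × Y => h p.1) (.inl ⟨h, hh, rfl⟩)) hf

/-- Functions on a product as sums of products of functions on the factors. -/
def tensorToProd (U : Set X) (G : Set (X → ℂ)) (V : Set Y) (H : Set (Y → ℂ)) :
    TensorProduct ℂ (coordRing U G) (coordRing V H) →ₐ[ℂ] coordRing (U ×ˢ V) (prodGen G H) :=
  Algebra.TensorProduct.lift
    (coordMap (fun p : U ×ˢ V => (⟨p.1.1, p.2.1⟩ : U))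
      fun h hh => gen_mem_coordRing (g := fun p : X × Y => h p.1) (.inl ⟨h, hh, rfl⟩))
    (coordMap (fun p : U ×ˢ V => (⟨p.1.2, p.2.2⟩ : V))
      fun h hh => gen_mem_coordRing (g := fun p : X × Y => h p.2) (.inr ⟨h, hh, rfl⟩))
    fun _ _ => Commute.all _ _

theorem tensorToProd_surjective : Function.Surjective (tensorToProd U G V H) := by
  have key : coordRing (U ×ˢ V) (prodGen G H) ≤
      (tensorToProd U G V H).range.map (coordRing (U ×ˢ V) (prodGen G H)).val := by
    refine Algebra.adjoin_le ?_
    rintro _ ⟨_, ⟨g, hg, rfl⟩ | ⟨g, hg, rfl⟩, rfl⟩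
    · refine ⟨_, ⟨⟨_, gen_mem_coordRing hg⟩ ⊗ₜ 1, rfl⟩, ?_⟩
      simp [tensorToProd]
      rfl
    · refine ⟨_, ⟨1 ⊗ₜ ⟨_, gen_mem_coordRing hg⟩, rfl⟩, ?_⟩
      simp [tensorToProd]
      rfl
  rintro ⟨f, hf⟩
  obtain ⟨g, ⟨t, rfl⟩, hg⟩ := key hf
  exact ⟨t, Subtype.ext hg⟩

/-- A character of a tensor product is determined by its restrictions to the two factors, and each
of these is evaluation at a point. -/
theorem tensorToProd_eval (hU : (coordRing U G).IsAff) (hV : (coordRing V H).IsAff)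
    (φ : TensorProduct ℂ (coordRing U G) (coordRing V H) →ₐ[ℂ] ℂ) :
    ∃ p, ∀ t, φ t = (tensorToProd U G V H t).1 p := by
  obtain ⟨x, hx⟩ := hU.exists_eval (φ.comp Algebra.TensorProduct.includeLeft)
  obtain ⟨y, hy⟩ := hV.exists_eval (φ.comp Algebra.TensorProduct.includeRight)
  refine ⟨⟨(x.1, y.1), x.2, y.2⟩, fun t => ?_⟩
  induction t using TensorProduct.induction_on with
  | zero => simp
  | tmul a b =>
    have : (a ⊗ₜ[ℂ] b : TensorProduct ℂ (coordRing U G) (coordRing V H)) =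
      (a ⊗ₜ[ℂ] 1) * (1 ⊗ₜ[ℂ] b) := by simp
    rw [this, map_mul, map_mul]
    have h1 := hx a
    have h2 := hy b
    rw [AlgHom.comp_apply] at h1 h2
    simp only [Algebra.TensorProduct.includeLeft_apply,
      Algebra.TensorProduct.includeRight_apply] at h1 h2
    rw [h1, h2]
    simp [tensorToProd]
    rfl
  | add a b ha hb => rw [map_add, map_add, ha, hb]; rfl

theorem Subalgebra.IsAff.prod (hU : (coordRing U G).IsAff) (hV : (coordRing V H).IsAff) :
    (coordRing (U ×ˢ V) (prodGen G H)).IsAff := by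
  have := hU.finiteType
  have := hV.finiteType
  refine ⟨(Subalgebra.fg_iff_finiteType _).2
    (Algebra.FiniteType.of_surjective _ tensorToProd_surjective), fun φ => ?_⟩
  obtain ⟨p, hp⟩ := tensorToProd_eval hU hV (φ.comp (tensorToProd U G V H))
  refine ⟨p, fun a => ?_⟩
  obtain ⟨t, rfl⟩ := tensorToProd_surjective a
  exact hp t

theorem Subalgebra.IsAff.cls_prod (hU : (coordRing U G).IsAff) (hV : (coordRing V H).IsAff) :
    setCls (U ×ˢ V) (prodGen G H) = setCls U G * setCls V H := by
  have := hU.finiteType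
  have := hV.finiteType
  have := (hU.prod hV).finiteType
  rw [setCls_eq, setCls_eq, setCls_eq]
  refine specCls_eq_mul_of_surjective (tensorToProd U G V H) tensorToProd_surjective ?_
  intro t ht φ
  obtain ⟨p, hp⟩ := tensorToProd_eval hU hV φ
  rw [hp, ht]
  rfl

end

theorem specCls_mvPolynomial (ι : Type) [Fintype ι] :
    specCls (MvPolynomial ι ℂ) = lefschetz ^ Fintype.card ι := by
  refine Fintype.induction_empty_option
    (P := fun ι _ => specCls (MvPolynomial ι ℂ) = lefschetz ^ Fintype.card ι) ?_ ?_ ?_ ι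
  · intro α β _ e h
    let := Fintype.ofEquiv β e.symm
    rw [← Fintype.card_congr e, ← h]
    exact specCls_congr (MvPolynomial.renameEquiv ℂ e.symm)
  · rw [specCls_congr (MvPolynomial.isEmptyAlgEquiv ℂ PEmpty), specCls_complex]
    simp
  · intro α _ h
    rw [Fintype.card_option, pow_succ, ← h, ← specCls_polynomial, ← specCls_tensor]
    exact specCls_congr ((MvPolynomial.optionEquivLeft ℂ α).trans
      ((polyEquivTensor ℂ (MvPolynomial α ℂ))))

/-- The coordinate functions on `ℂ^ι`. -/
def coordGen (ι : Type) : Set ((ι → ℂ) → ℂ) := Set.range fun i v => v i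

theorem coord_mem {ι : Type} {U : Set (ι → ℂ)} (i : ι) :
    (fun v : U => v.1 i) ∈ coordRing U (coordGen ι) :=
  gen_mem_coordRing (g := fun v : ι → ℂ => v i) ⟨i, rfl⟩

/-- The polynomial functions on `ℂ^ι`. -/
def polyFun (ι : Type) : MvPolynomial ι ℂ →ₐ[ℂ] coordRing (Set.univ : Set (ι → ℂ)) (coordGen ι) :=
  MvPolynomial.aeval fun i => ⟨_, coord_mem i⟩

theorem polyFun_apply (ι : Type) (p : MvPolynomial ι ℂ) (v : (Set.univ : Set (ι → ℂ))) :
    (polyFun ι p).1 v = MvPolynomial.eval v.1 p := by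
  induction p using MvPolynomial.induction_on with
  | C a => simp [polyFun]
  | add p q hp hq => simp [← hp, ← hq]
  | mul_X p i hp => simp [← hp]; simp [polyFun]

theorem polyFun_surjective (ι : Type) : Function.Surjective (polyFun ι) := by
  have key : coordRing (Set.univ : Set (ι → ℂ)) (coordGen ι) ≤
      (polyFun ι).range.map (coordRing _ (coordGen ι)).val := by
    refine Algebra.adjoin_le ?_
    rintro _ ⟨_, ⟨i, rfl⟩, rfl⟩
    refine ⟨_, ⟨MvPolynomial.X i, rfl⟩, ?_⟩
    simp [polyFun]
  rintro ⟨f, hf⟩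
  obtain ⟨g, ⟨t, rfl⟩, hg⟩ := key hf
  exact ⟨t, Subtype.ext hg⟩

theorem isAff_affineSpace (ι : Type) [Fintype ι] :
    (coordRing (Set.univ : Set (ι → ℂ)) (coordGen ι)).IsAff := by
  refine ⟨coordRing_fg (Set.finite_range _), fun φ => ⟨⟨fun i => φ ⟨_, coord_mem i⟩, trivial⟩, ?_⟩⟩
  intro a
  obtain ⟨p, rfl⟩ := polyFun_surjective ι a
  rw [polyFun_apply, ← AlgHom.comp_apply]
  induction p using MvPolynomial.induction_on with
  | C a => simp [polyFun]
  | add p q hp hq => simp only [map_add, hp, hq]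
  | mul_X p i hp => rw [map_mul, map_mul, hp]; simp [polyFun]

theorem cls_affineSpace (ι : Type) [Fintype ι] :
    setCls (Set.univ : Set (ι → ℂ)) (coordGen ι) = lefschetz ^ Fintype.card ι := by
  have := (isAff_affineSpace ι).finiteType
  rw [setCls_eq, ← specCls_mvPolynomial]
  refine (specCls_eq_of_surjective _ (polyFun_surjective ι) fun p hp => ?_).symm
  have : p = 0 := MvPolynomial.funext fun v => by
    rw [← polyFun_apply ι p ⟨v, trivial⟩, hp, map_zero]; rfl
  rw [this]
  exact IsNilpotent.zero

/-! ### Hyperplanes in a trivial projective bundle -/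

/-- The sum `1 + 𝕃 + ⋯ + 𝕃^(m-1)`. -/
def geomL (m : ℕ) : K0 := ∑ t ∈ Finset.range m, lefschetz ^ t

theorem sum_fin_rev (m : ℕ) : ∑ t : Fin m, lefschetz ^ (m - 1 - (t : ℕ)) = geomL m := by
  rw [geomL, ← Finset.sum_range_reflect, Finset.sum_range]

theorem card_lt_fin {m : ℕ} (j : Fin m) : Fintype.card {i : Fin m // j < i} = m - 1 - j := by
  rw [Fintype.card_subtype, ← Fin.card_Ioi]
  congr 1
  ext i
  simp

/-- This counts the free coordinates of a vector that begins at the `t`-th index other than `c`,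
when the coordinate `c` is fixed by an equation. -/
theorem card_lt_ne_fin {m : ℕ} (c : Fin (m + 1)) (t : Fin m) :
    Fintype.card {i : Fin (m + 1) // c.succAbove t < i ∧ i ≠ c} = m - 1 - t := by
  rw [← card_lt_fin t]
  refine (Fintype.card_of_bijective (f := fun i : {i : Fin m // t < i} =>
    (⟨c.succAbove i, Fin.succAbove_lt_succAbove_iff.2 i.2, Fin.succAbove_ne _ _⟩ :
      {i : Fin (m + 1) // c.succAbove t < i ∧ i ≠ c})) ⟨?_, ?_⟩).symm
  · intro a b h
    exact Subtype.ext (Fin.succAbove_right_injective (congrArg Subtype.val h))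
  · rintro ⟨i, hi, hc⟩
    obtain ⟨a, rfl⟩ := Fin.exists_succAbove_eq hc
    exact ⟨⟨a, Fin.succAbove_lt_succAbove_iff.1 hi⟩, rfl⟩

section
variable {X : Type} {B : Set X} {G : Set (X → ℂ)}

/-- A family of graphs over an affine set is a product with an affine space. -/
theorem isAff_and_cls_of_graph {ι : Type} (hB : (coordRing B G).IsAff) (s : Set ι)
    [Fintype s] (t : ι → X × (s → ℂ) → ℂ)
    (ht : ∀ i, (fun p : B ×ˢ (Set.univ : Set (s → ℂ)) => t i p) ∈
      coordRing (B ×ˢ Set.univ) (prodGen G (coordGen s)))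
    (E : Set (X × (ι → ℂ)))
    (hE : ∀ b v, (b, v) ∈ E ↔ b ∈ B ∧ ∀ i ∉ s, v i = t i (b, fun i => v i)) :
    (coordRing E (prodGen G (coordGen ι))).IsAff ∧
      setCls E (prodGen G (coordGen ι)) = setCls B G * lefschetz ^ Fintype.card s := by
  classical
  have hP := hB.prod (isAff_affineSpace s)
  let w : X × (s → ℂ) → ι → ℂ := fun p i => if h : i ∈ s then p.2 ⟨i, h⟩ else t i p
  have hw : ∀ p, (fun i : s => w p i) = p.2 := fun p => funext fun i => by simp [w]
  have hmem : ∀ p : B ×ˢ (Set.univ : Set (s → ℂ)), (p.1.1, w p) ∈ E := fun p => by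
    rw [hE]
    refine ⟨p.2.1, fun i hi => ?_⟩
    rw [hw]
    simp [w, hi]
  have hgen : ∀ g ∈ prodGen G (coordGen ι),
      (fun p : B ×ˢ (Set.univ : Set (s → ℂ)) => g (p.1.1, w p)) ∈
        coordRing (B ×ˢ Set.univ) (prodGen G (coordGen s)) := by
    rintro _ (⟨g, hg, rfl⟩ | ⟨_, ⟨i, rfl⟩, rfl⟩)
    · exact gen_mem_coordRing (g := fun p : X × (s → ℂ) => g p.1) (.inl ⟨g, hg, rfl⟩)
    · by_cases h : i ∈ s
      · simp only [w, h, dite_true]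
        exact gen_mem_coordRing (g := fun p : X × (s → ℂ) => p.2 ⟨i, h⟩)
          (.inr ⟨_, ⟨⟨i, h⟩, rfl⟩, rfl⟩)
      · simp only [w, h, dite_false]
        exact ht i
  let e : E → B ×ˢ (Set.univ : Set (s → ℂ)) := fun q =>
    ⟨(q.1.1, fun i => q.1.2 i), ((hE q.1.1 q.1.2).1 q.2).1, trivial⟩
  let e' : B ×ˢ (Set.univ : Set (s → ℂ)) → E := fun p => ⟨(p.1.1, w p), hmem p⟩
  have h1 : ∀ h ∈ prodGen G (coordGen s), (fun q => h (e q)) ∈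
      coordRing E (prodGen G (coordGen ι)) := by
    rintro _ (⟨g, hg, rfl⟩ | ⟨_, ⟨i, rfl⟩, rfl⟩)
    · exact gen_mem_coordRing (g := fun p : X × (ι → ℂ) => g p.1) (.inl ⟨g, hg, rfl⟩)
    · exact gen_mem_coordRing (g := fun p : X × (ι → ℂ) => p.2 i) (.inr ⟨_, ⟨i, rfl⟩, rfl⟩)
  have hl : ∀ q, e' (e q) = q := by
    rintro ⟨⟨b, v⟩, hq⟩
    refine Subtype.ext (Prod.ext rfl (funext fun i => ?_))
    by_cases h : i ∈ s
    · simp [e', w, e, h]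
    · simp only [e', w, e, h, dite_false]
      exact (((hE b v).1 hq).2 i h).symm
  have hr : ∀ p, e (e' p) = p := fun p => Subtype.ext (Prod.ext rfl (hw _))
  refine ⟨isAff_of_equiv hP e e' h1 hgen (fun g _ q => by rw [hl]) fun g _ p => by rw [hr], ?_⟩
  rw [cls_eq_of_equiv hP e e' h1 hgen (fun g _ q => by rw [hl]) fun g _ p => by rw [hr],
    hB.cls_prod (isAff_affineSpace s), cls_affineSpace]

/-- The points `(b, v)` of a trivial projective bundle on the hyperplane given by `lam`, where
`v` is normalized with the first non-zero coordinate `v j = 1`. -/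
def hyperPiece {N : ℕ} (lam : Fin N → X → ℂ) (B : Set X) (j : Fin N) : Set (X × (Fin N → ℂ)) :=
  {p | p.1 ∈ B ∧ p.2 j = 1 ∧ (∀ i < j, p.2 i = 0) ∧ ∑ i, lam i p.1 * p.2 i = 0}

variable {M : ℕ} {lam : Fin (M + 1) → X → ℂ}

theorem fst_mem {Y : Type} {V : Set Y} {H : Set (Y → ℂ)} {E : Set (X × Y)} (hE : E ⊆ B ×ˢ V)
    {f : X → ℂ} (hf : (fun u : B => f u) ∈ coordRing B G) :
    (fun p : E => f p.1.1) ∈ coordRing E (prodGen G H) :=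
  mem_coordRing_of_subset hE subset_rfl (f := fun p => f p.1) (fst_mem_prod (V := V) hf)

theorem coord_snd_mem {ι : Type} {E : Set (X × (ι → ℂ))} (i : ι) :
    (fun p : E => p.1.2 i) ∈ coordRing E (prodGen G (coordGen ι)) :=
  gen_mem_coordRing (g := fun p : X × (ι → ℂ) => p.2 i) (.inr ⟨_, ⟨i, rfl⟩, rfl⟩)

theorem isAff_hyperPiece (hB : (coordRing B G).IsAff)
    (hlam : ∀ i, (fun b : B => lam i b) ∈ coordRing B G) (j : Fin (M + 1)) :
    (coordRing (hyperPiece lam B j) (prodGen G (coordGen _))).IsAff := by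
  refine (hB.prod (isAff_affineSpace (Fin (M + 1)))).of_closed (fun p hp => ⟨hp.1, trivial⟩) ?_
  intro p hp hp'
  have hc (i) := coord_snd_mem (G := G) (E := B ×ˢ (Set.univ : Set (Fin (M + 1) → ℂ))) i
  by_cases h1 : p.2 j = 1
  · by_cases h2 : ∀ i < j, p.2 i = 0
    · refine ⟨fun p => ∑ i, lam i p.1 * p.2 i, ?_, fun q hq => hq.2.2.2, fun h => hp' ⟨hp.1, h1, h2, h⟩⟩
      have : (fun p : B ×ˢ (Set.univ : Set (Fin (M + 1) → ℂ)) => ∑ i, lam i p.1.1 * p.1.2 i) =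
        ∑ i, (fun p => lam i p.1.1) * (fun p => p.1.2 i) := by ext; simp
      rw [this]
      exact sum_mem fun i _ => mul_mem (fst_mem subset_rfl (hlam i)) (hc i)
    · push Not at h2
      obtain ⟨i, hi, h⟩ := h2
      exact ⟨fun p => p.2 i, hc i, fun q hq => hq.2.2.1 i hi, h⟩
  · exact ⟨fun p => p.2 j - 1, sub_mem (hc j) (const_mem_coordRing 1),
      fun q hq => sub_eq_zero.2 hq.2.1, sub_ne_zero.2 h1⟩

/-- The equation is void, so exactly the `M - j` coordinates after the leading 1 are free. -/
theorem cls_hyperPiece_zero (hB : (coordRing B G).IsAff) (h0 : ∀ b ∈ B, ∀ i, lam i b = 0)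
    (j : Fin (M + 1)) : setCls (hyperPiece lam B j) (prodGen G (coordGen _)) =
      setCls B G * lefschetz ^ (M - (j : ℕ)) := by
  have h := (isAff_and_cls_of_graph hB {i | j < i} (fun i _ => if i = j then 1 else 0)
    (fun i => const_mem_coordRing _) (hyperPiece lam B j) ?_).2
  · rw [h]
    congr 2
    exact (card_lt_fin j).trans (by simp)
  · intro b v
    refine and_congr_right fun hb => ?_
    simp only [h0 b hb, zero_mul, Finset.sum_const_zero, and_true]
    constructor
    · rintro ⟨h1, h2⟩ i hi
      split_ifs with h
      · rw [h, h1]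
      · exact h2 i (lt_of_le_of_ne (not_lt.1 hi) h)
    · intro h
      refine ⟨by simpa using h j, fun i hi => ?_⟩
      simpa [hi.ne] using h i (not_lt.2 hi.le)

/-- If `c` is the last index with a nonzero coefficient and `v` begins at `c`, the equation reduces
to `lam c = 0`. -/
theorem hyperPiece_self_eq_empty {c : Fin (M + 1)} (hc : ∀ b ∈ B, lam c b ≠ 0)
    (h0 : ∀ b ∈ B, ∀ i, c < i → lam i b = 0) : hyperPiece lam B c = ∅ := by
  refine Set.eq_empty_of_forall_notMem fun p hp => hc _ hp.1 ?_
  obtain ⟨hb, h1, h2, h3⟩ := hp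
  rw [Finset.sum_eq_single c, h1, mul_one] at h3
  · exact h3
  · intro i _ hi
    rcases lt_or_gt_of_ne hi with h | h
    · rw [h2 i h, mul_zero]
    · rw [h0 _ hb i h, zero_mul]
  · simp

/-- Since `lam c` is invertible, the equation can be solved for `v c`, and the coordinates after `j`
other than `c` are free: the piece is a graph over `B` times an affine space. -/
theorem cls_hyperPiece_of_ne (hB : (coordRing B G).IsAff)
    (hlam : ∀ i, (fun b : B => lam i b) ∈ coordRing B G) {c : Fin (M + 1)}
    (hc : ∀ b ∈ B, lam c b ≠ 0) (hinv : (fun b : B => (lam c b)⁻¹) ∈ coordRing B G)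
    (h0 : ∀ b ∈ B, ∀ i, c < i → lam i b = 0) {j : Fin (M + 1)} (hj : j ≠ c) :
    setCls (hyperPiece lam B j) (prodGen G (coordGen _)) =
      setCls B G * lefschetz ^ Fintype.card {i : Fin (M + 1) // j < i ∧ i ≠ c} := by
  let s : Set (Fin (M + 1)) := {i | j < i ∧ i ≠ c}
  -- The value of `v c` given by the equation when `v j = 1`.
  let T : X × (s → ℂ) → ℂ := fun p => -(lam c p.1)⁻¹ * (lam j p.1 + ∑ i : s, lam i p.1 * p.2 i)
  have hT : (fun p : B ×ˢ (Set.univ : Set (s → ℂ)) => T p) ∈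
      coordRing (B ×ˢ Set.univ) (prodGen G (coordGen s)) := by
    have : (fun p : B ×ˢ (Set.univ : Set (s → ℂ)) => T p) =
        -(fun p => (lam c p.1.1)⁻¹) * ((fun p => lam j p.1.1) +
          ∑ i : s, (fun p => lam i p.1.1) * (fun p => p.1.2 i)) := by
      ext; simp [T]
    rw [this]
    exact mul_mem (neg_mem (fst_mem (f := fun b => (lam c b)⁻¹) subset_rfl hinv))
      (add_mem (fst_mem subset_rfl (hlam j)) (sum_mem fun i _ =>
        mul_mem (fst_mem subset_rfl (hlam i)) (coord_snd_mem i)))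
  refine (isAff_and_cls_of_graph hB s
    (fun i p => if i = j then 1 else if i = c then T p else 0) ?_ (hyperPiece lam B j) ?_).2
  · intro i
    split_ifs
    · exact const_mem_coordRing 1
    · exact hT
    · exact const_mem_coordRing 0
  · intro b v
    refine and_congr_right fun hb => ?_
    have hcb := hc b hb
    have key : v j = 1 → (∀ i < j, i ≠ c → v i = 0) → ∑ i, lam i b * v i =
        lam c b * v c + (lam j b + ∑ i : s, lam i b * v i) := by
      intro h1 h2
      have e1 : lam c b * v c = ∑ i, if i = c then lam i b * v i else 0 := by simp
      have e2 : lam j b = ∑ i, if i = j then lam i b * v i else 0 := by simp [h1]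
      have e3 : ∑ i : s, lam i b * v i = ∑ i, if j < i ∧ i ≠ c then lam i b * v i else 0 := by
        rw [← Finset.sum_filter]
        exact (Finset.sum_subtype (p := fun i => i ∈ s) (Finset.univ.filter fun i => j < i ∧ i ≠ c)
            (fun i => by simp [s]) fun i => lam i b * v i).symm
      rw [e1, e3]
      nth_rewrite 1 [e2]
      rw [← Finset.sum_add_distrib, ← Finset.sum_add_distrib]
      refine Finset.sum_congr rfl fun i _ => ?_
      rcases lt_trichotomy i j with h | h | h
      · by_cases hic : i = c
        · simp [hic, hj.symm]
        · simp [hic, h.ne, h.not_gt, h2 i h hic]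
      · subst h; simp [hj]
      · by_cases hic : i = c
        · simp [hic, hj.symm]
        · simp [hic, h.ne', h]
    have hTc : (v c = T (b, fun i => v i)) ↔
        lam c b * v c + (lam j b + ∑ i : s, lam i b * v i) = 0 := by
      simp only [T]
      constructor
      · intro h; rw [h]; field_simp; ring
      · intro h; field_simp; linear_combination h
    change (v j = 1 ∧ (∀ i < j, v i = 0) ∧ ∑ i, lam i b * v i = 0) ↔ _
    constructor
    · rintro ⟨h1, h2, h3⟩ i hi
      rw [key h1 fun i hi _ => h2 i hi, ← hTc] at h3
      split_ifs with hij hic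
      · rw [hij, h1]
      · rw [hic, h3]
      · refine h2 i (lt_of_le_of_ne (not_lt.1 fun h => hi ⟨h, hic⟩) hij)
    · intro h
      have h1 : v j = 1 := by simpa using h j fun h' => lt_irrefl _ h'.1
      have h2 : ∀ i < j, i ≠ c → v i = 0 := fun i hi hic => by
        simpa [hi.ne, hic] using h i fun h' => h'.1.not_gt hi
      have h3 : v c = T (b, fun i => v i) := by
        simpa [hj.symm] using h c fun h' => h'.2 rfl
      refine ⟨h1, fun i hi => ?_, by rw [key h1 h2, ← hTc, h3]⟩
      by_cases hic : i = c
      -- If `c < j`, the solved coordinate must also satisfy the normalization `v c = 0`. It does,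
      -- because all coefficients after `c` vanish and so `T` is zero.
      · subst hic
        rw [h3]
        simp only [T]
        rw [h0 b hb j hi, Finset.sum_eq_zero, add_zero, mul_zero]
        rintro ⟨k, hk⟩ _
        rw [h0 b hb k (hi.trans hk.1), zero_mul]
      · exact h2 i hi hic

/-- The class of a hyperplane in a trivial projective bundle. -/
theorem sum_cls_hyperPiece (hB : (coordRing B G).IsAff)
    (hlam : ∀ i, (fun b : B => lam i b) ∈ coordRing B G) :
    ∑ j, setCls (hyperPiece lam B j) (prodGen G (coordGen _)) =
      setCls B G * geomL M + setCls (B ∩ {b | ∀ i, lam i b = 0}) G * lefschetz ^ M := by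
  -- Reversing the order makes the stratum of `c` the locus where `c` is the last index with a
  -- nonzero coefficient.
  let r : Fin (M + 1) → ℕ := fun i => M - i
  have hr : Function.Injective r := fun a b h => by
    simp only [r] at h; ext; omega
  have hlt : ∀ i c, r i < r c ↔ c < i := fun i c => by
    simp only [r, Fin.lt_def]; omega
  have hZ : (coordRing (B ∩ {b | ∀ i, lam i b = 0}) G).IsAff := by
    have h : {b | ∀ i, lam i b = 0} = {b | ∀ i ∈ Set.univ, lam i b = 0} := by ext; simp
    rw [h]
    exact hB.zeroSets Set.univ hlam
  have hE : ∀ j, setCls (hyperPiece lam B j) (prodGen G (coordGen _)) =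
      ∑ c, (setCls (stratum r lam B c) (insert (lam c)⁻¹ G) * if j = c then 0 else
        lefschetz ^ Fintype.card {i : Fin (M + 1) // j < i ∧ i ≠ c}) +
      setCls (B ∩ {b | ∀ i, lam i b = 0}) G * lefschetz ^ (M - (j : ℕ)) := by
    intro j
    rw [(isAff_hyperPiece hB hlam j).cls_eq_sum_stratum r hr
      (f := fun i p => lam i p.1) fun i => fst_mem (V := Set.univ)
        (fun p hp => ⟨hp.1, trivial⟩) (hlam i)]
    congr 1
    · refine Finset.sum_congr rfl fun c _ => ?_
      have hs : stratum r (fun i p => lam i p.1) (hyperPiece lam B j) c =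
          hyperPiece lam (stratum r lam B c) j := by
        ext p
        simp only [stratum, hyperPiece, Set.mem_inter_iff, Set.mem_ofPred_eq]
        tauto
      have hg : insert (fun p : X × (Fin (M + 1) → ℂ) => lam c p.1)⁻¹
          (prodGen G (coordGen (Fin (M + 1)))) =
          prodGen (insert (lam c)⁻¹ G) (coordGen (Fin (M + 1))) := by
        rw [prodGen, prodGen, Set.image_insert_eq, Set.insert_union]
        rfl
      rw [hs, hg]
      have hnz : ∀ b ∈ stratum r lam B c, lam c b ≠ 0 := fun b hb => hb.2.1
      have hz : ∀ b ∈ stratum r lam B c, ∀ i, c < i → lam i b = 0 :=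
        fun b hb i hi => hb.2.2 i ((hlt i c).2 hi)
      split_ifs with hjc
      · subst hjc
        rw [cls_coordRing_of_eq_empty (hyperPiece_self_eq_empty hnz hz), mul_zero]
      · exact cls_hyperPiece_of_ne (hB.isAff_stratum r hlam c)
          (fun i => mem_coordRing_of_subset Set.inter_subset_left (Set.subset_insert _ _) (hlam i))
          hnz (gen_mem_coordRing (g := (lam c)⁻¹) (Set.mem_insert _ _)) hz hjc
    · rw [← cls_hyperPiece_zero hZ (lam := lam) (fun b hb => hb.2) j]
      congr 1
      ext p
      simp only [hyperPiece, Set.mem_inter_iff, Set.mem_ofPred_eq]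
      tauto
  -- Whatever the pivot `c` is, the fibre has the class of P^{M-1}: the piece `j = c` is missing and
  -- the others have M - 1, ..., 0 free coordinates.
  have hsum : ∀ c : Fin (M + 1), ∑ j, (if j = c then 0 else
      lefschetz ^ Fintype.card {i : Fin (M + 1) // j < i ∧ i ≠ c}) = geomL M := by
    intro c
    rw [Fin.sum_univ_succAbove _ c, if_pos rfl, zero_add, ← sum_fin_rev]
    refine Finset.sum_congr rfl fun t _ => ?_
    rw [if_neg (Fin.succAbove_ne c t), card_lt_ne_fin]
  -- Where all coefficients vanish the fibre is the whole P^M, which exceeds a hyperplane by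
  -- `lefschetz ^ M`.
  have hgeom : ∑ j : Fin (M + 1), lefschetz ^ (M - (j : ℕ)) = geomL M + lefschetz ^ M := by
    have := sum_fin_rev (M + 1)
    simp only [Nat.add_sub_cancel] at this
    rw [this, geomL, geomL, Finset.sum_range_succ]
  rw [Finset.sum_congr rfl fun j _ => hE j, Finset.sum_add_distrib, Finset.sum_comm,
    Finset.sum_congr rfl fun c _ => (Finset.mul_sum _ _ _).symm,
    Finset.sum_congr rfl fun c _ => by rw [hsum c], ← Finset.sum_mul, ← Finset.mul_sum, hgeom,
    hB.cls_eq_sum_stratum r hr hlam]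
  ring

end

/-! ### Projective varieties as unions of affine pieces -/

theorem MvPolynomial.IsHomogeneous.eval₂_mul {σ R S : Type*} [CommSemiring R] [CommSemiring S]
    {p : MvPolynomial σ R} {d : ℕ} (hp : p.IsHomogeneous d) (φ : R →+* S) (t : S) (y : σ → S) :
    p.eval₂ φ (fun j => t * y j) = t ^ d * p.eval₂ φ y := by
  rw [MvPolynomial.eval₂_eq, MvPolynomial.eval₂_eq, Finset.mul_sum]
  refine Finset.sum_congr rfl fun m hm => ?_
  have h : m.degree = d :=
    (DFunLike.congr_fun (Finsupp.degree_eq_weight_one (σ := σ) (R := ℕ)) m).trans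
      (hp (MvPolynomial.mem_support_iff.1 hm))
  simp only [mul_pow, Finset.prod_mul_distrib, Finset.prod_pow_eq_pow_sum]
  rw [← h, Finsupp.degree_apply]
  exact mul_left_comm _ _ _

/-- A point `b` that satisfies all relations among the `f i` defines a character of the ring they
generate, and in an affine set that character is a point. So the image of `U` under the `f i` is
Zariski closed. -/
theorem Subalgebra.IsAff.exists_of_forall {X ι : Type} {U : Set X} {f : ι → X → ℂ}
    (h : (coordRing U (Set.range f)).IsAff) (b : ι → ℂ)
    (hb : ∀ p : MvPolynomial ι ℂ, (∀ u ∈ U, MvPolynomial.eval (fun i => f i u) p = 0) →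
      MvPolynomial.eval b p = 0) : ∃ u ∈ U, ∀ i, f i u = b i := by
  let θ : MvPolynomial ι ℂ →ₐ[ℂ] coordRing U (Set.range f) :=
    MvPolynomial.aeval fun i => ⟨_, gen_mem_coordRing ⟨i, rfl⟩⟩
  have hθ : ∀ p (u : U), (θ p).1 u = MvPolynomial.eval (fun i => f i u) p := by
    intro p u
    induction p using MvPolynomial.induction_on with
    | C a => simp [θ]
    | add p q hp hq => simp [← hp, ← hq]
    | mul_X p i hp => simp [← hp]; simp [θ]
  have hsurj : Function.Surjective θ := by
    have key : coordRing U (Set.range f) ≤ θ.range.map (coordRing U (Set.range f)).val := by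
      refine Algebra.adjoin_le ?_
      rintro _ ⟨_, ⟨i, rfl⟩, rfl⟩
      exact ⟨_, ⟨MvPolynomial.X i, rfl⟩, by simp [θ]⟩
    rintro ⟨g, hg⟩
    obtain ⟨_, ⟨t, rfl⟩, ht⟩ := key hg
    exact ⟨t, Subtype.ext ht⟩
  have hker : ∀ p ∈ RingHom.ker θ, MvPolynomial.aeval b p = 0 := fun p hp => by
    rw [MvPolynomial.aeval_eq_eval]
    refine hb p fun u hu => ?_
    rw [← hθ p ⟨u, hu⟩, RingHom.mem_ker.1 hp]
    rfl
  let φ : coordRing U (Set.range f) →ₐ[ℂ] ℂ :=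
    (Ideal.Quotient.liftₐ (RingHom.ker θ) (MvPolynomial.aeval b) hker).comp
      (Ideal.quotientKerAlgEquivOfSurjective hsurj).symm.toAlgHom
  have hφ : ∀ p, φ (θ p) = MvPolynomial.eval b p := fun p => by
    have : (Ideal.quotientKerAlgEquivOfSurjective hsurj).symm (θ p) =
        Ideal.Quotient.mk (RingHom.ker θ) p := by
      rw [AlgEquiv.symm_apply_eq]
      rfl
    simp only [φ, AlgHom.comp_apply]
    erw [this]
    simp
  obtain ⟨⟨u, hu⟩, hx⟩ := h.exists_eval φ
  refine ⟨u, hu, fun i => ?_⟩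
  have := hφ (MvPolynomial.X i)
  rw [hx, hθ] at this
  simpa using this

/-! ### Standard charts of projective space -/

variable {σ : Type}

/-- The grading of the homogeneous coordinate ring. -/
local notation "𝒜" => MvPolynomial.homogeneousSubmodule

/-- The quotients `x_j / x_i`. -/
def ratioGen (i : σ) : Set ((σ → ℂ) → ℂ) := Set.range fun j a => a j / a i

theorem X_mem_homogeneousSubmodule (i : σ) : (MvPolynomial.X i : MvPolynomial σ ℂ) ∈ 𝒜 σ ℂ 1 :=
  MvPolynomial.isHomogeneous_X ℂ i

/-- The fraction `g / x_i ^ d`. -/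
abbrev awayFrac (i : σ) (d : ℕ) (g : MvPolynomial σ ℂ) (hg : g.IsHomogeneous d) :
    HomogeneousLocalization.Away (𝒜 σ ℂ) (MvPolynomial.X i) :=
  HomogeneousLocalization.Away.mk (𝒜 σ ℂ) (X_mem_homogeneousSubmodule i) d g
    (by rw [smul_eq_mul, mul_one]; exact hg)

/-- The scalars in the coordinate ring of a chart of projective space. -/
abbrev awayC (i : σ) : ℂ →+* HomogeneousLocalization.Away (𝒜 σ ℂ) (MvPolynomial.X i) :=
  (HomogeneousLocalization.fromZeroRingHom (𝒜 σ ℂ) _).comp (algebraMap ℂ (𝒜 σ ℂ 0))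

/-- Polynomials in the affine coordinates `x_j / x_i`. -/
def awayPoly (i : σ) :
    MvPolynomial σ ℂ →+* HomogeneousLocalization.Away (𝒜 σ ℂ) (MvPolynomial.X i) :=
  MvPolynomial.eval₂Hom (awayC i) fun j => awayFrac i 1 (.X j) (MvPolynomial.isHomogeneous_X ℂ j)

/-- Substituting `x_j / x_i` in a form of degree `d` divides it by `x_i ^ d`. In the full
localization `x_i` is a unit, and both sides times `x_i ^ d` equal `g`. -/
theorem awayPoly_eq (i : σ) {d : ℕ} {g : MvPolynomial σ ℂ} (hg : g.IsHomogeneous d) :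
    awayPoly i g = awayFrac i d g hg := by
  refine HomogeneousLocalization.val_injective _ ?_
  let L := Localization.Away (MvPolynomial.X i : MvPolynomial σ ℂ)
  let v := algebraMap (HomogeneousLocalization.Away (𝒜 σ ℂ) (MvPolynomial.X i)) L
  let t : L := algebraMap (MvPolynomial σ ℂ) L (MvPolynomial.X i)
  let y : σ → L := fun j => v (awayFrac i 1 (.X j) (MvPolynomial.isHomogeneous_X ℂ j))
  have ht : IsUnit t := IsLocalization.Away.algebraMap_isUnit _
  have hfrac : ∀ {d : ℕ} {g : MvPolynomial σ ℂ} (hg : g.IsHomogeneous d),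
      t ^ d * (awayFrac i d g hg).val = algebraMap (MvPolynomial σ ℂ) L g := fun hg => by
    rw [HomogeneousLocalization.Away.val_mk, Localization.mk_eq_mk', ← map_pow]
    exact IsLocalization.mk'_spec' L _ _
  have hy : ∀ j, t * y j = algebraMap (MvPolynomial σ ℂ) L (.X j) := fun j => by
    have := hfrac (MvPolynomial.isHomogeneous_X ℂ j)
    rwa [pow_one] at this
  have h1 : v (awayPoly i g) = g.eval₂ (v.comp (awayC i)) y := by
    rw [awayPoly, MvPolynomial.coe_eval₂Hom, MvPolynomial.hom_eval₂]
  have h2 : t ^ d * g.eval₂ (v.comp (awayC i)) y = algebraMap _ L g := by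
    rw [← hg.eval₂_mul]
    simp only [hy]
    have : v.comp (awayC i) = (algebraMap (MvPolynomial σ ℂ) L).comp MvPolynomial.C := by
      ext c
      simp [v, HomogeneousLocalization.fromZeroRingHom]
      rfl
    rw [this, ← MvPolynomial.coe_eval₂Hom]
    have h3 : MvPolynomial.eval₂Hom ((algebraMap (MvPolynomial σ ℂ) L).comp MvPolynomial.C)
        (fun j => algebraMap (MvPolynomial σ ℂ) L (.X j)) = algebraMap (MvPolynomial σ ℂ) L := by
      ext <;> simp
    rw [h3]
  refine (ht.pow d).mul_left_cancel ?_
  rw [hfrac hg, ← h2, ← h1]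
  rfl

theorem awayPoly_surjective (i : σ) : Function.Surjective (awayPoly i) := by
  intro z
  obtain ⟨d, g, hg, rfl⟩ :=
    HomogeneousLocalization.Away.mk_surjective (𝒜 σ ℂ) (X_mem_homogeneousSubmodule i) z
  have hg' : g.IsHomogeneous d := by rw [smul_eq_mul, mul_one] at hg; exact hg
  exact ⟨g, awayPoly_eq i hg'⟩

/-- Evaluation of fractions at points. -/
def evalAwayFun (i : σ) (U : Set (σ → ℂ)) (hU : ∀ a ∈ U, a i ≠ 0) :
    HomogeneousLocalization.Away (𝒜 σ ℂ) (MvPolynomial.X i) →+* (U → ℂ) :=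
  (Localization.awayLift (RingHom.pi fun a : U => MvPolynomial.eval a.1) (MvPolynomial.X i)
    (isUnit_iff_exists_inv.2 ⟨fun a => (a.1 i)⁻¹, funext fun a =>
      (congrArg (· * (a.1 i)⁻¹) (MvPolynomial.eval_X i)).trans (mul_inv_cancel₀ (hU a.1 a.2))⟩)).comp (algebraMap _ (Localization.Away _))

theorem evalAwayFun_awayFrac (i : σ) (U : Set (σ → ℂ)) (hU : ∀ a ∈ U, a i ≠ 0) {d : ℕ}
    {g : MvPolynomial σ ℂ} (hg : g.IsHomogeneous d) (a : U) :
    evalAwayFun i U hU (awayFrac i d g hg) a = MvPolynomial.eval a.1 g / a.1 i ^ d := by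
  rw [evalAwayFun, RingHom.comp_apply, HomogeneousLocalization.algebraMap_apply,
    HomogeneousLocalization.Away.val_mk, Localization.awayLift_mk _ _ _ (fun a => (a.1 i)⁻¹)]
  · rw [div_eq_mul_inv, ← inv_pow]
    rfl
  · exact funext fun a =>
      (congrArg (· * (a.1 i)⁻¹) (MvPolynomial.eval_X i)).trans (mul_inv_cancel₀ (hU a.1 a.2))

theorem evalAwayFun_awayPoly (i : σ) (U : Set (σ → ℂ)) (hU : ∀ a ∈ U, a i ≠ 0)
    (p : MvPolynomial σ ℂ) (a : U) :
    evalAwayFun i U hU (awayPoly i p) a = MvPolynomial.eval (fun j => a.1 j / a.1 i) p := by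
  induction p using MvPolynomial.induction_on with
  | C c =>
    rw [awayPoly_eq i (MvPolynomial.isHomogeneous_C σ c), evalAwayFun_awayFrac]
    simp
  | add p q hp hq => rw [map_add, map_add, map_add, Pi.add_apply, hp, hq]
  | mul_X p j hp =>
    rw [map_mul, map_mul, map_mul, Pi.mul_apply, hp,
      awayPoly_eq i (MvPolynomial.isHomogeneous_X ℂ j), evalAwayFun_awayFrac]
    simp

theorem eval_ratio_mem (i : σ) (U : Set (σ → ℂ)) (p : MvPolynomial σ ℂ) :
    (fun a : U => MvPolynomial.eval (fun j => a.1 j / a.1 i) p) ∈ coordRing U (ratioGen i) := by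
  induction p using MvPolynomial.induction_on with
  | C c => simpa using const_mem_coordRing c
  | add p q hp hq => simpa using! add_mem hp hq
  | mul_X p j hp =>
    simpa using! mul_mem hp (gen_mem_coordRing (g := fun a : σ → ℂ => a j / a i) ⟨j, rfl⟩)

/-- Evaluation of fractions at points, as a map to the algebra of functions. -/
def evalAway (i : σ) (U : Set (σ → ℂ)) (hU : ∀ a ∈ U, a i ≠ 0) :
    HomogeneousLocalization.Away (𝒜 σ ℂ) (MvPolynomial.X i) →+* coordRing U (ratioGen i) :=
  (evalAwayFun i U hU).codRestrict _ fun z => by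
    obtain ⟨p, rfl⟩ := awayPoly_surjective i z
    rw [show evalAwayFun i U hU (awayPoly i p) = _ from funext (evalAwayFun_awayPoly i U hU p)]
    exact eval_ratio_mem i U p

theorem evalAway_awayPoly (i : σ) (U : Set (σ → ℂ)) (hU : ∀ a ∈ U, a i ≠ 0)
    (p : MvPolynomial σ ℂ) (a : U) :
    (evalAway i U hU (awayPoly i p)).1 a = MvPolynomial.eval (fun j => a.1 j / a.1 i) p :=
  evalAwayFun_awayPoly i U hU p a

theorem evalAway_surjective (i : σ) (U : Set (σ → ℂ)) (hU : ∀ a ∈ U, a i ≠ 0) :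
    Function.Surjective (evalAway i U hU) := by
  have key : ∀ f ∈ coordRing U (ratioGen i), ∃ p : MvPolynomial σ ℂ,
      ∀ a : U, MvPolynomial.eval (fun j => a.1 j / a.1 i) p = f a := by
    intro f hf
    induction hf using Algebra.adjoin_induction with
    | mem f hf =>
      obtain ⟨_, ⟨j, rfl⟩, rfl⟩ := hf
      exact ⟨.X j, fun a => by simp⟩
    | algebraMap c => exact ⟨.C c, fun a => by simp⟩
    | add f g _ _ hf hg =>
      obtain ⟨p, hp⟩ := hf
      obtain ⟨q, hq⟩ := hg
      exact ⟨p + q, fun a => by simp [hp, hq]⟩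
    | mul f g _ _ hf hg =>
      obtain ⟨p, hp⟩ := hf
      obtain ⟨q, hq⟩ := hg
      exact ⟨p * q, fun a => by simp [hp, hq]⟩
  rintro ⟨f, hf⟩
  obtain ⟨p, hp⟩ := key f hf
  exact ⟨awayPoly i p, Subtype.ext (funext fun a => (evalAway_awayPoly i U hU p a).trans (hp a))⟩

theorem evalAway_algebraMap (i : σ) (U : Set (σ → ℂ)) (hU : ∀ a ∈ U, a i ≠ 0) :
    (evalAway i U hU).comp (awayC i) = algebraMap ℂ (coordRing U (ratioGen i)) := by
  refine RingHom.ext fun c => Subtype.ext (funext fun a => ?_)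
  have : awayC i c = awayPoly i (.C c) := by simp [awayPoly]
  rw [RingHom.comp_apply, this, evalAway_awayPoly]
  simp

theorem awayPoly_X_self (i : σ) : awayPoly i (.X i) = 1 := by
  rw [awayPoly_eq i (MvPolynomial.isHomogeneous_X ℂ i)]
  refine HomogeneousLocalization.val_injective _ ?_
  rw [HomogeneousLocalization.Away.val_mk, HomogeneousLocalization.val_one]
  simp only [pow_one]
  rw [Localization.mk_eq_mk']
  exact IsLocalization.mk'_self _ (Submonoid.mem_powers _)

/-- The coordinate ring of a chart of projective space. -/
abbrev AwayX (i : σ) : Type :=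
  HomogeneousLocalization.Away (𝒜 σ ℂ) (MvPolynomial.X i : MvPolynomial σ ℂ)

/-- The chart of projective space where `x_i` is not zero. -/
def projChart (i : σ) : Spec (CommRingCat.of (AwayX i)) ⟶ ProjC σ :=
  Proj.awayι (𝒜 σ ℂ) (MvPolynomial.X i : MvPolynomial σ ℂ) (m := 1)
    (X_mem_homogeneousSubmodule i) one_pos

instance (i : σ) : IsOpenImmersion (projChart i) :=
  inferInstanceAs (IsOpenImmersion (Proj.awayι (𝒜 σ ℂ) (MvPolynomial.X i : MvPolynomial σ ℂ)
    (m := 1) (X_mem_homogeneousSubmodule i) one_pos))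

theorem opensRange_projChart (i : σ) : (projChart i).opensRange =
    Proj.basicOpen (𝒜 σ ℂ) (MvPolynomial.X i : MvPolynomial σ ℂ) :=
  Proj.opensRange_awayι (𝒜 σ ℂ) (MvPolynomial.X i : MvPolynomial σ ℂ) (m := 1)
    (X_mem_homogeneousSubmodule i) one_pos

theorem projChart_toSpecC (i : σ) : projChart i ≫ ProjC.toSpecC σ =
    Spec.map (CommRingCat.ofHom (awayC i)) := by
  rw [ProjC.toSpecC, projChart, Proj.awayι_toSpecZero_assoc, ← Spec.map_comp,
    ← CommRingCat.ofHom_comp]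

theorem X_notMem_projChart (i : σ)
    (q : Spec (CommRingCat.of (AwayX i))) :
    (MvPolynomial.X i : MvPolynomial σ ℂ) ∉ (projChart i q).asHomogeneousIdeal := by
  have : projChart i q ∈ (projChart i).opensRange := ⟨q, rfl⟩
  rwa [opensRange_projChart] at this

theorem mem_projChart (i : σ)
    (q : Spec (CommRingCat.of (AwayX i)))
    {d : ℕ} {g : MvPolynomial σ ℂ} (hg : g.IsHomogeneous d) :
    g ∈ (projChart i q).asHomogeneousIdeal ↔ awayPoly i g ∈ q.asIdeal := by
  -- The factor `X i` makes the degree positive, as `Proj.awayι_preimage_basicOpen` requires. It is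
  -- harmless: `X i` is not in the prime ideal and becomes 1 in the chart.
  have hg' : (MvPolynomial.X i * g).IsHomogeneous (1 + d) :=
    (MvPolynomial.isHomogeneous_X ℂ i).mul hg
  have h1 : MvPolynomial.X i * g ∈ (projChart i q).asHomogeneousIdeal ↔
      g ∈ (projChart i q).asHomogeneousIdeal := by
    have := (projChart i q).isPrime.mul_mem_iff_mem_or_mem (x := MvPolynomial.X i) (y := g)
    refine this.trans (or_iff_right ?_)
    exact X_notMem_projChart i q
  have h2 : awayPoly i (MvPolynomial.X i * g) = awayPoly i g := by
    rw [map_mul, awayPoly_X_self, one_mul]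
  rw [← h1, ← h2, ← not_iff_not]
  have h3 := Proj.awayι_preimage_basicOpen (𝒜 σ ℂ) (f := (MvPolynomial.X i : MvPolynomial σ ℂ)) (m := 1) (X_mem_homogeneousSubmodule i)
    one_pos (g := MvPolynomial.X i * g) (m' := 1 + d) hg' (by omega)
  have h4 := SetLike.ext_iff.1 h3 q
  refine h4.trans (not_congr ?_)
  rw [awayPoly_eq i hg']
  have : HomogeneousLocalization.Away.isLocalizationElem
      (X_mem_homogeneousSubmodule i) (hg' : _ ∈ 𝒜 σ ℂ (1 + d)) = awayFrac i (1 + d) _ hg' := by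
    refine HomogeneousLocalization.val_injective _ ?_
    rw [HomogeneousLocalization.Away.val_mk, HomogeneousLocalization.Away.val_mk]
    simp
  rw [this]

theorem homogenize_exists (i : σ) (p : MvPolynomial σ ℂ) :
    ∃ (d : ℕ) (P : MvPolynomial σ ℂ), P.IsHomogeneous d ∧
      ∀ (a : σ → ℂ), (a i = 0 → MvPolynomial.eval a P = 0) ∧
        (a i ≠ 0 → MvPolynomial.eval a P =
          a i ^ d * MvPolynomial.eval (fun j => a j / a i) p) := by
  let D := p.totalDegree
  -- The exponent `D + 1 - d` is always positive, so `P` also vanishes where `x_i = 0`. Thus a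
  -- relation that holds on the chart of `A` becomes a form that vanishes on all of `A`.
  let P := ∑ d ∈ Finset.range (D + 1),
    MvPolynomial.X i ^ (D + 1 - d) * MvPolynomial.homogeneousComponent d p
  refine ⟨D + 1, P, ?_, fun a => ⟨fun h => ?_, fun h => ?_⟩⟩
  · refine MvPolynomial.IsHomogeneous.sum _ _ _ fun d hd => ?_
    have hd' : d ≤ D := Nat.lt_succ_iff.1 (Finset.mem_range.1 hd)
    have := ((MvPolynomial.isHomogeneous_X ℂ i).pow (D + 1 - d)).mul
      (MvPolynomial.homogeneousComponent_isHomogeneous d p)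
    rwa [one_mul, Nat.sub_add_cancel (by omega)] at this
  · simp only [P, map_sum, map_mul, map_pow, MvPolynomial.eval_X, h]
    refine Finset.sum_eq_zero fun d hd => ?_
    have hd' : d ≤ D := Nat.lt_succ_iff.1 (Finset.mem_range.1 hd)
    rw [zero_pow (by omega), zero_mul]
  · conv_rhs => rw [← MvPolynomial.sum_homogeneousComponent p]
    simp only [P, map_sum, map_mul, map_pow, MvPolynomial.eval_X, Finset.mul_sum]
    refine Finset.sum_congr rfl fun d hd => ?_
    have hd' : d ≤ D := Nat.lt_succ_iff.1 (Finset.mem_range.1 hd)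
    have h1 := (MvPolynomial.homogeneousComponent_isHomogeneous d p).eval₂_mul
      (RingHom.id ℂ) (a i) (fun j => a j / a i)
    have h2 : (fun j => a i * (a j / a i)) = a := funext fun j => by field_simp
    rw [h2] at h1
    rw [MvPolynomial.eval, MvPolynomial.coe_eval₂Hom, h1, ← mul_assoc, ← pow_add,
      Nat.sub_add_cancel (by omega)]
    rfl

/-- The part of `A` in a chart of projective space, where the coordinates in `s` are zero. -/
def projPiece (A : Set (σ → ℂ)) (i : σ) (s : Set σ) : Set (σ → ℂ) :=
  {a | a ∈ A ∧ a i ≠ 0 ∧ ∀ j ∈ s, a j = 0}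

/-- Forms that vanish on the piece lie in the kernel of evaluation, which gives one inclusion. For
the other, the Nullstellensatz reduces the claim to complex points `b` of the closure of `q`.
Homogenizing shows that `b` satisfies every relation valid on the chart of `A`, so by `hA` it comes
from a point of `A`, and the conditions on `s` put that point in the piece. -/
theorem range_evalAway (A : Set (σ → ℂ)) [Finite σ] (i : σ) (s : Set σ)
    (hA : (coordRing (A ∩ {a | a i ≠ 0}) (ratioGen i)).IsAff) :
    (Set.range (Spec.map (CommRingCat.ofHom (evalAway i (projPiece A i s) fun _ h => h.2.1))) :
      Set (Spec (CommRingCat.of (AwayX i)))) =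
      {q | projChart i q ∈ (projZeroLocus A : Set (ProjC σ)) ∧
        ∀ j ∈ s, (MvPolynomial.X j : MvPolynomial σ ℂ) ∈ (projChart i q).asHomogeneousIdeal} := by
  let U := projPiece A i s
  have hU : ∀ a ∈ U, a i ≠ 0 := fun _ h => h.2.1
  have h1 : Set.range (Spec.map (CommRingCat.ofHom (evalAway i U hU))) =
      PrimeSpectrum.zeroLocus (RingHom.ker (evalAway i U hU) : Set _) :=
    range_comap_of_surjective _ _ (evalAway_surjective i U hU)
  rw [h1]
  have hker : ∀ {d : ℕ} {g : MvPolynomial σ ℂ}, g.IsHomogeneous d →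
      (∀ a ∈ U, MvPolynomial.eval a g = 0) → awayPoly i g ∈ RingHom.ker (evalAway i U hU) := by
    intro d g hg h0
    rw [RingHom.mem_ker]
    refine Subtype.ext (funext fun a => ?_)
    rw [awayPoly_eq i hg]
    refine (evalAwayFun_awayFrac i U hU hg a).trans ?_
    rw [h0 a a.2, zero_div]
    rfl
  ext q
  constructor
  · intro hq
    refine ⟨?_, fun j hj => ?_⟩
    · rintro f ⟨⟨d, hd⟩, hf⟩
      exact (mem_projChart i q hd).2 (hq (hker hd fun a ha => hf a ha.1))
    · exact (mem_projChart i q (MvPolynomial.isHomogeneous_X ℂ j)).2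
        (hq (hker (MvPolynomial.isHomogeneous_X ℂ j) fun a ha => by simpa using ha.2.2 j hj))
  · rintro ⟨hq1, hq2⟩ z hz
    obtain ⟨p, rfl⟩ := awayPoly_surjective i z
    have hp : ∀ a ∈ U, MvPolynomial.eval (fun j => a j / a i) p = 0 := fun a ha => by
      rw [← evalAway_awayPoly i U hU p ⟨a, ha⟩, RingHom.mem_ker.1 hz]
      rfl
    have hprime : ((q.asIdeal.comap (awayPoly i)).radical) = q.asIdeal.comap (awayPoly i) :=
      (inferInstance : (q.asIdeal.comap (awayPoly i)).IsPrime).radical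
    change p ∈ q.asIdeal.comap (awayPoly i)
    rw [← hprime]
    refine mem_radical_of_forall_algHom _ _ fun φ hφ => ?_
    let b : σ → ℂ := fun j => φ (.X j)
    have hb : ∀ g, φ g = MvPolynomial.eval b g := fun g => by
      rw [← MvPolynomial.aeval_eq_eval]
      exact DFunLike.congr_fun (MvPolynomial.aeval_unique φ) g
    have hbi : b i = 1 := by
      have := hφ (.X i - 1) (by
        rw [Ideal.mem_comap, map_sub, awayPoly_X_self, map_one, sub_self]; exact zero_mem _)
      rw [map_sub, map_one, sub_eq_zero] at this
      exact this
    have hbh : ∀ {d : ℕ} {g : MvPolynomial σ ℂ}, g.IsHomogeneous d →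
        g ∈ (projChart i q).asHomogeneousIdeal → MvPolynomial.eval b g = 0 := fun hg h => by
      rw [← hb]
      exact hφ _ ((mem_projChart i q hg).1 h)
    obtain ⟨a, ha, hab⟩ := hA.exists_of_forall b fun f hf => by
      obtain ⟨d, P, hP, hP'⟩ := homogenize_exists i f
      have h2 : MvPolynomial.eval b P = 0 := hbh hP (hq1 ⟨⟨d, hP⟩, fun a ha => by
        by_cases hai : a i = 0
        · exact (hP' a).1 hai
        · rw [(hP' a).2 hai, hf a ⟨ha, hai⟩, mul_zero]⟩)
      rw [(hP' b).2 (by rw [hbi]; exact one_ne_zero), hbi, one_pow, one_mul] at h2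
      simpa using h2
    have haU : a ∈ U := ⟨ha.1, ha.2, fun j hj => by
      have h3 : b j = 0 := by
        simpa using hbh (MvPolynomial.isHomogeneous_X ℂ j) (hq2 j hj)
      have h4 := hab j
      rw [h3, div_eq_zero_iff] at h4
      exact h4.resolve_right ha.2⟩
    have h5 := hp a haU
    rw [hb, ← h5]
    congr 2
    exact funext fun j => (hab j).symm

theorem isAff_projPiece {A : Set (σ → ℂ)} {i : σ}
    (hA : (coordRing (A ∩ {a | a i ≠ 0}) (ratioGen i)).IsAff) (s : Set σ) :
    (coordRing (projPiece A i s) (ratioGen i)).IsAff := by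
  refine hA.of_closed (fun a h => ⟨h.1, h.2.1⟩) fun x hx hx' => ?_
  obtain ⟨j, hj, hj'⟩ : ∃ j ∈ s, x j ≠ 0 := by
    by_contra! h
    exact hx' ⟨hx.1, hx.2, h⟩
  exact ⟨fun a => a j / a i,
    gen_mem_coordRing (g := fun a : σ → ℂ => a j / a i) (Set.mem_range_self j),
    fun y hy => by simp [hy.2.2 j hj], div_ne_zero hj' hx.2⟩

/-- The class of a projective variety, given affine charts. -/
theorem cls_projVariety [Fintype σ] (A : Set (σ → ℂ)) (r : σ → ℕ)
    (hA : ∀ i, (coordRing (A ∩ {a | a i ≠ 0}) (ratioGen i)).IsAff)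
    (hr : Function.Injective r) :
    (projVariety A).cls = ∑ i, setCls (stratum r (fun j a => a j) A i) (ratioGen i) := by
  classical
  let f := ProjC.toSpecC σ
  let Z : TopologicalSpace.Closeds (ProjC σ) := projZeroLocus A
  let W : (ProjC σ).Opens := ⟨(Z : Set (ProjC σ))ᶜ, Z.isClosed.isOpen_compl⟩
  let D : σ → (ProjC σ).Opens := fun i => Proj.basicOpen (𝒜 σ ℂ) (.X i)
  -- Starting from the complement W of the variety Z, the standard open sets are added in the order
  -- of `r`. Adding the chart `a` contributes the points of Z in it that lie in no earlier chart.
  -- The final union is the whole projective space, whose class is [Z] + [W].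
  suffices H : ∀ s : Finset σ, clsOpen f (W ⊔ s.sup D) = clsOpen f W +
      ∑ i ∈ s, setCls (projPiece A i {j | j ∈ s ∧ r j < r i}) (ratioGen i) by
    have h1 := H Finset.univ
    have hcov : Finset.univ.sup D = ⊤ := by
      rw [Finset.sup_univ_eq_iSup]
      refine Proj.iSup_basicOpen_eq_top' (𝒜 σ ℂ) (fun i => .X i)
        (fun i => ⟨1, X_mem_homogeneousSubmodule i⟩) ?_
      rw [eq_top_iff]
      rintro p -
      induction p using MvPolynomial.induction_on with
      | C c =>
        exact Subalgebra.algebraMap_mem _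
          (⟨.C c, MvPolynomial.isHomogeneous_C σ c⟩ : 𝒜 σ ℂ 0)
      | add p q hp hq => exact add_mem hp hq
      | mul_X p i hp => exact mul_mem hp (Algebra.subset_adjoin (Set.mem_range_self i))
    rw [hcov, sup_top_eq, clsOpen_top] at h1
    have h2 := clsOf_eq_add_clsOpen f
      ((Scheme.IdealSheafData.vanishingIdeal Z).subschemeι ≫ f)
      (Scheme.IdealSheafData.vanishingIdeal Z).subschemeι rfl W (by
        rw [Scheme.IdealSheafData.range_subschemeι,
          Scheme.IdealSheafData.coe_support_vanishingIdeal]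
        rfl)
    rw [h2, add_comm] at h1
    refine (add_left_cancel h1).trans (Finset.sum_congr rfl fun i _ => ?_)
    congr 1
    ext a
    simp [projPiece, stratum]
    tauto
  intro s
  induction s using Finset.induction_on_max_value r with
  | empty => simp
  | insert a s ha hmax ih =>
    have hpiece : ∀ i ∈ s, projPiece A i {j | j ∈ insert a s ∧ r j < r i} =
        projPiece A i {j | j ∈ s ∧ r j < r i} := by
      intro i hi
      congr 1
      ext j
      simp only [Finset.mem_insert, Set.mem_ofPred_eq]
      refine and_congr_left fun hj => or_iff_right ?_
      rintro rfl
      exact (hmax i hi).not_gt hj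
    have hlast : projPiece A a {j | j ∈ insert a s ∧ r j < r a} = projPiece A a s := by
      congr 1
      ext j
      simp only [Finset.mem_insert, Set.mem_ofPred_eq, Finset.mem_coe]
      constructor
      · rintro ⟨rfl | h, h'⟩
        · exact absurd h' (lt_irrefl _)
        · exact h
      · exact fun h => ⟨.inr h, lt_of_le_of_ne (hmax j h) fun e => ha (hr e ▸ h)⟩
    rw [Finset.sum_insert ha, Finset.sum_congr rfl fun i hi => by rw [hpiece i hi], hlast,
      Finset.sup_insert, sup_comm (D a), ← sup_assoc]
    let U := projPiece A a s
    have hU : ∀ b ∈ U, b a ≠ 0 := fun _ h => h.2.1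
    have := (isAff_projPiece (hA a) (s : Set σ)).finiteType
    let i := Spec.map (CommRingCat.ofHom (evalAway a U hU))
    have : IsClosedImmersion i :=
      IsClosedImmersion.spec_of_surjective _ (evalAway_surjective a U hU)
    have hz : i ≫ projChart a ≫ f = specHom (coordRing U (ratioGen a)) := by
      rw [projChart_toSpecC, ← Spec.map_comp, ← CommRingCat.ofHom_comp, evalAway_algebraMap]
    have := isLocallyNoetherian_of_specC f
    have key := clsOpen_sup f (projChart a ≫ f) (W ⊔ s.sup D) (D a)
      (specHom (coordRing U (ratioGen a))) (projChart a)
      (opensRange_projChart a) rfl i hz ?_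
    · rw [key, ih, setCls_eq]
      change _ + specCls _ = _
      ring
    · rw [range_evalAway A a (s : Set σ) (hA a)]
      ext q
      simp only [Set.mem_ofPred_eq, Set.mem_preimage, Set.mem_compl_iff, SetLike.mem_coe,
        TopologicalSpace.Opens.mem_sup, not_or]
      refine and_congr not_not.symm ?_
      have hD : ∀ x, x ∈ s.sup D ↔ ∃ j ∈ s, x ∈ D j := fun x => by
        rw [Finset.sup_eq_iSup]
        simp only [TopologicalSpace.Opens.mem_iSup, exists_prop]
      rw [hD]
      push Not
      exact forall₂_congr fun j _ => not_not.symm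

/-! ### Projective space -/

section
variable {ι : Type} [DecidableEq ι]

/-- The points with `x_i` not zero and `x_j` zero for `j` outside of `s` and different from `i`. -/
theorem isAff_and_cls_projCell (i : ι) (s : Set ι) (hi : i ∉ s) [Fintype s] (U : Set (ι → ℂ))
    (hU : ∀ a, a ∈ U ↔ a i ≠ 0 ∧ ∀ j, j ≠ i → j ∉ s → a j = 0) :
    (coordRing U (ratioGen i)).IsAff ∧
      setCls U (ratioGen i) = lefschetz ^ Fintype.card s := by
  classical
  have hV := isAff_affineSpace s
  let e : U → (Set.univ : Set (s → ℂ)) := fun a => ⟨fun j => a.1 j / a.1 i, trivial⟩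
  let w : (s → ℂ) → ι → ℂ := fun v j => if h : j ∈ s then v ⟨j, h⟩ else if j = i then 1 else 0
  have hwi : ∀ v, w v i = 1 := fun v => by simp [w, hi]
  let e' : ↥(Set.univ : Set (s → ℂ)) → U := fun v => ⟨w v.1, (hU _).2 ⟨by simp [hwi],
    fun j hj hjs => by simp [w, hj, hjs]⟩⟩
  have he : ∀ h ∈ coordGen s, (fun u => h (e u)) ∈ coordRing U (ratioGen i) := by
    rintro _ ⟨j, rfl⟩
    exact gen_mem_coordRing (g := fun a : ι → ℂ => a j / a i) ⟨_, rfl⟩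
  have he' : ∀ g ∈ ratioGen i, (fun v => g (e' v)) ∈ coordRing Set.univ (coordGen s) := by
    rintro _ ⟨j, rfl⟩
    simp only [e', hwi, div_one]
    by_cases h : j ∈ s
    · simp only [w, h, dite_true]
      exact coord_mem (ι := s) ⟨j, h⟩
    · simp only [w, h, dite_false]
      exact const_mem_coordRing _
  have hl : ∀ g ∈ ratioGen i, ∀ u, g (e' (e u)) = g u := by
    rintro _ ⟨j, rfl⟩ u
    have hu := (hU _).1 u.2
    simp only [e', hwi, div_one]
    by_cases h : j ∈ s
    · simp [w, h, e]
    · by_cases hj : j = i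
      · subst hj; simp [w, h, hu.1]
      · simp [w, h, hj, hu.2 j hj h]
  have hr : ∀ h ∈ coordGen s, ∀ v, h (e (e' v)) = h v := by
    rintro _ ⟨j, rfl⟩ v
    simp only [e, e', hwi, div_one]
    simp [w]
  exact ⟨isAff_of_equiv hV e e' he he' hl hr,
    (cls_eq_of_equiv hV e e' he he' hl hr).trans (cls_affineSpace s)⟩

end

theorem projectiveSpace_cls (m : ℕ) : (projectiveSpace m).cls = geomL (m + 1) := by
  classical
  -- Only the zero polynomial vanishes at all vectors, so the closed subset given by `Set.univ` has
  -- all points of Proj.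
  have h0 : (projectiveSpace m).cls = (projVariety (Set.univ : Set (Fin (m + 1) → ℂ))).cls := by
    let Z := Scheme.IdealSheafData.vanishingIdeal (projZeroLocus (Set.univ : Set (Fin (m + 1) → ℂ)))
    refine clsOf_eq_of_range_eq (ProjC.toSpecC (Fin (m + 1))) (ProjC.toSpecC _)
      (Z.subschemeι ≫ ProjC.toSpecC _) (𝟙 _) (Category.id_comp _) Z.subschemeι rfl ?_
    rw [Scheme.IdealSheafData.range_subschemeι,
      Scheme.IdealSheafData.coe_support_vanishingIdeal]
    have : (projZeroLocus (Set.univ : Set (Fin (m + 1) → ℂ)) : Set (ProjC (Fin (m + 1)))) =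
        Set.univ := by
      refine Set.eq_univ_of_forall fun x => ?_
      rintro f ⟨-, hf⟩
      have : f = 0 := MvPolynomial.funext fun a => by simpa using hf a trivial
      rw [this]
      exact zero_mem _
    rw [this]
    simp
  rw [h0, cls_projVariety Set.univ Fin.val (fun i => ?_) Fin.val_injective, ← sum_fin_rev]
  · refine Finset.sum_congr rfl fun i _ => ?_
    rw [(isAff_and_cls_projCell i {j | i < j} (by simp) _ fun a => ?_).2]
    · congr 1
      exact card_lt_fin i
    · simp only [stratum, Set.univ_inter, Set.mem_ofPred_eq, not_lt]
      refine and_congr_right fun _ => forall_congr' fun j => ?_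
      rw [lt_iff_le_and_ne]
      simp only [Fin.val_fin_le, Fin.val_ne_iff]
      tauto
  · refine (isAff_and_cls_projCell i {j | j ≠ i} (by simp) _ fun a => ?_).1
    simp only [Set.univ_inter, Set.mem_ofPred_eq, not_not]
    refine (and_iff_left ?_).symm
    intro j h h'
    exact absurd h' h

/-! ### Minors and Plücker coordinates -/

/-- Pulled back to ℂ^k along `w`, the form is a multiple of the determinant. -/
theorem AlternatingMap.map_sum_smul {V : Type*} [AddCommGroup V] [Module ℂ V] {k : ℕ}
    (f : V [⋀^Fin k]→ₗ[ℂ] ℂ) (A : Matrix (Fin k) (Fin k) ℂ) (w : Fin k → V) :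
    f (fun a => ∑ b, A a b • w b) = A.det * f w := by
  have h := DFunLike.congr_fun ((f.compLinearMap
    (Fintype.linearCombination ℂ w)).eq_smul_basis_det (Pi.basisFun ℂ (Fin k))) A.row
  simp [AlternatingMap.compLinearMap_apply, Fintype.linearCombination_apply,
    Pi.basisFun_det, Matrix.row_def, Pi.single_apply] at h
  rw [mul_comm]
  exact h

/-- The minor of the `k × n` matrix `w` with columns `f`. -/
def minor {n k : ℕ} (w : Fin k → Fin n → ℂ) (f : Fin k → Fin n) : ℂ :=
  (Matrix.of fun a b => w a (f b)).det

/-- The minor with columns `f` as an alternating map. -/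
def minorMap {n k : ℕ} (f : Fin k → Fin n) : (Fin n → ℂ) [⋀^Fin k]→ₗ[ℂ] ℂ :=
  Matrix.detRowAlternating.compLinearMap (LinearMap.funLeft ℂ ℂ f)

section
variable {n k : ℕ}

theorem minorMap_apply (f : Fin k → Fin n) (w : Fin k → Fin n → ℂ) : minorMap f w = minor w f :=
  rfl

theorem minor_sum_smul {N : ℕ} (A : Fin k → Fin N → ℂ) (w : Fin N → Fin n → ℂ)
    (g : Fin N → Fin n) (h : ∀ a b, w a (g b) = if a = b then 1 else 0) (f : Fin k → Fin N) :
    minor (fun a => ∑ b, A a b • w b) (g ∘ f) = minor A f := by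
  simp [minor, h]

theorem linearIndependent_of_minor_ne_zero {w : Fin k → Fin n → ℂ} {f : Fin k → Fin n}
    (h : minor w f ≠ 0) : LinearIndependent ℂ w := by
  by_contra hw
  exact h ((minorMap f).map_linearDependent w hw)

theorem minor_perm (w : Fin k → Fin n → ℂ) (f : Fin k → Fin n) (σ : Equiv.Perm (Fin k)) :
    minor w (f ∘ σ) = (Equiv.Perm.sign σ : ℤ) * minor w f :=
  Matrix.det_permute' σ (Matrix.of fun a b => w a (f b))

theorem minor_eq_zero_of_not_injective (w : Fin k → Fin n → ℂ) {f : Fin k → Fin n}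
    (h : ¬ Function.Injective f) : minor w f = 0 := by
  simp only [Function.Injective, not_forall] at h
  obtain ⟨a, b, hab, hne⟩ := h
  exact Matrix.det_zero_of_column_eq hne fun c => by simp [hab]

theorem exists_orderEmbedding {f : Fin k → Fin n} (h : Function.Injective f) :
    ∃ (I : Fin k ↪o Fin n) (σ : Equiv.Perm (Fin k)), f = I ∘ σ := by
  have h1 : StrictMono (f ∘ Tuple.sort f) :=
    (Tuple.monotone_sort f).strictMono_of_injective (h.comp (Tuple.sort f).injective)
  refine ⟨OrderEmbedding.ofStrictMono _ h1, (Tuple.sort f)⁻¹, ?_⟩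
  ext x
  simp

/-- Row rank equals column rank, so there are `k` independent columns; sorting them changes only the
sign of the minor. -/
theorem exists_minor_ne_zero {w : Fin k → Fin n → ℂ} (h : LinearIndependent ℂ w) :
    ∃ I : Fin k ↪o Fin n, minor w I ≠ 0 := by
  suffices H : ∃ f : Fin k → Fin n, minor w f ≠ 0 by
    obtain ⟨f, hf⟩ := H
    have hi : Function.Injective f := by
      by_contra hi
      exact hf (minor_eq_zero_of_not_injective w hi)
    obtain ⟨I, σ, rfl⟩ := exists_orderEmbedding hi
    rw [minor_perm] at hf
    exact ⟨I, right_ne_zero_of_mul hf⟩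
  have hr : (Matrix.of w).rank = k := by
    rw [LinearIndependent.rank_matrix (M := Matrix.of w) h, Fintype.card_fin]
  rw [Matrix.rank_eq_finrank_span_cols] at hr
  obtain ⟨κ, a, ha, hsp, hli⟩ := exists_linearIndependent' ℂ (Matrix.of w).col
  have := Finite.of_injective a ha
  have := Fintype.ofFinite κ
  rw [← hsp, finrank_span_eq_card hli] at hr
  let e := (Fintype.equivFinOfCardEq hr).symm
  refine ⟨a ∘ e, ?_⟩
  have hu : LinearIndependent ℂ (Matrix.of fun a' b => w a' (a (e b))).col :=
    hli.comp e e.injective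
  rw [Matrix.linearIndependent_cols_iff_isUnit, Matrix.isUnit_iff_isUnit_det] at hu
  exact hu.ne_zero

theorem eq_sum_smul_of_mem_span {N : ℕ} {w : Fin N → Fin n → ℂ} {u : Fin k → Fin n → ℂ}
    (h : ∀ a, u a ∈ Submodule.span ℂ (Set.range w)) :
    ∃ A : Matrix (Fin k) (Fin N) ℂ, u = fun a => ∑ b, A a b • w b := by
  choose A hA using fun a => (Submodule.mem_span_range_iff_exists_fun ℂ).1 (h a)
  exact ⟨A, funext fun a => (hA a).symm⟩

/-- A change of basis multiplies all maximal minors by one determinant, and this is not zero because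
some minor of `w` is not. -/
theorem exists_minor_eq_mul {w w' : Fin k → Fin n → ℂ} (hw : LinearIndependent ℂ w)
    (h : ∀ a, w a ∈ Submodule.span ℂ (Set.range w')) :
    ∃ A : Matrix (Fin k) (Fin k) ℂ, A.det ≠ 0 ∧ w = (fun a => ∑ b, A a b • w' b) ∧
      ∀ f, minor w f = A.det * minor w' f := by
  obtain ⟨A, rfl⟩ := eq_sum_smul_of_mem_span h
  have hm : ∀ f, minor (fun a => ∑ b, A a b • w' b) f = A.det * minor w' f := fun f =>
    (minorMap f).map_sum_smul A w'
  refine ⟨A, fun h0 => ?_, rfl, hm⟩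
  obtain ⟨I, hI⟩ := exists_minor_ne_zero hw
  rw [hm, h0, zero_mul] at hI
  exact hI rfl

/-- The set of `k`-dimensional subspaces of `ℂⁿ`. -/
def grassSet (n k : ℕ) : Set (Submodule ℂ (Fin n → ℂ)) := {W | Module.finrank ℂ W = k}

theorem span_mem_grassSet {w : Fin k → Fin n → ℂ} (h : LinearIndependent ℂ w) :
    Submodule.span ℂ (Set.range w) ∈ grassSet n k := by
  rw [grassSet, Set.mem_ofPred_eq, finrank_span_eq_card h, Fintype.card_fin]

theorem span_eq_of_mem {W : Submodule ℂ (Fin n → ℂ)} (hW : W ∈ grassSet n k)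
    {w : Fin k → Fin n → ℂ} (h : LinearIndependent ℂ w) (hw : ∀ a, w a ∈ W) :
    Submodule.span ℂ (Set.range w) = W :=
  Submodule.eq_of_le_of_finrank_eq (Submodule.span_le.2 (Set.range_subset_iff.2 hw))
    ((span_mem_grassSet h).trans hW.symm)

open Classical in
/-- A basis of a subspace of dimension `k`. -/
def grassBasis (k : ℕ) (W : Submodule ℂ (Fin n → ℂ)) : Fin k → Fin n → ℂ :=
  if h : ∃ w : Fin k → Fin n → ℂ, LinearIndependent ℂ w ∧ Submodule.span ℂ (Set.range w) = W
    then h.choose else 0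

theorem grassBasis_spec {W : Submodule ℂ (Fin n → ℂ)} (hW : W ∈ grassSet n k) :
    LinearIndependent ℂ (grassBasis k W) ∧
      Submodule.span ℂ (Set.range (grassBasis k W)) = W := by
  have h : ∃ w : Fin k → Fin n → ℂ,
      LinearIndependent ℂ w ∧ Submodule.span ℂ (Set.range w) = W := by
    let b := (Module.finBasis ℂ W).reindex (finCongr hW)
    have hb : LinearIndependent ℂ (fun a => (b a : Fin n → ℂ)) :=
      b.linearIndependent.map' W.subtype W.ker_subtype
    exact ⟨_, hb, span_eq_of_mem hW hb fun a => (b a).2⟩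
  rw [grassBasis, dif_pos h]
  exact h.choose_spec

theorem grassBasis_mem {W : Submodule ℂ (Fin n → ℂ)} (hW : W ∈ grassSet n k) (a : Fin k) :
    grassBasis k W a ∈ W :=
  (grassBasis_spec hW).2.le (Submodule.subset_span (Set.mem_range_self a))

/-- The Plücker coordinates of a subspace of dimension `k`, for the basis `grassBasis k W`. -/
def pluckerCoord (f : Fin k → Fin n) (W : Submodule ℂ (Fin n → ℂ)) : ℂ := minor (grassBasis k W) f

theorem exists_minor_eq {W : Submodule ℂ (Fin n → ℂ)} (hW : W ∈ grassSet n k)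
    {w : Fin k → Fin n → ℂ} (h : LinearIndependent ℂ w) (hw : ∀ a, w a ∈ W) :
    ∃ A : Matrix (Fin k) (Fin k) ℂ, A.det ≠ 0 ∧ w = (fun a => ∑ b, A a b • grassBasis k W b) ∧
      ∀ f, minor w f = A.det * pluckerCoord f W :=
  exists_minor_eq_mul h fun a => by rw [(grassBasis_spec hW).2]; exact hw a

/-- The coordinates depend on the chosen basis; their vanishing does not, nor do their ratios
(`pluckerCoord_div`). Only these are used. -/
theorem pluckerCoord_ne_zero {W : Submodule ℂ (Fin n → ℂ)} (hW : W ∈ grassSet n k)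
    {w : Fin k → Fin n → ℂ} (h : LinearIndependent ℂ w) (hw : ∀ a, w a ∈ W) (f : Fin k → Fin n) :
    pluckerCoord f W ≠ 0 ↔ minor w f ≠ 0 := by
  obtain ⟨A, hA, -, hm⟩ := exists_minor_eq hW h hw
  rw [hm, mul_ne_zero_iff, and_iff_right hA]

theorem pluckerCoord_div {W : Submodule ℂ (Fin n → ℂ)} (hW : W ∈ grassSet n k)
    {w : Fin k → Fin n → ℂ} (h : LinearIndependent ℂ w) (hw : ∀ a, w a ∈ W)
    (f g : Fin k → Fin n) : pluckerCoord f W / pluckerCoord g W = minor w f / minor w g := by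
  obtain ⟨A, hA, -, hm⟩ := exists_minor_eq hW h hw
  rw [hm, hm, mul_div_mul_left _ _ hA]

theorem exists_pluckerCoord_ne_zero {W : Submodule ℂ (Fin n → ℂ)} (hW : W ∈ grassSet n k) :
    ∃ I : Fin k ↪o Fin n, pluckerCoord I W ≠ 0 := exists_minor_ne_zero (grassBasis_spec hW).1

theorem exists_normal_basis {W : Submodule ℂ (Fin n → ℂ)} (hW : W ∈ grassSet n k)
    {f : Fin k → Fin n} (hf : pluckerCoord f W ≠ 0) :
    ∃ w : Fin k → Fin n → ℂ, (∀ a, w a ∈ W) ∧ ∀ a b, w a (f b) = if a = b then 1 else 0 := by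
  let B : Matrix (Fin k) (Fin k) ℂ := Matrix.of fun a b => grassBasis k W a (f b)
  have hB : IsUnit B.det := isUnit_iff_ne_zero.2 hf
  refine ⟨fun a => ∑ b, B⁻¹ a b • grassBasis k W b, fun a => sum_mem fun b _ =>
    W.smul_mem _ (grassBasis_mem hW b), fun a b => ?_⟩
  have := congrFun (congrFun (Matrix.nonsing_inv_mul B hB) a) b
  rw [Matrix.mul_apply, Matrix.one_apply] at this
  simpa [B] using! this

open Classical in
/-- The basis of `W` for which the columns `f` form the identity matrix. -/
def normalBasis (f : Fin k → Fin n) (W : Submodule ℂ (Fin n → ℂ)) : Fin k → Fin n → ℂ :=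
  if h : ∃ w : Fin k → Fin n → ℂ, (∀ a, w a ∈ W) ∧ ∀ a b, w a (f b) = if a = b then 1 else 0
    then h.choose else 0

theorem minor_of_eq_one {w : Fin k → Fin n → ℂ} {f : Fin k → Fin n}
    (h : ∀ a b, w a (f b) = if a = b then 1 else 0) : minor w f = 1 := by
  have : (Matrix.of fun a b => w a (f b)) = (1 : Matrix (Fin k) (Fin k) ℂ) := by
    ext a b
    simp [h, Matrix.one_apply]
  rw [minor, this, Matrix.det_one]

/-- Replacing one column of the identity matrix gives a determinant equal to a single entry. Hence
the entries of a normalized basis are ratios of Plücker coordinates, so they are regular functions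
on the chart. -/
theorem minor_update {w : Fin k → Fin n → ℂ} {f : Fin k → Fin n}
    (h : ∀ a b, w a (f b) = if a = b then 1 else 0) (a : Fin k) (i : Fin n) :
    minor w (Function.update f a i) = w a i := by
  have : (Matrix.of fun a' b => w a' (Function.update f a i b)) =
      (1 : Matrix (Fin k) (Fin k) ℂ).updateCol a fun a' => w a' i := by
    ext a' b
    by_cases hb : b = a
    · subst hb; simp
    · simp [hb, h, Matrix.one_apply]
  rw [minor, this, ← Matrix.cramer_apply, Matrix.cramer_one]
  rfl

section
variable {W : Submodule ℂ (Fin n → ℂ)} {f : Fin k → Fin n}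

theorem normalBasis_mem (hW : W ∈ grassSet n k) (hf : pluckerCoord f W ≠ 0) (a : Fin k) :
    normalBasis f W a ∈ W := by
  rw [normalBasis, dif_pos (exists_normal_basis hW hf)]
  exact (exists_normal_basis hW hf).choose_spec.1 a

theorem normalBasis_apply (hW : W ∈ grassSet n k) (hf : pluckerCoord f W ≠ 0) (a b : Fin k) :
    normalBasis f W a (f b) = if a = b then 1 else 0 := by
  rw [normalBasis, dif_pos (exists_normal_basis hW hf)]
  exact (exists_normal_basis hW hf).choose_spec.2 a b

theorem linearIndependent_of_eq_one {w : Fin k → Fin n → ℂ}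
    (h : ∀ a b, w a (f b) = if a = b then 1 else 0) : LinearIndependent ℂ w :=
  linearIndependent_of_minor_ne_zero (f := f) (by rw [minor_of_eq_one h]; exact one_ne_zero)

theorem span_normalBasis (hW : W ∈ grassSet n k) (hf : pluckerCoord f W ≠ 0) :
    Submodule.span ℂ (Set.range (normalBasis f W)) = W :=
  span_eq_of_mem hW (linearIndependent_of_eq_one (normalBasis_apply hW hf))
    (normalBasis_mem hW hf)

theorem pluckerCoord_div_eq (hW : W ∈ grassSet n k) {w : Fin k → Fin n → ℂ}
    (h : ∀ a b, w a (f b) = if a = b then 1 else 0) (hw : ∀ a, w a ∈ W) (g : Fin k → Fin n) :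
    pluckerCoord g W / pluckerCoord f W = minor w g := by
  rw [pluckerCoord_div hW (linearIndependent_of_eq_one h) hw, minor_of_eq_one h, div_one]

theorem pluckerCoord_ne_zero_of_eq_one (hW : W ∈ grassSet n k) {w : Fin k → Fin n → ℂ}
    (h : ∀ a b, w a (f b) = if a = b then 1 else 0) (hw : ∀ a, w a ∈ W) :
    pluckerCoord f W ≠ 0 := by
  rw [pluckerCoord_ne_zero hW (linearIndependent_of_eq_one h) hw, minor_of_eq_one h]
  exact one_ne_zero

theorem normal_apply_eq_div (hW : W ∈ grassSet n k) {w : Fin k → Fin n → ℂ}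
    (h : ∀ a b, w a (f b) = if a = b then 1 else 0) (hw : ∀ a, w a ∈ W) (a : Fin k) (i : Fin n) :
    w a i = pluckerCoord (Function.update f a i) W / pluckerCoord f W := by
  rw [pluckerCoord_div_eq hW h hw, minor_update h]

theorem eq_normalBasis (hW : W ∈ grassSet n k) {w : Fin k → Fin n → ℂ}
    (h : ∀ a b, w a (f b) = if a = b then 1 else 0) (hw : ∀ a, w a ∈ W) :
    w = normalBasis f W := by
  have hf := pluckerCoord_ne_zero_of_eq_one hW h hw
  ext a i
  rw [normal_apply_eq_div hW h hw,
    ← normal_apply_eq_div hW (normalBasis_apply hW hf) (normalBasis_mem hW hf)]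

end

/-- The quotients of Plücker coordinates. -/
def grassGen (f : Fin k → Fin n) : Set (Submodule ℂ (Fin n → ℂ) → ℂ) :=
  Set.range fun (g : Fin k → Fin n) W => pluckerCoord g W / pluckerCoord f W

theorem normalBasis_mem_coordRing {U : Set (Submodule ℂ (Fin n → ℂ))} {f : Fin k → Fin n}
    (hU : ∀ W ∈ U, W ∈ grassSet n k ∧ pluckerCoord f W ≠ 0) (a : Fin k) (i : Fin n) :
    (fun W : U => normalBasis f W.1 a i) ∈ coordRing U (grassGen f) := by
  have : (fun W : U => normalBasis f W.1 a i) = fun W : U =>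
      pluckerCoord (Function.update f a i) W.1 / pluckerCoord f W.1 := funext fun W => by
    have h := hU W.1 W.2
    exact normal_apply_eq_div h.1 (normalBasis_apply h.1 h.2) (normalBasis_mem h.1 h.2) a i
  rw [this]
  exact gen_mem_coordRing (g := fun W => _ / pluckerCoord f W) ⟨_, rfl⟩

theorem minor_mem {X : Type} {A : Subalgebra ℂ (X → ℂ)} {w : X → Fin k → Fin n → ℂ}
    (hw : ∀ a i, (fun x => w x a i) ∈ A) (f : Fin k → Fin n) : (fun x => minor (w x) f) ∈ A := by
  have : (fun x => minor (w x) f) = ∑ σ : Equiv.Perm (Fin k),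
      (Equiv.Perm.sign σ : ℤ) • ∏ i, fun x => w x (σ i) (f i) := by
    ext x
    simp [minor, Matrix.det_apply, Units.smul_def]
  rw [this]
  exact sum_mem fun σ _ => zsmul_mem (prod_mem fun i _ => hw _ _) _

/-- The matrices with the identity matrix in the columns `f`. -/
def normalMatrices (f : Fin k → Fin n) : Set (Fin k × Fin n → ℂ) :=
  {m | ∀ a b, m (a, f b) = if a = b then 1 else 0}

/-- The chart is an affine space of matrices with identity block `f`, by row span in one direction
and the normalized basis in the other. Entries are ratios of Plücker coordinates, and these ratios
are minors of the matrix. -/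
theorem isAff_grassChart (f : Fin k → Fin n) :
    (coordRing (grassSet n k ∩ {W | pluckerCoord f W ≠ 0}) (grassGen f)).IsAff := by
  have hV : (coordRing (normalMatrices f) (coordGen (Fin k × Fin n))).IsAff := by
    refine (isAff_affineSpace _).of_closed (Set.subset_univ _) fun m _ hm => ?_
    simp only [normalMatrices, Set.mem_ofPred_eq, not_forall] at hm
    obtain ⟨a, b, hab⟩ := hm
    exact ⟨fun m => m (a, f b) - if a = b then 1 else 0,
      sub_mem (coord_mem (a, f b)) (const_mem_coordRing _),
      fun y hy => sub_eq_zero.2 (hy a b), sub_ne_zero.2 hab⟩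
  let row : (Fin k × Fin n → ℂ) → Fin k → Fin n → ℂ := fun m a i => m (a, i)
  let W : (Fin k × Fin n → ℂ) → Submodule ℂ (Fin n → ℂ) := fun m =>
    Submodule.span ℂ (Set.range (row m))
  have h1 : ∀ m ∈ normalMatrices f, W m ∈ grassSet n k := fun m hm =>
    span_mem_grassSet (linearIndependent_of_eq_one (w := row m) (f := f) hm)
  have h0 : ∀ m ∈ normalMatrices f, ∀ a b, row m a (f b) = if a = b then 1 else 0 :=
    fun m hm => hm
  have h2 : ∀ m a, row m a ∈ W m := fun m a => Submodule.subset_span (Set.mem_range_self a)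
  refine isAff_of_equiv hV
    (fun V => ⟨fun p => normalBasis f V.1 p.1 p.2, normalBasis_apply V.2.1 V.2.2⟩)
    (fun m => ⟨W m.1, h1 _ m.2, pluckerCoord_ne_zero_of_eq_one (h1 _ m.2) (h0 _ m.2) (h2 m.1)⟩)
    ?_ ?_ ?_ ?_
  · rintro _ ⟨p, rfl⟩
    exact normalBasis_mem_coordRing (fun _ h => h) p.1 p.2
  · rintro _ ⟨g, rfl⟩
    have : (fun m : normalMatrices f => pluckerCoord g (W m.1) / pluckerCoord f (W m.1)) =
        fun m => minor (row m.1) g :=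
      funext fun m => pluckerCoord_div_eq (h1 _ m.2) (h0 _ m.2) (h2 m.1) g
    dsimp only
    rw [this]
    exact minor_mem (fun a i => coord_mem (a, i)) g
  · intro g _ V
    have : W (fun p => normalBasis f V.1 p.1 p.2) = V.1 := span_normalBasis V.2.1 V.2.2
    dsimp only
    rw [this]
  · rintro _ ⟨p, rfl⟩ m
    exact congrFun (congrFun (eq_normalBasis (h1 _ m.2) (h0 _ m.2) (h2 m.1)) p.1).symm p.2

/-- The generators in `grassGen` allow any columns, while the Plücker embedding uses increasing
ones; up to constants the former add nothing. -/
theorem minor_eq_or (f : Fin k → Fin n) : (∀ w : Fin k → Fin n → ℂ, minor w f = 0) ∨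
    ∃ (I : Fin k ↪o Fin n) (c : ℂ), ∀ w : Fin k → Fin n → ℂ, minor w f = c * minor w I := by
  by_cases hf : Function.Injective f
  · obtain ⟨I, σ, rfl⟩ := exists_orderEmbedding hf
    exact .inr ⟨I, _, fun w => minor_perm w I σ⟩
  · exact .inl fun w => minor_eq_zero_of_not_injective w hf

/-- The class of a chart of a subvariety of the Grassmannian, where the Plücker coordinates in `s`
are zero, in Plücker coordinates. -/
theorem isAff_and_cls_plucker {𝒲 : Set (Submodule ℂ (Fin n → ℂ))} (h𝒲 : 𝒲 ⊆ grassSet n k)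
    (I : Fin k ↪o Fin n) (s : Set (Fin k ↪o Fin n))
    (hA : (coordRing (𝒲 ∩ {W | pluckerCoord I W ≠ 0 ∧ ∀ J ∈ s, pluckerCoord J W = 0})
      (grassGen I)).IsAff) (A : Set ((Fin k ↪o Fin n) → ℂ))
    (hA' : ∀ a, a ∈ A ↔ (∃ w : Fin k → Fin n → ℂ,
      LinearIndependent ℂ w ∧ Submodule.span ℂ (Set.range w) ∈ 𝒲 ∧ a = plucker w) ∧
        a I ≠ 0 ∧ ∀ J ∈ s, a J = 0) :
    (coordRing A (ratioGen I)).IsAff ∧ setCls A (ratioGen I) =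
      setCls (𝒲 ∩ {W | pluckerCoord I W ≠ 0 ∧ ∀ J ∈ s, pluckerCoord J W = 0}) (grassGen I) := by
  have h1 : ∀ a : A, ∃ w : Fin k → Fin n → ℂ,
      LinearIndependent ℂ w ∧ Submodule.span ℂ (Set.range w) ∈ 𝒲 ∧ a.1 = plucker w :=
    fun a => ((hA' a.1).1 a.2).1
  choose w hw hw' ha using h1
  have hmem : ∀ a i, w a i ∈ Submodule.span ℂ (Set.range (w a)) := fun a i =>
    Submodule.subset_span (Set.mem_range_self i)
  have hne : ∀ (a : A) (J : Fin k ↪o Fin n),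
      pluckerCoord J (Submodule.span ℂ (Set.range (w a))) ≠ 0 ↔ a.1 J ≠ 0 := fun a J => by
    rw [pluckerCoord_ne_zero (h𝒲 (hw' a)) (hw a) (hmem a), ha a]
    rfl
  have hdiv : ∀ (a : A) (f : Fin k → Fin n),
      pluckerCoord f (Submodule.span ℂ (Set.range (w a))) /
        pluckerCoord I (Submodule.span ℂ (Set.range (w a))) = minor (w a) f / a.1 I := fun a f => by
    rw [pluckerCoord_div (h𝒲 (hw' a)) (hw a) (hmem a), ha a]
    rfl
  let e : A → ↥(𝒲 ∩ {W | pluckerCoord I W ≠ 0 ∧ ∀ J ∈ s, pluckerCoord J W = 0}) := fun a =>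
    ⟨Submodule.span ℂ (Set.range (w a)), hw' a, (hne a I).2 ((hA' a.1).1 a.2).2.1,
      fun J hJ => of_not_not fun h => (hne a J).1 h (((hA' a.1).1 a.2).2.2 J hJ)⟩
  let e' : ↥(𝒲 ∩ {W | pluckerCoord I W ≠ 0 ∧ ∀ J ∈ s, pluckerCoord J W = 0}) → A := fun W =>
    ⟨fun J => pluckerCoord J W.1, (hA' _).2 ⟨⟨grassBasis k W.1, (grassBasis_spec (h𝒲 W.2.1)).1, by
      rw [(grassBasis_spec (h𝒲 W.2.1)).2]
      exact W.2.1, rfl⟩, W.2.2⟩⟩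
  have he : ∀ h ∈ grassGen I, (fun a => h (e a)) ∈ coordRing A (ratioGen I) := by
    rintro _ ⟨f, rfl⟩
    have h2 : (fun a : A => minor (w a) f / a.1 I) ∈ coordRing A (ratioGen I) := by
      rcases minor_eq_or f with h0 | ⟨J, c, h0⟩
      · simp only [h0, zero_div]
        exact const_mem_coordRing 0
      · have h3 : (fun a : A => minor (w a) f / a.1 I) =
            (fun _ => c) * fun a => a.1 J / a.1 I := funext fun a => by
          rw [h0, mul_div_assoc, Pi.mul_apply, ha a]
          rfl
        rw [h3]
        exact mul_mem (const_mem_coordRing c)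
          (gen_mem_coordRing (g := fun a : (Fin k ↪o Fin n) → ℂ => a J / a I) ⟨J, rfl⟩)
    convert! h2 using 2 with a
    exact hdiv a f
  have he' : ∀ g ∈ ratioGen I, (fun W => g (e' W)) ∈ coordRing
      (𝒲 ∩ {W | pluckerCoord I W ≠ 0 ∧ ∀ J ∈ s, pluckerCoord J W = 0}) (grassGen I) := by
    rintro _ ⟨J, rfl⟩
    exact gen_mem_coordRing (g := fun W => pluckerCoord J W / pluckerCoord I W) ⟨J, rfl⟩
  -- `e' (e a)` is only proportional to `a`, since the span forgets the basis; the ratios are the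
  -- same.
  have hl : ∀ g ∈ ratioGen I, ∀ a, g (e' (e a)) = g a := by
    rintro _ ⟨J, rfl⟩ a
    refine (hdiv a J).trans ?_
    rw [ha a]
    rfl
  have hr : ∀ h ∈ grassGen I, ∀ W, h (e (e' W)) = h W := by
    rintro _ ⟨f, rfl⟩ W
    refine (hdiv (e' W) f).trans ?_
    rcases minor_eq_or f with h0 | ⟨J, c, h0⟩
    · simp only [pluckerCoord, h0, zero_div]
    · have h3 : minor (w (e' W)) J = (e' W).1 J := by rw [ha (e' W)]; rfl
      rw [h0, h3]
      simp only [pluckerCoord, h0]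
      rfl
  exact ⟨isAff_of_equiv hA e e' he he' hl hr, cls_eq_of_equiv hA e e' he he' hl hr⟩

/-- The class of a closed subvariety of the Grassmannian is the sum of the classes of its
strata. -/
theorem grassSubvariety_cls {𝒲 : Set (Submodule ℂ (Fin n → ℂ))} (h𝒲 : 𝒲 ⊆ grassSet n k)
    (hA : ∀ I : Fin k ↪o Fin n,
      (coordRing (𝒲 ∩ {W | pluckerCoord I W ≠ 0}) (grassGen I)).IsAff)
    [Fintype (Fin k ↪o Fin n)] (r : (Fin k ↪o Fin n) → ℕ) (hr : Function.Injective r) :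
    (grassSubvariety n k 𝒲).cls =
      ∑ I, setCls (stratum r (fun J => pluckerCoord J) 𝒲 I) (grassGen I) := by
  have hA' : ∀ (I : Fin k ↪o Fin n) (s : Set (Fin k ↪o Fin n)),
      (coordRing (𝒲 ∩ {W | pluckerCoord I W ≠ 0 ∧ ∀ J ∈ s, pluckerCoord J W = 0})
        (grassGen I)).IsAff := fun I s => by
    refine (hA I).of_closed (fun W h => ⟨h.1, h.2.1⟩) fun W h h' => ?_
    obtain ⟨J, hJ, hJ'⟩ : ∃ J ∈ s, pluckerCoord J W ≠ 0 := by
      by_contra! hc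
      exact h' ⟨h.1, h.2, hc⟩
    exact ⟨fun W => pluckerCoord J W / pluckerCoord I W,
      gen_mem_coordRing (g := fun W => pluckerCoord J W / pluckerCoord I W) ⟨J, rfl⟩,
      fun V hV => by simp [hV.2.2 J hJ], div_ne_zero hJ' h.2⟩
  rw [grassSubvariety, cls_projVariety _ r (fun I => ?_) hr]
  · exact Finset.sum_congr rfl fun I _ =>
      (isAff_and_cls_plucker h𝒲 I {J | r J < r I} (hA' I _) _ fun a => Iff.rfl).2
  · refine (isAff_and_cls_plucker h𝒲 I ∅ (hA' I _) _ fun a => ?_).1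
    simp

end

/-! ### Refining strata -/

section
variable {X α β : Type}

/-- The quotients of the functions `p` with denominators in `F`. -/
def quotGen (p : α → X → ℂ) (F : Set α) : Set (X → ℂ) :=
  {φ | ∃ f ∈ F, ∃ g, φ = fun x => p g x / p f x}

theorem quotGen_singleton (p : α → X → ℂ) (f : α) :
    quotGen p {f} = Set.range fun g x => p g x / p f x := by
  ext φ
  simp [quotGen, eq_comm]

theorem quot_mem {p : α → X → ℂ} {F : Set α} {K : Set (X → ℂ)} {E : Set X} {f : α} (hf : f ∈ F)
    (g : α) : (fun x : E => p g x / p f x) ∈ coordRing E (quotGen p F ∪ K) :=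
  gen_mem_coordRing (g := fun x => p g x / p f x) (.inl ⟨f, hf, g, rfl⟩)

/-- Inverting `p f' / p f` is the same as allowing the denominator `p f'`, because `p g / p f' = (p
g / p f) * (p f / p f')`. -/
theorem coordRing_insert_quotGen {p : α → X → ℂ} {F : Set α} {K : Set (X → ℂ)} {E : Set X}
    {f f' : α} (hf : f ∈ F) (hE : ∀ x ∈ E, p f x ≠ 0) (hE' : ∀ x ∈ E, p f' x ≠ 0) :
    coordRing E (insert (fun x => p f' x / p f x)⁻¹ (quotGen p F ∪ K)) =
      coordRing E (quotGen p (insert f' F) ∪ K) := by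
  refine coordRing_congr ?_ ?_
  · rintro _ (rfl | ⟨f₁, hf₁, g, rfl⟩ | h)
    · have := quot_mem (p := p) (F := insert f' F) (K := K) (E := E) (Set.mem_insert f' F) f
      simpa only [Pi.inv_apply, inv_div] using this
    · exact quot_mem (Set.mem_insert_of_mem _ hf₁) g
    · exact gen_mem_coordRing (.inr h)
  · rintro _ (⟨f₁, hf₁, g, rfl⟩ | h)
    · rcases Set.mem_insert_iff.1 hf₁ with h | h
      · subst h
        have h1 : (fun x : E => p g x / p f x) ∈
            coordRing E (insert (fun x => p f₁ x / p f x)⁻¹ (quotGen p F ∪ K)) :=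
          gen_mem_coordRing (g := fun x => p g x / p f x) (.inr (.inl ⟨f, hf, g, rfl⟩))
        have h2 : (fun x : E => (fun x => p f₁ x / p f x)⁻¹ x.1) ∈
            coordRing E (insert (fun x => p f₁ x / p f x)⁻¹ (quotGen p F ∪ K)) :=
          gen_mem_coordRing (.inl rfl)
        convert! mul_mem h1 h2 using 1
        ext x
        have := hE x x.2
        have := hE' x x.2
        simp only [Pi.mul_apply, Pi.inv_apply, inv_div]
        field_simp
      · exact gen_mem_coordRing (g := fun x => p g x / p f₁ x) (.inr (.inl ⟨f₁, h, g, rfl⟩))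
    · exact gen_mem_coordRing (.inr (.inr h))

/-- Division by the nonvanishing `p f` turns the functions `p (φ i)` into regular ones with the same
zeros. The residual stratum, where all of them vanish, is empty by `hφ`. -/
theorem isAff_and_cls_refine {p : α → X → ℂ} {F : Set α} {K : Set (X → ℂ)} {E : Set X}
    (hE : (coordRing E (quotGen p F ∪ K)).IsAff) {f : α} (hf : f ∈ F)
    (hpf : ∀ x ∈ E, p f x ≠ 0) {ι : Type} [Fintype ι] (r : ι → ℕ) (hr : Function.Injective r)
    (φ : ι → α) (hφ : ∀ x ∈ E, ∃ i, p (φ i) x ≠ 0) :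
    (∀ i, (coordRing (stratum r (fun i => p (φ i)) E i)
      (quotGen p (insert (φ i) F) ∪ K)).IsAff) ∧
    setCls E (quotGen p F ∪ K) = ∑ i, setCls (stratum r (fun i => p (φ i)) E i)
      (quotGen p (insert (φ i) F) ∪ K) := by
  have hm : ∀ i, (fun x : E => p (φ i) x / p f x) ∈ coordRing E (quotGen p F ∪ K) :=
    fun i => quot_mem hf _
  have hs : ∀ i, stratum r (fun i x => p (φ i) x / p f x) E i =
      stratum r (fun i => p (φ i)) E i := by
    intro i
    ext x
    refine and_congr_right fun hx => ?_
    simp [hpf x hx]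
  have hc : ∀ i, coordRing (stratum r (fun i => p (φ i)) E i)
      (insert (fun x => p (φ i) x / p f x)⁻¹ (quotGen p F ∪ K)) =
      coordRing (stratum r (fun i => p (φ i)) E i) (quotGen p (insert (φ i) F) ∪ K) := fun i =>
    coordRing_insert_quotGen hf (fun x hx => hpf x hx.1) fun x hx => hx.2.1
  refine ⟨fun i => ?_, ?_⟩
  · rw [← hc, ← hs]
    exact hE.isAff_stratum r hm i
  · rw [hE.cls_eq_sum_stratum r hr (f := fun i x => p (φ i) x / p f x) hm, cls_coordRing_of_eq_empty (U := E ∩ _), add_zero]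
    · refine Finset.sum_congr rfl fun i _ => ?_
      rw [hs, setCls_congr (hc i)]
    · refine Set.eq_empty_of_forall_notMem fun x hx => ?_
      obtain ⟨i, hi⟩ := hφ x hx.1
      exact (div_ne_zero hi (hpf x hx.1)) (hx.2 i)

section
variable {ι κ : Type} [Fintype κ] {N N' : ℕ} {p : α → X → ℂ} {q : β → X → ℂ}
  {M : Set X} {φ : ι → α} {c : ι → Fin N → β} {ψ : κ → β} {d : κ → Fin N' → α}
  {r : ι → ℕ} {s : κ → ℕ}

/-- The strata of `M` for the functions `p (φ i)`, and then for the functions `q (c i j)`. -/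
def biStratum (p : α → X → ℂ) (q : β → X → ℂ) (M : Set X) (r : ι → ℕ) (φ : ι → α)
    (c : ι → Fin N → β) (i : ι) (j : Fin N) : Set X :=
  stratum Fin.val (fun j => q (c i j)) (stratum r (fun i => p (φ i)) M i) j

/-- A piece of one stratification is cut by the other in two steps, first by `ψ` and then by `d`;
each step adds the new denominator to the functions. -/
theorem cls_biStratum (hs : Function.Injective s) (hψ : ∀ x ∈ M, ∃ i, q (ψ i) x ≠ 0)
    (hd : ∀ x ∈ M, ∀ i, q (ψ i) x ≠ 0 → ∃ j, p (d i j) x ≠ 0) (i : ι) (j : Fin N)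
    (hA : (coordRing (biStratum p q M r φ c i j)
      (quotGen p {φ i} ∪ quotGen q {c i j})).IsAff) :
    setCls (biStratum p q M r φ c i j) (quotGen p {φ i} ∪ quotGen q {c i j}) =
      ∑ i', ∑ j', setCls (biStratum p q M r φ c i j ∩ biStratum q p M s ψ d i' j')
        (quotGen p {d i' j', φ i} ∪ quotGen q {ψ i', c i j}) := by
  rw [Set.union_comm] at hA ⊢
  obtain ⟨h1, h2⟩ := isAff_and_cls_refine hA (Set.mem_singleton _) (fun x hx => hx.2.1) s hs ψ
    fun x hx => hψ x hx.1.1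
  rw [h2]
  refine Finset.sum_congr rfl fun i' _ => ?_
  have h3 := h1 i'
  rw [Set.union_comm] at h3 ⊢
  obtain ⟨-, h4⟩ := isAff_and_cls_refine h3 (Set.mem_singleton _) (fun x hx => hx.1.1.2.1)
    Fin.val Fin.val_injective (d i') fun x hx => hd x hx.1.1.1 i' hx.2.1
  rw [h4]
  refine Finset.sum_congr rfl fun j' _ => ?_
  congr 1
  ext x
  simp only [biStratum, stratum, Set.mem_inter_iff]
  tauto

/-- The two stratifications of `M` have the same class. -/
theorem sum_cls_biStratum [Fintype ι] (hr : Function.Injective r) (hs : Function.Injective s)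
    (hφ : ∀ x ∈ M, ∃ i, p (φ i) x ≠ 0) (hψ : ∀ x ∈ M, ∃ i, q (ψ i) x ≠ 0)
    (hc : ∀ x ∈ M, ∀ i, p (φ i) x ≠ 0 → ∃ j, q (c i j) x ≠ 0)
    (hd : ∀ x ∈ M, ∀ i, q (ψ i) x ≠ 0 → ∃ j, p (d i j) x ≠ 0)
    (hA : ∀ i j, (coordRing (biStratum p q M r φ c i j)
      (quotGen p {φ i} ∪ quotGen q {c i j})).IsAff)
    (hA' : ∀ i j, (coordRing (biStratum q p M s ψ d i j)
      (quotGen p {d i j} ∪ quotGen q {ψ i})).IsAff) :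
    ∑ i, ∑ j, setCls (biStratum p q M r φ c i j) (quotGen p {φ i} ∪ quotGen q {c i j}) =
      ∑ i, ∑ j, setCls (biStratum q p M s ψ d i j) (quotGen p {d i j} ∪ quotGen q {ψ i}) := by
  -- Both sums refine to the same intersections, with the same four families of denominators, so
  -- only the order of summation differs.
  have h1 : ∀ i j, setCls (biStratum q p M s ψ d i j) (quotGen p {d i j} ∪ quotGen q {ψ i}) =
      ∑ i', ∑ j', setCls (biStratum p q M r φ c i' j' ∩ biStratum q p M s ψ d i j)
        (quotGen p {d i j, φ i'} ∪ quotGen q {ψ i, c i' j'}) := by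
    intro i j
    have h := hA' i j
    rw [Set.union_comm] at h ⊢
    rw [cls_biStratum hr hφ hc i j h]
    refine Finset.sum_congr rfl fun i' _ => Finset.sum_congr rfl fun j' _ => ?_
    rw [Set.inter_comm, Set.union_comm, Set.pair_comm (φ i'), Set.pair_comm (c i' j')]
  simp only [h1, cls_biStratum hs hψ hd _ _ (hA _ _)]
  have h2 : ∀ F : ι → Fin N → κ → Fin N' → K0, ∑ i, ∑ j, ∑ i', ∑ j', F i j i' j' =
      ∑ i', ∑ j', ∑ i, ∑ j, F i j i' j' := by
    intro F
    have := Finset.sum_comm (s := Finset.univ) (t := Finset.univ)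
      (f := fun (a : ι × Fin N) (b : κ × Fin N') => F a.1 a.2 b.1 b.2)
    simpa only [Fintype.sum_prod_type] using this
  exact h2 _

end

end

/-! ### Flags with a given first step -/

theorem MultilinearMap.eq_sum_single {n k : ℕ} {Q : Type*} [AddCommGroup Q] [Module ℂ Q]
    (F : MultilinearMap ℂ (fun _ : Fin k => Fin n → ℂ) Q) (w : Fin k → Fin n → ℂ) :
    F w = ∑ g : Fin k → Fin n, (∏ a, w a (g a)) • F fun a => Pi.single (g a) 1 := by
  have h : w = fun a => ∑ i, w a i • (Pi.single i 1 : Fin n → ℂ) :=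
    funext fun a => pi_eq_sum_univ' (w a)
  conv_lhs => rw [h]
  rw [F.map_sum]
  exact Finset.sum_congr rfl fun g _ => F.map_smul_univ _ _

section
variable {n k : ℕ} (S : FlagSection n k)

/-- The value of the section on two families of vectors. -/
def flagVal (w : Fin k → Fin n → ℂ) (w' : Fin (k + 1) → Fin n → ℂ) : ℂ :=
  S (exteriorPower.ιMulti ℂ k w) (exteriorPower.ιMulti ℂ (k + 1) w')

/-- The value of the section as an alternating map of the first family. -/
def flagValLeft (w' : Fin (k + 1) → Fin n → ℂ) : (Fin n → ℂ) [⋀^Fin k]→ₗ[ℂ] ℂ :=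
  (S.flip (exteriorPower.ιMulti ℂ (k + 1) w')).compAlternatingMap (exteriorPower.ιMulti ℂ k)

/-- The value of the section as an alternating map of the second family. -/
def flagValRight (w : Fin k → Fin n → ℂ) : (Fin n → ℂ) [⋀^Fin (k + 1)]→ₗ[ℂ] ℂ :=
  (S (exteriorPower.ιMulti ℂ k w)).compAlternatingMap (exteriorPower.ιMulti ℂ (k + 1))

theorem flagValLeft_apply (w : Fin k → Fin n → ℂ) (w' : Fin (k + 1) → Fin n → ℂ) :
    flagValLeft S w' w = flagVal S w w' := rfl

theorem flagValRight_apply (w : Fin k → Fin n → ℂ) (w' : Fin (k + 1) → Fin n → ℂ) :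
    flagValRight S w w' = flagVal S w w' := rfl

/-- The form is alternating in each argument, so its values on W and W' are multiples, by two
determinants, of its value on spanning families. -/
theorem vanishesAt_iff {W W' : Submodule ℂ (Fin n → ℂ)} {w : Fin k → Fin n → ℂ}
    {w' : Fin (k + 1) → Fin n → ℂ} (hw : Submodule.span ℂ (Set.range w) = W)
    (hw' : Submodule.span ℂ (Set.range w') = W') :
    S.VanishesAt W W' ↔ flagVal S w w' = 0 := by
  subst hw hw'
  constructor
  · exact fun h => h w w' (fun i => Submodule.subset_span (Set.mem_range_self i))
      fun i => Submodule.subset_span (Set.mem_range_self i)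
  · intro h u u' hu hu'
    obtain ⟨A, rfl⟩ := eq_sum_smul_of_mem_span hu
    obtain ⟨A', rfl⟩ := eq_sum_smul_of_mem_span hu'
    change flagVal S _ _ = 0
    rw [← flagValLeft_apply, AlternatingMap.map_sum_smul, flagValLeft_apply,
      ← flagValRight_apply, AlternatingMap.map_sum_smul, flagValRight_apply, h, mul_zero, mul_zero]

/-- Expanded in the standard basis, the value is a polynomial in the entries of the two families. -/
theorem flagVal_mem {X : Type} {A : Subalgebra ℂ (X → ℂ)} {w : X → Fin k → Fin n → ℂ}
    {w' : X → Fin (k + 1) → Fin n → ℂ} (hw : ∀ a i, (fun x => w x a i) ∈ A)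
    (hw' : ∀ a i, (fun x => w' x a i) ∈ A) : (fun x => flagVal S (w x) (w' x)) ∈ A := by
  have h : (fun x => flagVal S (w x) (w' x)) =
      ∑ g : Fin k → Fin n, ∑ g' : Fin (k + 1) → Fin n,
        flagVal S (fun a => Pi.single (g a) 1) (fun a => Pi.single (g' a) 1) •
          ((∏ a, fun x => w x a (g a)) * ∏ a, fun x => w' x a (g' a)) := by
    ext x
    rw [← flagValLeft_apply, ← AlternatingMap.coe_multilinearMap,
      MultilinearMap.eq_sum_single]
    simp only [Finset.sum_apply, Pi.smul_apply, Pi.mul_apply, Finset.prod_apply,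
      AlternatingMap.coe_multilinearMap, flagValLeft_apply]
    refine Finset.sum_congr rfl fun g _ => ?_
    rw [← flagValRight_apply, ← AlternatingMap.coe_multilinearMap,
      MultilinearMap.eq_sum_single, Finset.smul_sum]
    refine Finset.sum_congr rfl fun g' _ => ?_
    simp only [AlternatingMap.coe_multilinearMap, flagValRight_apply, smul_eq_mul]
    ring
  rw [h]
  exact sum_mem fun g _ => sum_mem fun g' _ => A.smul_mem
    (mul_mem (prod_mem fun a _ => hw _ _) (prod_mem fun a _ => hw' _ _)) _

/-- The flags at which the section is zero. -/
def flagSet : Set (Submodule ℂ (Fin n → ℂ) × Submodule ℂ (Fin n → ℂ)) :=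
  {x | x.1 ∈ grassSet n k ∧ x.2 ∈ grassSet n (k + 1) ∧ x.1 ≤ x.2 ∧ S.VanishesAt x.1 x.2}

/-- The Plücker coordinates of the smaller space of a flag. -/
def coordFst (f : Fin k → Fin n) (x : Submodule ℂ (Fin n → ℂ) × Submodule ℂ (Fin n → ℂ)) : ℂ :=
  pluckerCoord f x.1

/-- The Plücker coordinates of the larger space of a flag. -/
def coordSnd (f : Fin (k + 1) → Fin n)
    (x : Submodule ℂ (Fin n → ℂ) × Submodule ℂ (Fin n → ℂ)) : ℂ :=
  pluckerCoord f x.2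

section
variable {w : Fin k → Fin n → ℂ} {f : Fin k → Fin n}
  (hw : ∀ a b, w a (f b) = if a = b then 1 else 0)
include hw

/-- In the expansion along the first row only `x i` survives, with the identity minor of `w` as
cofactor. -/
theorem minor_vecCons {x : Fin n → ℂ} (hx : ∀ b, x (f b) = 0) (i : Fin n) :
    minor (Matrix.vecCons x w) (Matrix.vecCons i f) = x i := by
  rw [minor, Matrix.det_succ_row_zero, Fin.sum_univ_succ, Finset.sum_eq_zero, add_zero]
  · have h := minor_of_eq_one hw
    simp only [minor] at h
    simpa [Matrix.submatrix] using! congrArg (x i * ·) h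
  · intro b _
    simp [hx]

theorem linearIndependent_vecCons {x : Fin n → ℂ} (hx : ∀ b, x (f b) = 0) (hx0 : x ≠ 0) :
    LinearIndependent ℂ (Matrix.vecCons x w) := by
  obtain ⟨i, hi⟩ := Function.ne_iff.1 hx0
  exact linearIndependent_of_minor_ne_zero (f := Matrix.vecCons i f)
    (by rw [minor_vecCons hw hx]; exact hi)

theorem exists_mem_of_lt {W W' : Submodule ℂ (Fin n → ℂ)} (hW : W ∈ grassSet n k)
    (hW' : W' ∈ grassSet n (k + 1)) (h : W ≤ W') (hwW : ∀ a, w a ∈ W) :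
    ∃ x ∈ W', x ≠ 0 ∧ ∀ b, x (f b) = 0 := by
  have hlt : W < W' := lt_of_le_of_ne h fun e => by
    rw [grassSet, Set.mem_ofPred_eq] at hW hW'
    rw [e] at hW
    omega
  obtain ⟨y, hy, hyW⟩ := SetLike.exists_of_lt hlt
  have hs : ∑ b, y (f b) • w b ∈ W := sum_mem fun b _ => W.smul_mem _ (hwW b)
  -- Subtracting the vector of W with the same entries in the columns `f` clears these columns.
  refine ⟨y - ∑ b, y (f b) • w b, sub_mem hy (h hs), fun h0 => ?_, fun b => ?_⟩
  · rw [sub_eq_zero] at h0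
    exact hyW (h0 ▸ hs)
  · simp [hw]

end

/-! ### Coordinates on the fibre P(V/W) -/

section
variable {f : Fin k → Fin n} {N : ℕ} {c : Fin N → Fin n} (hc : Function.Injective c)
  (hcf : ∀ i, i ∈ Set.range c ↔ i ∉ Set.range f)

/-- The vector with coordinates `v` in the places `c`. -/
def placeVec (c : Fin N → Fin n) (v : Fin N → ℂ) : Fin n → ℂ := ∑ i, v i • Pi.single (c i) 1

include hc in
theorem placeVec_apply (v : Fin N → ℂ) (i : Fin N) : placeVec c v (c i) = v i := by
  simp [placeVec, Finset.sum_apply, Pi.single_apply, hc.eq_iff]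

theorem placeVec_eq_zero (v : Fin N → ℂ) {i : Fin n} (hi : i ∉ Set.range c) :
    placeVec c v i = 0 := by
  simp only [placeVec, Finset.sum_apply, Pi.smul_apply, smul_eq_mul]
  refine Finset.sum_eq_zero fun j _ => ?_
  rw [Pi.single_eq_of_ne, mul_zero]
  rintro rfl
  exact hi ⟨j, rfl⟩

include hc hcf in
theorem placeVec_eq {x : Fin n → ℂ} (hx : ∀ b, x (f b) = 0) : placeVec c (fun i => x (c i)) = x := by
  ext i
  by_cases h : i ∈ Set.range c
  · obtain ⟨j, rfl⟩ := h
    exact placeVec_apply hc _ j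
  · rw [placeVec_eq_zero _ h]
    rw [hcf, not_not] at h
    obtain ⟨b, rfl⟩ := h
    exact (hx b).symm

/-- For a fixed W the section is linear in the extra vector; this is the equation of the hyperplane
in P(V/W). -/
theorem flagVal_placeVec (w u : Fin k → Fin n → ℂ) (v : Fin N → ℂ) :
    flagVal S u (Matrix.vecCons (placeVec c v) w) =
      ∑ i, flagVal S u (Matrix.vecCons (Pi.single (c i) 1) w) * v i := by
  let L : (Fin n → ℂ) →ₗ[ℂ] ℂ :=
    { toFun := fun x => flagVal S u (Matrix.vecCons x w)
      map_add' := fun x y => (flagValRight S u).map_vecCons_add w x y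
      map_smul' := fun a x => (flagValRight S u).map_vecCons_smul w a x }
  change L (placeVec c v) = ∑ i, L (Pi.single (c i) 1) * v i
  simp [placeVec, mul_comm]

end

end

section
variable {n k : ℕ} (S : FlagSection n k)

/-- The vector `y` represents the line W'/W in the coordinates off `f`. Its entries are, up to a
common factor, the Plücker coordinates of W' in the columns `i, f`. -/
theorem exists_vecCons_basis {f : Fin k → Fin n} {W W' : Submodule ℂ (Fin n → ℂ)}
    (hW : W ∈ grassSet n k) (hW' : W' ∈ grassSet n (k + 1)) (h : W ≤ W')
    (hf : pluckerCoord f W ≠ 0) : ∃ y ∈ W', y ≠ 0 ∧ (∀ b, y (f b) = 0) ∧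
      Submodule.span ℂ (Set.range (Matrix.vecCons y (normalBasis f W))) = W' ∧
      (∀ i, pluckerCoord (Matrix.vecCons i f) W' ≠ 0 ↔ y i ≠ 0) ∧
      ∀ i j, pluckerCoord (Matrix.vecCons i f) W' / pluckerCoord (Matrix.vecCons j f) W' =
        y i / y j := by
  have hw := normalBasis_apply hW hf
  have hwW := normalBasis_mem hW hf
  obtain ⟨y, hy, hy0, hyf⟩ := exists_mem_of_lt hw hW hW' h hwW
  have hli := linearIndependent_vecCons hw hyf hy0
  have hm : ∀ a, Matrix.vecCons y (normalBasis f W) a ∈ W' :=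
    Fin.cases hy fun a => h (hwW a)
  refine ⟨y, hy, hy0, hyf, span_eq_of_mem hW' hli hm, fun i => ?_, fun i j => ?_⟩
  · rw [pluckerCoord_ne_zero hW' hli hm, minor_vecCons hw hyf]
  · rw [pluckerCoord_div hW' hli hm, minor_vecCons hw hyf, minor_vecCons hw hyf]

/-- The coefficients of the equation for the larger space of a flag with a given smaller space. -/
def lamFst {N : ℕ} (f : Fin k → Fin n) (c : Fin N → Fin n) (i : Fin N)
    (W : Submodule ℂ (Fin n → ℂ)) : ℂ :=
  flagVal S (normalBasis f W) (Matrix.vecCons (Pi.single (c i) 1) (normalBasis f W))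

variable {f : Fin k → Fin n} {N : ℕ} {c : Fin N → Fin n}

theorem lamFst_mem {B : Set (Submodule ℂ (Fin n → ℂ))}
    (hB : ∀ W ∈ B, W ∈ grassSet n k ∧ pluckerCoord f W ≠ 0) (i : Fin N) :
    (fun W : B => lamFst S f c i W) ∈ coordRing B (grassGen f) :=
  flagVal_mem S (normalBasis_mem_coordRing hB) fun a b => by
    refine Fin.cases ?_ (fun a => ?_) a
    · exact const_mem_coordRing _
    · exact normalBasis_mem_coordRing hB a b

theorem exists_coordSnd_ne_zero (hcf : ∀ i, i ∈ Set.range c ↔ i ∉ Set.range f)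
    {W W' : Submodule ℂ (Fin n → ℂ)}
    (hW : W ∈ grassSet n k) (hW' : W' ∈ grassSet n (k + 1)) (h : W ≤ W')
    (hf : pluckerCoord f W ≠ 0) : ∃ i, pluckerCoord (Matrix.vecCons (c i) f) W' ≠ 0 := by
  obtain ⟨y, -, hy0, hyf, -, hne, -⟩ := exists_vecCons_basis hW hW' h hf
  obtain ⟨i, hi⟩ := Function.ne_iff.1 hy0
  obtain ⟨a, rfl⟩ := (hcf i).2 fun ⟨b, hb⟩ => hi (hb ▸ hyf b)
  exact ⟨a, (hne _).2 hi⟩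

theorem placeVec_apply_left (hcf : ∀ i, i ∈ Set.range c ↔ i ∉ Set.range f) (v : Fin N → ℂ) (b : Fin k) : placeVec c v (f b) = 0 :=
  placeVec_eq_zero v fun h => (hcf _).1 h ⟨b, rfl⟩

theorem forall_lamFst_eq_zero_iff (hc : Function.Injective c)
    (hcf : ∀ i, i ∈ Set.range c ↔ i ∉ Set.range f) {W : Submodule ℂ (Fin n → ℂ)} (hW : W ∈ grassSet n k)
    (hf : pluckerCoord f W ≠ 0) : (∀ i, lamFst S f c i W = 0) ↔
      ∀ W' : Submodule ℂ (Fin n → ℂ), Module.finrank ℂ W' = k + 1 → W ≤ W' →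
        S.VanishesAt W W' := by
  have hw := normalBasis_apply hW hf
  have hs := span_normalBasis hW hf
  constructor
  · intro h W' hW' hle
    obtain ⟨y, -, hy0, hyf, hsp, -, -⟩ := exists_vecCons_basis hW hW' hle hf
    rw [vanishesAt_iff S hs hsp, ← placeVec_eq hc hcf hyf, flagVal_placeVec]
    exact Finset.sum_eq_zero fun i _ => by rw [← lamFst, h, zero_mul]
  -- The coefficient at `i` is the value of the section at the flag W ⊂ W + ⟨e_{c i}⟩.
  · intro h i
    have h1 : ∀ b, (Pi.single (c i) 1 : Fin n → ℂ) (f b) = 0 := fun b => by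
      refine Pi.single_eq_of_ne ?_ _
      intro e
      exact (hcf (c i)).1 ⟨i, rfl⟩ ⟨b, e⟩
    have hli := linearIndependent_vecCons hw h1 (by simp)
    refine (vanishesAt_iff S hs rfl).1 (h _ (span_mem_grassSet hli) ?_)
    rw [← hs, Submodule.span_le]
    rintro _ ⟨a, rfl⟩
    rw [hs]
    exact Submodule.subset_span ⟨a.succ, rfl⟩

/-- A flag corresponds to `(W, v)`, where `v` gives the coordinates of W'/W scaled to begin with 1
at `j`. The entries of `v` are ratios of Plücker coordinates of W'; conversely, those ratios are
minors of a matrix built from `v` and the normalized basis of W. -/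
theorem isAff_and_cls_flagPieceFst {N : ℕ} {c : Fin (N + 1) → Fin n} (hc : Function.Injective c)
    (hcf : ∀ i, i ∈ Set.range c ↔ i ∉ Set.range f) {B : Set (Submodule ℂ (Fin n → ℂ))}
    (hB : ∀ W ∈ B, W ∈ grassSet n k ∧ pluckerCoord f W ≠ 0)
    (hA : (coordRing B (grassGen f)).IsAff) (j : Fin (N + 1))
    (E : Set (Submodule ℂ (Fin n → ℂ) × Submodule ℂ (Fin n → ℂ)))
    (hE : ∀ x, x ∈ E ↔ x ∈ flagSet S ∧ x.1 ∈ B ∧ coordSnd (Matrix.vecCons (c j) f) x ≠ 0 ∧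
      ∀ i < j, coordSnd (Matrix.vecCons (c i) f) x = 0) :
    (coordRing E (quotGen coordFst {f} ∪ quotGen coordSnd {Matrix.vecCons (c j) f})).IsAff ∧
    setCls E (quotGen coordFst {f} ∪ quotGen coordSnd {Matrix.vecCons (c j) f}) =
      setCls (hyperPiece (lamFst S f c) B j) (prodGen (grassGen f) (coordGen _)) := by
  rw [quotGen_singleton, quotGen_singleton]
  set K := (Set.range fun g x => coordFst g x / coordFst f x) ∪
    Set.range fun g x => coordSnd g x / coordSnd (Matrix.vecCons (c j) f) x
  have hV := isAff_hyperPiece hA (lamFst_mem S (c := c) hB) j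
  have hspan : ∀ p : hyperPiece (lamFst S f c) B j, ∀ a,
      Matrix.vecCons (placeVec c p.1.2) (normalBasis f p.1.1) a ∈
        Submodule.span ℂ (Set.range (Matrix.vecCons (placeVec c p.1.2) (normalBasis f p.1.1))) :=
    fun p a => Submodule.subset_span (Set.mem_range_self a)
  have hli : ∀ p : hyperPiece (lamFst S f c) B j,
      LinearIndependent ℂ (Matrix.vecCons (placeVec c p.1.2) (normalBasis f p.1.1)) := fun p => by
    obtain ⟨h1, h2⟩ := hB _ p.2.1
    refine linearIndependent_vecCons (normalBasis_apply h1 h2)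
      (placeVec_apply_left hcf _) fun h0 => ?_
    have := placeVec_apply hc p.1.2 j
    rw [h0, p.2.2.1] at this
    exact zero_ne_one this
  have hminor : ∀ (p : hyperPiece (lamFst S f c) B j) i,
      minor (Matrix.vecCons (placeVec c p.1.2) (normalBasis f p.1.1))
        (Matrix.vecCons (c i) f) = p.1.2 i := fun p i => by
    obtain ⟨h1, h2⟩ := hB _ p.2.1
    rw [minor_vecCons (normalBasis_apply h1 h2) (placeVec_apply_left hcf _),
      placeVec_apply hc]
  have hne := fun (p : hyperPiece (lamFst S f c) B j) =>
    pluckerCoord_ne_zero (span_mem_grassSet (hli p)) (hli p) (hspan p)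
  have hdiv := fun (p : hyperPiece (lamFst S f c) B j) =>
    pluckerCoord_div (span_mem_grassSet (hli p)) (hli p) (hspan p)
  let e' : hyperPiece (lamFst S f c) B j → E := fun p =>
    ⟨(p.1.1, Submodule.span ℂ
        (Set.range (Matrix.vecCons (placeVec c p.1.2) (normalBasis f p.1.1)))), (hE _).2 (by
      obtain ⟨h1, h2⟩ := hB _ p.2.1
      have hs := span_normalBasis h1 h2
      refine ⟨⟨h1, span_mem_grassSet (hli p), ?_, ?_⟩, p.2.1, ?_, fun i hi => ?_⟩
      · rw [← hs, Submodule.span_le]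
        rintro _ ⟨a, rfl⟩
        rw [hs]
        exact Submodule.subset_span ⟨a.succ, rfl⟩
      · rw [vanishesAt_iff S hs rfl, flagVal_placeVec]
        exact p.2.2.2.2
      · refine (hne p _).2 ?_
        rw [hminor, p.2.2.1]
        exact one_ne_zero
      · refine of_not_not fun h => (hne p _).1 h ?_
        rw [hminor, p.2.2.2.1 i hi])⟩
  let v : E → Fin (N + 1) → ℂ := fun x i =>
    coordSnd (Matrix.vecCons (c i) f) x.1 / coordSnd (Matrix.vecCons (c j) f) x.1
  have hv : ∀ x : E, ∃ y : Fin n → ℂ, y ∈ x.1.2 ∧ y ≠ 0 ∧ (∀ b, y (f b) = 0) ∧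
      (fun i => y (c i)) = v x := fun x => by
    obtain ⟨⟨h1, h2, h3, h4⟩, h5, h6, h7⟩ := (hE _).1 x.2
    obtain ⟨y, hy, hy0, hyf, -, hyne, hydiv⟩ := exists_vecCons_basis h1 h2 h3 (hB _ h5).2
    have hyj := (hyne _).1 h6
    refine ⟨(y (c j))⁻¹ • y, Submodule.smul_mem _ _ hy, smul_ne_zero (inv_ne_zero hyj) hy0,
      fun b => by simp [hyf], funext fun i => ?_⟩
    refine Eq.trans ?_ (hydiv (c i) (c j)).symm
    rw [Pi.smul_apply, smul_eq_mul, div_eq_inv_mul]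
  have hx : ∀ x : E, Submodule.span ℂ
      (Set.range (Matrix.vecCons (placeVec c (v x)) (normalBasis f x.1.1))) = x.1.2 := fun x => by
    obtain ⟨⟨h1, h2, h3, h4⟩, h5, -⟩ := (hE _).1 x.2
    obtain ⟨y, hy, hy0, hyf, hyv⟩ := hv x
    rw [← hyv, placeVec_eq hc hcf hyf]
    exact span_eq_of_mem h2 (linearIndependent_vecCons (normalBasis_apply h1 (hB _ h5).2) hyf hy0)
      (Fin.cases hy fun a => h3 (normalBasis_mem h1 (hB _ h5).2 a))
  let e : E → hyperPiece (lamFst S f c) B j := fun x => ⟨(x.1.1, v x), by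
    obtain ⟨⟨h1, h2, h3, h4⟩, h5, h6, h7⟩ := (hE _).1 x.2
    refine ⟨h5, div_self h6, fun i hi => ?_, ?_⟩
    · simp only [v, h7 i hi, zero_div]
    · rw [vanishesAt_iff S (span_normalBasis h1 (hB _ h5).2) (hx x), flagVal_placeVec] at h4
      exact h4⟩
  have he : ∀ h ∈ prodGen (grassGen f) (coordGen (Fin (N + 1))), (fun x => h (e x)) ∈ coordRing E
      (K) := by
    rintro _ (⟨_, ⟨g, rfl⟩, rfl⟩ | ⟨_, ⟨i, rfl⟩, rfl⟩)
    · exact gen_mem_coordRing (g := fun x => coordFst g x / coordFst f x) (.inl ⟨g, rfl⟩)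
    · exact gen_mem_coordRing (g := fun x => coordSnd (Matrix.vecCons (c i) f) x /
        coordSnd (Matrix.vecCons (c j) f) x) (.inr ⟨_, rfl⟩)
  have he' : ∀ g ∈ K,
      (fun p => g (e' p)) ∈ coordRing (hyperPiece (lamFst S f c) B j)
        (prodGen (grassGen f) (coordGen _)) := by
    rintro _ (⟨g, rfl⟩ | ⟨g, rfl⟩)
    · exact gen_mem_coordRing
        (g := fun p : Submodule ℂ (Fin n → ℂ) × (Fin (N + 1) → ℂ) =>
          pluckerCoord g p.1 / pluckerCoord f p.1) (.inl ⟨_, ⟨g, rfl⟩, rfl⟩)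
    · have : (fun p : hyperPiece (lamFst S f c) B j => coordSnd g (e' p).1 /
          coordSnd (Matrix.vecCons (c j) f) (e' p).1) = fun p =>
          minor (Matrix.vecCons (placeVec c p.1.2) (normalBasis f p.1.1)) g := funext fun p => by
        refine (hdiv p g _).trans ?_
        rw [hminor, p.2.2.1, div_one]
      dsimp only
      rw [this]
      refine minor_mem (fun a i => ?_) g
      refine Fin.cases ?_ (fun a => ?_) a
      · have h : (fun p : hyperPiece (lamFst S f c) B j => placeVec c p.1.2 i) =
            ∑ b, (Pi.single (c b) 1 : Fin n → ℂ) i • fun p => p.1.2 b := by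
          ext p
          simp [placeVec, mul_comm]
        change (fun p : hyperPiece (lamFst S f c) B j => placeVec c p.1.2 i) ∈ _
        rw [h]
        exact sum_mem fun b _ => Subalgebra.smul_mem _ (coord_snd_mem b) _
      · exact fst_mem (V := Set.univ) (f := fun W => normalBasis f W a i)
          (fun p hp => ⟨hp.1, trivial⟩) (normalBasis_mem_coordRing hB a i)
  have hl : ∀ x, (e' (e x)).1 = x.1 := fun x => Prod.ext rfl (hx x)
  have hr : ∀ h ∈ prodGen (grassGen f) (coordGen (Fin (N + 1))), ∀ p, h (e (e' p)) = h p := by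
    rintro _ (⟨_, ⟨g, rfl⟩, rfl⟩ | ⟨_, ⟨i, rfl⟩, rfl⟩) p
    · rfl
    · refine (hdiv p _ _).trans ?_
      rw [hminor, hminor, p.2.2.1, div_one]
  exact ⟨isAff_of_equiv hV e e' he he' (fun g _ x => congrArg g (hl x)) hr,
    cls_eq_of_equiv hV e e' he he' (fun g _ x => congrArg g (hl x)) hr⟩

end

/-! ### Flags with a given second step -/

section
variable {n k : ℕ}

theorem exists_succAbove_perm {v : Fin k → Fin (k + 1)} (h : Function.Injective v) :
    ∃ (a : Fin (k + 1)) (σ : Equiv.Perm (Fin k)), v = a.succAbove ∘ σ := by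
  obtain ⟨a, ha⟩ : ∃ a, ∀ t, v t ≠ a := by
    by_contra! hc
    have := Fintype.card_le_of_surjective v hc
    simp at this
  choose σ hσ using fun t => Fin.exists_succAbove_eq (ha t)
  have hi : Function.Injective σ := fun s t hst => h (by rw [← hσ, ← hσ, hst])
  exact ⟨a, Equiv.ofBijective σ (Finite.injective_iff_bijective.1 hi), funext fun t => (hσ t).symm⟩

theorem minor_single_succAbove (a b : Fin (k + 1)) :
    minor (fun t => (Pi.single (a.succAbove t) 1 : Fin (k + 1) → ℂ)) b.succAbove =
      if a = b then 1 else 0 := by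
  split_ifs with h
  · subst h
    refine minor_of_eq_one fun s t => ?_
    simp [Pi.single_apply, eq_comm]
  · obtain ⟨t, ht⟩ := Fin.exists_succAbove_eq h
    refine Matrix.det_eq_zero_of_column_eq_zero t fun s => ?_
    simp [ht, Pi.single_apply, (Fin.succAbove_ne a s).symm]

/-- An alternating form on `k` combinations of `k + 1` vectors, in terms of minors. -/
theorem AlternatingMap.map_sum_smul_succ {V : Type*} [AddCommGroup V] [Module ℂ V]
    (F : V [⋀^Fin k]→ₗ[ℂ] ℂ) (U : Fin k → Fin (k + 1) → ℂ) (m : Fin (k + 1) → V) :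
    F (fun t => ∑ a, U t a • m a) =
      ∑ a : Fin (k + 1), minor U a.succAbove * F (m ∘ a.succAbove) := by
  let F₁ : (Fin (k + 1) → ℂ) [⋀^Fin k]→ₗ[ℂ] ℂ :=
    F.compLinearMap (Fintype.linearCombination ℂ m)
  let F₂ : (Fin (k + 1) → ℂ) [⋀^Fin k]→ₗ[ℂ] ℂ :=
    ∑ a : Fin (k + 1), F (m ∘ a.succAbove) • minorMap a.succAbove
  have hF₂ : ∀ u, F₂ u = ∑ a : Fin (k + 1), F (m ∘ a.succAbove) * minor u a.succAbove := fun u => by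
    change AlternatingMap.toMultilinearMapLM (S := ℂ) F₂ u = _
    rw [map_sum, sum_apply]
    rfl
  have key : F₁ = F₂ := by
    -- Alternating maps need only be compared on injective families of basis vectors, and these omit
    -- one index and permute the rest.
    refine (Pi.basisFun ℂ (Fin (k + 1))).ext_alternating fun v hv => ?_
    obtain ⟨a, σ, rfl⟩ := exists_succAbove_perm hv
    have h : (fun i => Pi.basisFun ℂ (Fin (k + 1)) ((a.succAbove ∘ σ) i)) =
        (fun t => (Pi.single (a.succAbove t) 1 : Fin (k + 1) → ℂ)) ∘ σ := by
      ext; simp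
    rw [h, F₁.map_perm, F₂.map_perm]
    congr 1
    have h1 : F₁ (fun t => (Pi.single (a.succAbove t) 1 : Fin (k + 1) → ℂ)) =
        F (m ∘ a.succAbove) := by
      simp only [F₁, AlternatingMap.compLinearMap_apply]
      congr 1
      ext t
      simp
    rw [h1]
    simp [hF₂, minor_single_succAbove]
  have h := DFunLike.congr_fun key U
  rw [hF₂] at h
  simp only [mul_comm (minor U _)]
  exact h

/-- This is the expansion of a determinant with a repeated row: the signed minors are the
coefficients of a linear form that vanishes on the rows. -/
theorem sum_mul_minor_succAbove (U : Fin k → Fin (k + 1) → ℂ) (t : Fin k) :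
    ∑ a : Fin (k + 1), (-1) ^ (a : ℕ) * U t a * minor U a.succAbove = 0 := by
  have h : (Matrix.of (Matrix.vecCons (U t) U)).det = 0 :=
    Matrix.det_zero_of_row_eq (Fin.succ_ne_zero t).symm (by ext; simp)
  rw [Matrix.det_succ_row_zero] at h
  rw [← h]
  rfl

/-- The `k` vectors with the minors `ξ`, up to sign, for `ξ i = 1`. -/
def kerMat (i : Fin (k + 1)) (ξ : Fin (k + 1) → ℂ) (t : Fin k) (a : Fin (k + 1)) : ℂ :=
  if a = i then -((-1) ^ ((i : ℕ) + (i.succAbove t : ℕ)) * ξ (i.succAbove t))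
    else if a = i.succAbove t then 1 else 0

theorem kerMat_succAbove (i : Fin (k + 1)) (ξ : Fin (k + 1) → ℂ) (s t : Fin k) :
    kerMat i ξ s (i.succAbove t) = if s = t then 1 else 0 := by
  simp [kerMat, eq_comm]

/-- In the relation above for row `t` only the columns `i` and `i.succAbove t` survive, and it can
be solved for the entry in column `i`. -/
theorem minor_succAbove_of_normal {i : Fin (k + 1)} {U : Fin k → Fin (k + 1) → ℂ}
    (hU : ∀ s t, U s (i.succAbove t) = if s = t then 1 else 0) (t : Fin k) :
    U t i = -((-1) ^ ((i : ℕ) + (i.succAbove t : ℕ)) * minor U (i.succAbove t).succAbove) := by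
  have h := sum_mul_minor_succAbove U t
  rw [Fin.sum_univ_succAbove _ i, minor_of_eq_one hU] at h
  simp only [hU, mul_ite, mul_one, mul_zero, ite_mul, zero_mul, Finset.sum_ite_eq,
    Finset.mem_univ, if_true] at h
  have h1 : ((-1) ^ (i : ℕ) * (-1) ^ (i : ℕ) : ℂ) = 1 := by
    rw [← mul_pow]; simp
  rw [pow_add]
  linear_combination (-1) ^ (i : ℕ) * h - U t i * h1

/-- The entry in column `i` is a signed `ξ` by definition and the same signed minor by the relation.
Thus every normalized point of the dual projective space is realized by an explicit hyperplane. -/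
theorem minor_kerMat {i : Fin (k + 1)} {ξ : Fin (k + 1) → ℂ} (hξ : ξ i = 1) (a : Fin (k + 1)) :
    minor (kerMat i ξ) a.succAbove = ξ a := by
  have hU := kerMat_succAbove i ξ
  by_cases h : a = i
  · subst h
    rw [minor_of_eq_one hU, hξ]
  · obtain ⟨t, rfl⟩ := Fin.exists_succAbove_eq h
    have h1 := minor_succAbove_of_normal hU t
    rw [kerMat, if_pos rfl, neg_inj] at h1
    exact (mul_left_cancel₀ (pow_ne_zero _ (by simp)) h1).symm

theorem eq_kerMat {i : Fin (k + 1)} {U : Fin k → Fin (k + 1) → ℂ}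
    (hU : ∀ s t, U s (i.succAbove t) = if s = t then 1 else 0) :
    U = kerMat i fun a => minor U a.succAbove := by
  ext t a
  by_cases h : a = i
  · subst h
    rw [kerMat, if_pos rfl, minor_succAbove_of_normal hU]
  · obtain ⟨s, rfl⟩ := Fin.exists_succAbove_eq h
    rw [hU, kerMat_succAbove]

/-! ### Hyperplanes in a fixed larger space -/

variable (S : FlagSection n k)

/-- The coefficients of the equation for the smaller space of a flag with a given larger space. -/
def lamSnd (f : Fin (k + 1) → Fin n) (a : Fin (k + 1)) (W' : Submodule ℂ (Fin n → ℂ)) : ℂ :=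
  flagVal S (normalBasis f W' ∘ a.succAbove) (normalBasis f W')

variable {f : Fin (k + 1) → Fin n}

theorem lamSnd_mem {B : Set (Submodule ℂ (Fin n → ℂ))}
    (hB : ∀ W' ∈ B, W' ∈ grassSet n (k + 1) ∧ pluckerCoord f W' ≠ 0) (i : Fin (k + 1)) :
    (fun W' : B => lamSnd S f i W') ∈ coordRing B (grassGen f) :=
  flagVal_mem S (fun a => normalBasis_mem_coordRing hB (i.succAbove a))
    (normalBasis_mem_coordRing hB)

/-- For a fixed W' the section is linear in the `k + 1` minors of `U`, the homogeneous coordinates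
of W in the dual projective space of W'. -/
theorem flagVal_sum_smul (U : Fin k → Fin (k + 1) → ℂ) (W' : Submodule ℂ (Fin n → ℂ)) :
    flagVal S (fun t => ∑ a, U t a • normalBasis f W' a) (normalBasis f W') =
      ∑ a, lamSnd S f a W' * minor U a.succAbove := by
  rw [← flagValLeft_apply, AlternatingMap.map_sum_smul_succ]
  exact Finset.sum_congr rfl fun a _ => mul_comm _ _

theorem exists_eq_sum_normalBasis {W W' : Submodule ℂ (Fin n → ℂ)}
    (hW' : W' ∈ grassSet n (k + 1)) (h : W ≤ W') (hf : pluckerCoord f W' ≠ 0)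
    {w : Fin k → Fin n → ℂ} (hw : ∀ t, w t ∈ W) : ∃ U : Fin k → Fin (k + 1) → ℂ,
      (w = fun t => ∑ a, U t a • normalBasis f W' a) ∧ (∀ t a, U t a = w t (f a)) ∧
      ∀ g, minor w (f ∘ g) = minor U g := by
  obtain ⟨U, rfl⟩ := eq_sum_smul_of_mem_span (w := normalBasis f W') (u := w) fun t => by
    rw [span_normalBasis hW' hf]
    exact h (hw t)
  have hn := normalBasis_apply hW' hf
  exact ⟨U, rfl, fun t a => by simp [hn], minor_sum_smul U _ f hn⟩

/-- Every Plücker coordinate of W is a combination of those with columns in `f`, so these cannot all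
vanish. -/
theorem exists_coordFst_ne_zero {W W' : Submodule ℂ (Fin n → ℂ)}
    (hW : W ∈ grassSet n k) (hW' : W' ∈ grassSet n (k + 1)) (h : W ≤ W')
    (hf : pluckerCoord f W' ≠ 0) : ∃ i : Fin (k + 1), pluckerCoord (f ∘ i.succAbove) W ≠ 0 := by
  obtain ⟨U, hU, -, hm⟩ := exists_eq_sum_normalBasis hW' h hf (grassBasis_mem hW)
  obtain ⟨I, hI⟩ := exists_pluckerCoord_ne_zero hW
  by_contra! h0
  have h1 : ∀ i : Fin (k + 1), minor U i.succAbove = 0 := fun i => by rw [← hm]; exact h0 i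
  rw [pluckerCoord, ← minorMap_apply, hU, AlternatingMap.map_sum_smul_succ] at hI
  simp [h1] at hI

theorem forall_lamSnd_eq_zero_iff {W' : Submodule ℂ (Fin n → ℂ)} (hW' : W' ∈ grassSet n (k + 1))
    (hf : pluckerCoord f W' ≠ 0) : (∀ i, lamSnd S f i W' = 0) ↔
      ∀ W : Submodule ℂ (Fin n → ℂ), Module.finrank ℂ W = k → W ≤ W' → S.VanishesAt W W' := by
  have hn := normalBasis_apply hW' hf
  have hs := span_normalBasis hW' hf
  constructor
  · intro h W hW hle
    obtain ⟨U, hU, -, -⟩ := exists_eq_sum_normalBasis hW' hle hf (grassBasis_mem hW)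
    rw [vanishesAt_iff S (grassBasis_spec hW).2 hs, hU, flagVal_sum_smul]
    exact Finset.sum_eq_zero fun a _ => by rw [h, zero_mul]
  · intro h i
    have hli : LinearIndependent ℂ (normalBasis f W' ∘ i.succAbove) :=
      linearIndependent_of_eq_one (f := f ∘ i.succAbove) fun a b => by simp [hn]
    refine (vanishesAt_iff S rfl hs).1 (h _ (span_mem_grassSet hli) ?_)
    rw [Submodule.span_le]
    rintro _ ⟨a, rfl⟩
    exact normalBasis_mem hW' hf _

/-- The basis of the smaller space of a flag with Plücker coordinates proportional to `ξ`. -/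
def kerBasis (f : Fin (k + 1) → Fin n) (i : Fin (k + 1)) (ξ : Fin (k + 1) → ℂ)
    (W' : Submodule ℂ (Fin n → ℂ)) : Fin k → Fin n → ℂ :=
  fun t => ∑ a, kerMat i ξ t a • normalBasis f W' a

theorem kerBasis_eq (f : Fin (k + 1) → Fin n) (i : Fin (k + 1)) (ξ : Fin (k + 1) → ℂ)
    (W' : Submodule ℂ (Fin n → ℂ)) : kerBasis f i ξ W' =
      fun t => ∑ a, kerMat i ξ t a • normalBasis f W' a := rfl

/-- A flag corresponds to `(W', ξ)`, where `ξ` is the vector of minors of W relative to the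
normalized basis of W', scaled to begin with 1 at `i`. The inverse is `kerBasis`, polynomial in `ξ`
and that basis, so both directions pull functions back to functions. -/
theorem isAff_and_cls_flagPieceSnd {B : Set (Submodule ℂ (Fin n → ℂ))}
    (hB : ∀ W' ∈ B, W' ∈ grassSet n (k + 1) ∧ pluckerCoord f W' ≠ 0)
    (hA : (coordRing B (grassGen f)).IsAff) (i : Fin (k + 1))
    (E : Set (Submodule ℂ (Fin n → ℂ) × Submodule ℂ (Fin n → ℂ)))
    (hE : ∀ x, x ∈ E ↔ x ∈ flagSet S ∧ x.2 ∈ B ∧ coordFst (f ∘ i.succAbove) x ≠ 0 ∧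
      ∀ a < i, coordFst (f ∘ a.succAbove) x = 0) :
    (coordRing E (quotGen coordFst {f ∘ i.succAbove} ∪ quotGen coordSnd {f})).IsAff ∧
    setCls E (quotGen coordFst {f ∘ i.succAbove} ∪ quotGen coordSnd {f}) =
      setCls (hyperPiece (lamSnd S f) B i) (prodGen (grassGen f) (coordGen _)) := by
  rw [quotGen_singleton, quotGen_singleton]
  set K := (Set.range fun g x => coordFst g x / coordFst (f ∘ i.succAbove) x) ∪
    Set.range fun g x => coordSnd g x / coordSnd f x
  have hV := isAff_hyperPiece hA (lamSnd_mem S hB) i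
  have hspan : ∀ p : hyperPiece (lamSnd S f) B i, ∀ a, kerBasis f i p.1.2 p.1.1 a ∈
        Submodule.span ℂ (Set.range (kerBasis f i p.1.2 p.1.1)) :=
    fun p a => Submodule.subset_span (Set.mem_range_self a)
  have hminor : ∀ (p : hyperPiece (lamSnd S f) B i) (a : Fin (k + 1)),
      minor (kerBasis f i p.1.2 p.1.1) (f ∘ a.succAbove) = p.1.2 a := fun p a => by
    obtain ⟨h1, h2⟩ := hB _ p.2.1
    rw [kerBasis_eq, minor_sum_smul _ _ _ (normalBasis_apply h1 h2), minor_kerMat p.2.2.1]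
  have hli : ∀ p : hyperPiece (lamSnd S f) B i,
      LinearIndependent ℂ (kerBasis f i p.1.2 p.1.1) := fun p =>
    linearIndependent_of_minor_ne_zero (f := f ∘ i.succAbove) (by
      rw [hminor, p.2.2.1]
      exact one_ne_zero)
  have hne := fun (p : hyperPiece (lamSnd S f) B i) =>
    pluckerCoord_ne_zero (span_mem_grassSet (hli p)) (hli p) (hspan p)
  have hdiv := fun (p : hyperPiece (lamSnd S f) B i) =>
    pluckerCoord_div (span_mem_grassSet (hli p)) (hli p) (hspan p)
  let e' : hyperPiece (lamSnd S f) B i → E := fun p =>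
    ⟨(Submodule.span ℂ (Set.range (kerBasis f i p.1.2 p.1.1)), p.1.1), (hE _).2 (by
      obtain ⟨h1, h2⟩ := hB _ p.2.1
      refine ⟨⟨span_mem_grassSet (hli p), h1, ?_, ?_⟩, p.2.1, ?_, fun a ha => ?_⟩
      · rw [Submodule.span_le]
        rintro _ ⟨t, rfl⟩
        exact sum_mem fun a _ => Submodule.smul_mem _ _ (normalBasis_mem h1 h2 a)
      · rw [vanishesAt_iff S rfl (span_normalBasis h1 h2), kerBasis_eq, flagVal_sum_smul]
        simp only [minor_kerMat p.2.2.1]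
        exact p.2.2.2.2
      · refine (hne p _).2 ?_
        rw [hminor, p.2.2.1]
        exact one_ne_zero
      · refine of_not_not fun h => (hne p _).1 h ?_
        rw [hminor, p.2.2.2.1 a ha])⟩
  let v : E → Fin (k + 1) → ℂ := fun x a =>
    coordFst (f ∘ a.succAbove) x.1 / coordFst (f ∘ i.succAbove) x.1
  have hx : ∀ x : E, Submodule.span ℂ (Set.range (kerBasis f i (v x) x.1.2)) = x.1.1 := fun x => by
    obtain ⟨⟨h1, h2, h3, h4⟩, h5, h6, h7⟩ := (hE _).1 x.2
    have hn := normalBasis_apply h1 h6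
    obtain ⟨U, hU, hUf, hm⟩ := exists_eq_sum_normalBasis h2 h3 (hB _ h5).2 (normalBasis_mem h1 h6)
    -- The normalized basis of W has the ratios of Plücker coordinates as its minors, so `eq_kerMat`
    -- recovers its coefficient matrix from `v x`.
    have hv : v x = fun a : Fin (k + 1) => minor U a.succAbove := funext fun a => by
      rw [← hm]
      exact pluckerCoord_div_eq h1 hn (normalBasis_mem h1 h6) _
    rw [hv, kerBasis_eq, ← eq_kerMat fun s t => by rw [hUf]; exact hn s t, ← hU]
    exact span_normalBasis h1 h6
  let e : E → hyperPiece (lamSnd S f) B i := fun x => ⟨(x.1.2, v x), by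
    obtain ⟨⟨h1, h2, h3, h4⟩, h5, h6, h7⟩ := (hE _).1 x.2
    have hvi : v x i = 1 := div_self h6
    refine ⟨h5, hvi, fun a ha => ?_, ?_⟩
    · simp only [v, h7 a ha, zero_div]
    · rw [vanishesAt_iff S (hx x) (span_normalBasis h2 (hB _ h5).2), kerBasis_eq,
        flagVal_sum_smul] at h4
      simp only [minor_kerMat hvi] at h4
      exact h4⟩
  have he : ∀ h ∈ prodGen (grassGen f) (coordGen (Fin (k + 1))),
      (fun x => h (e x)) ∈ coordRing E K := by
    rintro _ (⟨_, ⟨g, rfl⟩, rfl⟩ | ⟨_, ⟨a, rfl⟩, rfl⟩)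
    · exact gen_mem_coordRing (g := fun x => coordSnd g x / coordSnd f x) (.inr ⟨g, rfl⟩)
    · exact gen_mem_coordRing (g := fun x => coordFst (f ∘ a.succAbove) x /
        coordFst (f ∘ i.succAbove) x) (.inl ⟨_, rfl⟩)
  have he' : ∀ g ∈ K, (fun p => g (e' p)) ∈ coordRing (hyperPiece (lamSnd S f) B i)
        (prodGen (grassGen f) (coordGen _)) := by
    rintro _ (⟨g, rfl⟩ | ⟨g, rfl⟩)
    · have : (fun p : hyperPiece (lamSnd S f) B i => coordFst g (e' p).1 /
          coordFst (f ∘ i.succAbove) (e' p).1) = fun p =>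
          minor (kerBasis f i p.1.2 p.1.1) g := funext fun p => by
        refine (hdiv p g _).trans ?_
        rw [hminor, p.2.2.1, div_one]
      dsimp only
      rw [this]
      refine minor_mem (fun t b => ?_) g
      have h : (fun p : hyperPiece (lamSnd S f) B i => kerBasis f i p.1.2 p.1.1 t b) =
          ∑ a, (fun p => kerMat i p.1.2 t a) * fun p => normalBasis f p.1.1 a b := by
        ext p
        simp [kerBasis]
      rw [h]
      refine sum_mem fun a _ => mul_mem ?_ ?_
      · simp only [kerMat]
        split_ifs
        · exact neg_mem (mul_mem (const_mem_coordRing _) (coord_snd_mem _))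
        · exact const_mem_coordRing _
        · exact const_mem_coordRing _
      · exact fst_mem (V := Set.univ) (f := fun W => normalBasis f W a b)
          (fun p hp => ⟨hp.1, trivial⟩) (normalBasis_mem_coordRing hB a b)
    · exact gen_mem_coordRing
        (g := fun p : Submodule ℂ (Fin n → ℂ) × (Fin (k + 1) → ℂ) =>
          pluckerCoord g p.1 / pluckerCoord f p.1) (.inl ⟨_, ⟨g, rfl⟩, rfl⟩)
  have hl : ∀ x, (e' (e x)).1 = x.1 := fun x => Prod.ext (hx x) rfl
  have hr : ∀ h ∈ prodGen (grassGen f) (coordGen (Fin (k + 1))), ∀ p, h (e (e' p)) = h p := by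
    rintro _ (⟨_, ⟨g, rfl⟩, rfl⟩ | ⟨_, ⟨a, rfl⟩, rfl⟩) p
    · rfl
    · refine (hdiv p _ _).trans ?_
      rw [hminor, hminor, p.2.2.1, div_one]
  exact ⟨isAff_of_equiv hV e e' he he' (fun g _ x => congrArg g (hl x)) hr,
    cls_eq_of_equiv hV e e' he he' (fun g _ x => congrArg g (hl x)) hr⟩

end

/-! ### The relation between the zero loci -/

section
variable {n k : ℕ}

theorem isAff_grassStratum (r : (Fin k ↪o Fin n) → ℕ) (I : Fin k ↪o Fin n) :
    (coordRing (stratum r (fun J => pluckerCoord J) (grassSet n k) I) (grassGen I)).IsAff := by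
  refine (isAff_grassChart I).of_closed (fun W h => ⟨h.1, h.2.1⟩) fun W h h' => ?_
  obtain ⟨J, hJ, hJ'⟩ : ∃ J, r J < r I ∧ pluckerCoord J W ≠ 0 := by
    by_contra! hc
    exact h' ⟨h.1, h.2, hc⟩
  exact ⟨fun W => pluckerCoord J W / pluckerCoord I W,
    gen_mem_coordRing (g := fun W => pluckerCoord J W / pluckerCoord I W) ⟨J, rfl⟩,
    fun V hV => by simp [hV.2.2 J hJ], div_ne_zero hJ' h.2⟩

/-- The class of a family of hyperplanes over the Grassmannian. -/
theorem sum_cls_hyperPiece_grass [Fintype (Fin k ↪o Fin n)] {r : (Fin k ↪o Fin n) → ℕ}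
    (hr : Function.Injective r) {M : ℕ}
    (lam : (Fin k ↪o Fin n) → Fin (M + 1) → Submodule ℂ (Fin n → ℂ) → ℂ)
    (hlam : ∀ (I : Fin k ↪o Fin n) (B : Set (Submodule ℂ (Fin n → ℂ))),
      (∀ W ∈ B, W ∈ grassSet n k ∧ pluckerCoord I W ≠ 0) →
        ∀ i, (fun W : B => lam I i W) ∈ coordRing B (grassGen I))
    {𝒲 : Set (Submodule ℂ (Fin n → ℂ))} (h𝒲 : 𝒲 ⊆ grassSet n k)
    (hmem : ∀ (I : Fin k ↪o Fin n), ∀ W ∈ grassSet n k, pluckerCoord I W ≠ 0 →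
      (W ∈ 𝒲 ↔ ∀ i, lam I i W = 0)) :
    ∑ I : Fin k ↪o Fin n, ∑ j, setCls
      (hyperPiece (lam I) (stratum r (fun J => pluckerCoord J) (grassSet n k) I) j)
        (prodGen (grassGen I) (coordGen _)) =
      (grassmannian n k).cls * geomL M + (grassSubvariety n k 𝒲).cls * lefschetz ^ M := by
  have h1 : (grassmannian n k).cls =
      ∑ I, setCls (stratum r (fun J => pluckerCoord J) (grassSet n k) I) (grassGen I) :=
    grassSubvariety_cls subset_rfl (fun I => isAff_grassChart I) r hr
  have h2 : (grassSubvariety n k 𝒲).cls =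
      ∑ I, setCls (stratum r (fun J => pluckerCoord J) 𝒲 I) (grassGen I) := by
    refine grassSubvariety_cls h𝒲 (fun I => ?_) r hr
    have : 𝒲 ∩ {W | pluckerCoord I W ≠ 0} = (grassSet n k ∩ {W | pluckerCoord I W ≠ 0}) ∩
        {W | ∀ i ∈ Set.univ, lam I i W = 0} := by
      ext W
      constructor
      · rintro ⟨h, h'⟩
        exact ⟨⟨h𝒲 h, h'⟩, fun i _ => (hmem I W (h𝒲 h) h').1 h i⟩
      · rintro ⟨⟨h, h'⟩, h''⟩
        exact ⟨(hmem I W h h').2 fun i => h'' i trivial, h'⟩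
    rw [this]
    exact (isAff_grassChart I).zeroSets _ (hlam I _ fun W h => h)
  rw [h1, h2, Finset.sum_mul, Finset.sum_mul, ← Finset.sum_add_distrib]
  refine Finset.sum_congr rfl fun I _ => ?_
  rw [sum_cls_hyperPiece (isAff_grassStratum r I) (hlam I _ fun W h => ⟨h.1, h.2.1⟩)]
  congr 3
  ext W
  constructor
  · rintro ⟨⟨h, h'⟩, h''⟩
    exact ⟨(hmem I W h h'.1).2 h'', h'⟩
  · rintro ⟨h, h'⟩
    exact ⟨⟨h𝒲 h, h'⟩, (hmem I W (h𝒲 h) h'.1).1 h⟩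

theorem exists_complement {N : ℕ} (h : n = k + N) (I : Fin k ↪o Fin n) :
    ∃ c : Fin N → Fin n, Function.Injective c ∧ ∀ i, i ∈ Set.range c ↔ i ∉ Set.range I := by
  let s : Finset (Fin n) := (Finset.univ.map I.toEmbedding)ᶜ
  have hs : s.card = N := by
    rw [Finset.card_compl, Finset.card_map, Finset.card_univ, Fintype.card_fin, Fintype.card_fin]
    omega
  refine ⟨s.orderEmbOfFin hs, (s.orderEmbOfFin hs).injective, fun i => ?_⟩
  rw [Finset.range_orderEmbOfFin]
  simp [s]

variable (S : FlagSection n k)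

/-- Both sides compute the class of the zero set of the section in the flag variety, by its fibres
over the two Grassmannians: the left has fibres in P^M, the right in P^k. -/
theorem FlagSection.relation {M : ℕ} (hn : n = k + (M + 1)) :
    (grassmannian n k).cls * geomL M + S.Y₁.cls * lefschetz ^ M =
      (grassmannian n (k + 1)).cls * geomL k + S.Y₂.cls * lefschetz ^ k := by
  let := Fintype.ofFinite (Fin k ↪o Fin n)
  let := Fintype.ofFinite (Fin (k + 1) ↪o Fin n)
  choose c hc hcf using exists_complement (n := n) (k := k) hn
  let r : (Fin k ↪o Fin n) → ℕ := fun I => Fintype.equivFin _ I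
  let s : (Fin (k + 1) ↪o Fin n) → ℕ := fun I => Fintype.equivFin _ I
  have hr : Function.Injective r := Fin.val_injective.comp (Equiv.injective _)
  have hs : Function.Injective s := Fin.val_injective.comp (Equiv.injective _)
  have hfst : ∀ I j, _ := fun (I : Fin k ↪o Fin n) (j : Fin (M + 1)) =>
    isAff_and_cls_flagPieceFst S (hc I) (hcf I)
      (B := stratum r (fun J => pluckerCoord J) (grassSet n k) I) (fun W h => ⟨h.1, h.2.1⟩)
      (isAff_grassStratum r I) j
      (biStratum coordFst coordSnd (flagSet S) r (fun I => I)
        (fun I j => Matrix.vecCons (c I j) I) I j) fun x => by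
      simp only [biStratum, stratum, Set.mem_inter_iff, Set.mem_ofPred_eq, coordFst, flagSet,
        Fin.val_fin_lt]
      tauto
  have hsnd : ∀ J i, _ := fun (J : Fin (k + 1) ↪o Fin n) (i : Fin (k + 1)) =>
    isAff_and_cls_flagPieceSnd S
      (B := stratum s (fun J => pluckerCoord J) (grassSet n (k + 1)) J) (fun W h => ⟨h.1, h.2.1⟩)
      (isAff_grassStratum s J) i
      (biStratum coordSnd coordFst (flagSet S) s (fun J => J)
        (fun J i => J ∘ i.succAbove) J i) fun x => by
      simp only [biStratum, stratum, Set.mem_inter_iff, Set.mem_ofPred_eq, coordSnd, flagSet,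
        Fin.val_fin_lt]
      tauto
  -- One stratification takes the first nonzero coordinate of W and then that of W'/W; the other
  -- starts with W' and then uses the coordinates of W in W'.
  have key := sum_cls_biStratum (p := coordFst) (q := coordSnd) (M := flagSet S)
    (φ := fun I : Fin k ↪o Fin n => I) (ψ := fun J : Fin (k + 1) ↪o Fin n => J)
    (c := fun I j => Matrix.vecCons (c I j) I) (d := fun J i => J ∘ i.succAbove) hr hs
    (fun x hx => exists_pluckerCoord_ne_zero hx.1)
    (fun x hx => exists_pluckerCoord_ne_zero hx.2.1)
    (fun x hx I h => exists_coordSnd_ne_zero (hcf I) hx.1 hx.2.1 hx.2.2.1 h)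
    (fun x hx J h => exists_coordFst_ne_zero hx.1 hx.2.1 hx.2.2.1 h)
    (fun I j => (hfst I j).1) (fun J i => (hsnd J i).1)
  rw [Finset.sum_congr rfl fun I _ => Finset.sum_congr rfl fun j _ => (hfst I j).2,
    Finset.sum_congr rfl fun J _ => Finset.sum_congr rfl fun i _ => (hsnd J i).2,
    sum_cls_hyperPiece_grass hr (fun I => lamFst S I (c I)) (fun I B hB => lamFst_mem S hB)
      (𝒲 := {W | Module.finrank ℂ W = k ∧ ∀ W' : Submodule ℂ (Fin n → ℂ),
        Module.finrank ℂ W' = k + 1 → W ≤ W' → S.VanishesAt W W'}) (fun W h => h.1)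
      (fun I W hW hI => by
        rw [forall_lamFst_eq_zero_iff S (hc I) (hcf I) hW hI]
        exact and_iff_right hW),
    sum_cls_hyperPiece_grass hs (fun J => lamSnd S J) (fun J B hB => lamSnd_mem S hB)
      (𝒲 := {W' | Module.finrank ℂ W' = k + 1 ∧ ∀ W : Submodule ℂ (Fin n → ℂ),
        Module.finrank ℂ W = k → W ≤ W' → S.VanishesAt W W'}) (fun W h => h.1)
      (fun J W' hW' hJ => by
        rw [forall_lamSnd_eq_zero_iff S hW' hJ]
        exact and_iff_right hW')] at key
  exact key

end

theorem mainTheorem9 (n k : ℕ) (hk : 1 ≤ k) (hkn : k + 1 < n) (S : FlagSection n k) :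
    lefschetz ^ k * S.Y₂.cls - lefschetz ^ (n - k - 1) * S.Y₁.cls
      + (grassmannian n (k + 1)).cls * (projectiveSpace (k - 1)).cls
      - (grassmannian n k).cls * (projectiveSpace (n - k - 2)).cls = 0 := by
  -- P(V/W) has dimension `n - k - 1`. Since `geomL m` is the class of P^{m-1} for positive `m`, the
  -- indices drop by one, and `hk` and `hkn` keep the natural subtractions exact.
  have h := S.relation (M := n - k - 1) (by omega)
  rw [projectiveSpace_cls, projectiveSpace_cls, Nat.sub_add_cancel hk,
    show n - k - 2 + 1 = n - k - 1 by omega]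
  linear_combination -h
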